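/- **Setting.** Fix real constants $g_x<0$, $g_v<0$, $v_0\neq 0$ and $\rho_{v,\pm1}$ with $\rho_{v,-1}+1+\rho_{v,1}=0$, and put $\rho_{x,0}=\rho_{v,0}=1$, $\rho_{x,\pm1}=-\tfrac12$. For $N\ge 1$ let $S_N$ be the following linear system for the positions $z_0,\dots,z_N$ of $N+1$ agents. The leader moves as $z_0(t)=0$ for $t<0$ and $z_0(t)=v_0t$ for $t\ge 0$. The agents $1,\dots,N$ are at rest at $0$ for $t\le 0$ and have continuous velocities, and for $t>0$ $$\ddot z_k=g_x\left[\rho_{x,-1}z_{k-1}+\rho_{x,0}z_k+\rho_{x,1}z_{k+1}\right]+g_v\left[\rho_{v,-1}\dot z_{k-1}+\rho_{v,0}\dot z_k+\rho_{v,1}\dot z_{k+1}\right]\qquad(1\le k\le N-1),$$ $$\ddot z_N=g_x\beta_x\left[-z_{N-1}+z_N\right]+g_v\beta_v\left[-\dot z_{N-1}+\dot z_N\right],$$ where either $\beta_x=-\rho_{x,-1}$, $\beta_v=-\rho_{v,-1}$ (variable mass boundary condition) or $\beta_x=\beta_v=1$ (regular boundary condition). Let $$c_\pm=-\frac{g_v(1+2\rho_{v,1})}{2}\pm\sqrt{\frac{g_v^2(1+2\rho_{v,1})^2}{4}-\frac{g_x}{2}},\qquad\text{so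 } c_+>0>c_-,$$ be the signal velocities, let $w_N(t)=z_N(t)-v_0t$ $(t\ge 0)$ be the orbit of the last agent relative to the leader, and let $$t_k=t_k(N)=\frac{N}{c_+}+\left(\frac1{c_+}-\frac1{c_-}\right)kN\qquad(k\ge -1).$$ **Theorem.** For either boundary condition and every fixed integer $k_0\ge 1$ the following holds as $N\to\infty$. 1. *(Velocities.)* Put $u_k=-\left(\frac{c_-}{c_+}\right)^k v_0$. For every $\delta>0$ and every $0\le k\le k_0$, $\dot w_N(t)\to u_k$, uniformly over $t\ge 0$ with $t_{k-1}+\delta N\le t\le t_k-\delta N$. Thus the velocity relative to the leader jumps from $u_k$ to $u_{k+1}$ at the times $t_k$, starting from $u_0=-v_0$. 2. *(Zero-crossing times.)* For all sufficiently large $N$ the function $w_N$ has a first, second, …, $k_0$-th positive zero $T_1<T_2<\dots<T_{k_0}$, it changes sign at each of them, and $$\lim_{N\to\infty}\frac{T_k}{N}=\left(\frac1{c_+}-\frac1{c_-}\right)k\qquad(1\le k\le k_0).$$ 3. *(Extrema.)* Put $T_0=0$. For all sufficiently large $N$ and $1\le k\le k_0$, $w_N$ has a local extremum in $(T_{k-1},T_k)$;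 and the values $A_k$ of all local extrema of $w_N$ in $(T_{k-1},T_k)$ satisfy, uniformly, $$\lim_{N\to\infty}\frac{A_k}{N}=-\left(\frac{c_-}{c_+}\right)^{k-1}\frac{v_0}{c_+}.$$ In particular this describes the orbit of the last agent on the whole time window $[0,k_0N/c_+]$, which for large $N$ is contained in $[0,T_{k_0}]$; and the transients grow linearly in $N$. -/

import Mathlib

open Set Filter Topology

namespace Flock

/-- Coefficients of the linear nearest-neighbour system: the gains `gx`, `gv` and the interaction
weights `ρx j`, `ρv j`, of which only those with `j = -1, 0, 1` are used. -/
structure Params where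
  gx : ℝ
  gv : ℝ
  ρx : ℤ → ℝ
  ρv : ℤ → ℝ

/-- The normalization: `ρ_{x,0} = ρ_{v,0} = 1`, `ρ_{x,±1} = -1/2`, `g_x < 0`, `g_v < 0`, and the
weights of the velocities sum to zero (those of the positions then do so as well). -/
structure Params.Normalized (P : Params) : Prop where
  ρx_zero : P.ρx 0 = 1
  ρv_zero : P.ρv 0 = 1
  ρx_neg_one : P.ρx (-1) = -1 / 2
  ρx_one : P.ρx 1 = -1 / 2
  ρv_sum : P.ρv (-1) + P.ρv 0 + P.ρv 1 = 0
  gx_neg : P.gx < 0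
  gv_neg : P.gv < 0

/-- The two boundary conditions for the last agent. -/
inductive Boundary where
  | variableMass
  | regular

/-- The coefficient `β_x` of the boundary condition. -/
def Boundary.βx (P : Params) : Boundary → ℝ
  | .variableMass => -P.ρx (-1)
  | .regular => 1

/-- The coefficient `β_v` of the boundary condition. -/
def Boundary.βv (P : Params) : Boundary → ℝ
  | .variableMass => -P.ρv (-1)
  | .regular => 1

/-- `z 0, …, z N` are the orbits of the agents `0, …, N` of the system `S_N`: the leader `z 0` is at
rest up to time `0` and then moves with velocity `v₀`; the other agents are at rest up to time `0`,
have continuous velocities, and obey the equations of motion for positive times.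
(The functions `z k` with `k > N` play no role.) -/
structure IsOrbit (P : Params) (bc : Boundary) (v₀ : ℝ) (N : ℕ) (z : ℕ → ℝ → ℝ) : Prop where
  leader : ∀ t, z 0 t = if t < 0 then 0 else v₀ * t
  rest : ∀ k, 1 ≤ k → k ≤ N → ∀ t ≤ 0, z k t = 0
  smooth : ∀ k, 1 ≤ k → k ≤ N → ContDiff ℝ 1 (z k)
  interior : ∀ k, 1 ≤ k → k < N → ∀ t > 0,
    HasDerivAt (deriv (z k))
      (P.gx * (P.ρx (-1) * z (k - 1) t + P.ρx 0 * z k t + P.ρx 1 * z (k + 1) t)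
        + P.gv * (P.ρv (-1) * deriv (z (k - 1)) t + P.ρv 0 * deriv (z k) t
            + P.ρv 1 * deriv (z (k + 1)) t)) t
  last : 1 ≤ N → ∀ t > 0,
    HasDerivAt (deriv (z N))
      (P.gx * bc.βx P * (-z (N - 1) t + z N t)
        + P.gv * bc.βv P * (-deriv (z (N - 1)) t + deriv (z N) t)) t

/-- The signal velocity `c₊`. -/
noncomputable def Params.cPlus (P : Params) : ℝ :=
  -(P.gv * (1 + 2 * P.ρv 1)) / 2 + √(P.gv ^ 2 * (1 + 2 * P.ρv 1) ^ 2 / 4 - P.gx / 2)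

/-- The signal velocity `c₋`. -/
noncomputable def Params.cMinus (P : Params) : ℝ :=
  -(P.gv * (1 + 2 * P.ρv 1)) / 2 - √(P.gv ^ 2 * (1 + 2 * P.ρv 1) ^ 2 / 4 - P.gx / 2)

/-- The orbit of the last agent of `S_N` relative to the leader (for times `t ≥ 0`); its equilibrium
position is `0`. -/
def relOrbit (v₀ : ℝ) (N : ℕ) (z : ℕ → ℝ → ℝ) (t : ℝ) : ℝ := z N t - v₀ * t

/-- The response time `t_k = N / c₊ + (1 / c₊ - 1 / c₋) k N`, at which the velocity of the last agent
relative to the leader jumps from `u_k` to `u_{k+1}`. -/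
noncomputable def Params.responseTime (P : Params) (N : ℕ) (k : ℤ) : ℝ :=
  N / P.cPlus + (1 / P.cPlus - 1 / P.cMinus) * k * N

/-- `w` crosses its equilibrium position `0` at the time `T`: it vanishes there and changes sign. -/
def IsCrossing (w : ℝ → ℝ) (T : ℝ) : Prop :=
  w T = 0 ∧ ∃ δ > 0, ∀ r ∈ Ioo (T - δ) T, ∀ s ∈ Ioo T (T + δ), w r * w s < 0

/-- `T` is the `k`-th positive zero of `w` (counted from `k = 1`), and `w` crosses `0` there. -/
def IsKthCrossing (w : ℝ → ℝ) (k : ℕ) (T : ℝ) : Prop :=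
  0 < T ∧ IsCrossing w T ∧ {t | t ∈ Ioo 0 T ∧ w t = 0}.encard + 1 = (k : ℕ∞)

end Flock

/-! Write x = -g_x, g = -g_v, b = 1 + 2ρ_{v,1} and N = n + 1. The Laplace transforms of the
positions, normalized to 1 for the leader, obey a three-term recursion in the agent number with
characteristic roots r = `wave x g b` and 1/s, where s = `wave x g (-b)`. In the closed right
half-plane without 0 both |r| and |s| are below 1, so r carries a signal towards the last agent and
s carries it back. Eliminating the other agents (`last_eq`) gives the transform E r^n / (1 - F
(rs)^n) for the last one. This is the geometric series of the terms E F^j (r^{j+1} s^j)^n, and the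
j-th term is the wave after j round trips. The boundary condition changes E and F, but not F(0) = ρ
= c₋/c₊ and E(0) = 1 - ρ, which alone matter in the limit.

Each term is a moving front. The factor S = r^{j+1} s^j satisfies S(0) = 1, |S| < 1 elsewhere on the
imaginary axis, and log S = -τz + κz² + … with κ > 0. Hence the inverse transform of A S^n is a
pulse near nτ: on the contour Re z = ±1/√n it is at most of order n^{-1/2} exp(-|t - nτ|/√n)
(`IsFront.norm_lineIntegral_le`). Its total mass is 2πA(0) by Fourier inversion, so A S^n / z yields
a step of that height (`IsFront.front`).

On a line Re z = Λ > 0 the round-trip factor F (rs)^n is at most C q^n with q < 1. For t ≤ cN a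
fixed number J of terms therefore suffices, since e^{Λt} q^{nJ} tends to 0 once J is large
(`velocity_expansion`). After k fronts the velocity is v₀(1 - ρ)(1 + … + ρ^{k-1}) = v₀(1 - ρ^k),
that is, -v₀ρ^k relative to the leader (`velocity_limit`).

The rest is real analysis (`HasSlopes`). Let a = 1/c₊ and a' = -1/c₋, so that ρa' = -a. By
integration w_N is within o(N) of a piecewise linear function whose k-th piece vanishes at k(a +
a')N and ends at (a + k(a + a'))N with value -v₀ρ^k aN. Near a zero of the profile the velocity is
close to a nonzero constant, so there is exactly one crossing; extrema can occur only near the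
corners. -/

open MeasureTheory Complex in
/-- The integral of a holomorphic function with quadratic decay along a vertical line does not
depend on the line. -/
theorem integral_vertical_eq {f : ℂ → ℂ} {a b C : ℝ} (hab : a ≤ b)
    (hf : ∀ z : ℂ, a ≤ z.re → z.re ≤ b → DifferentiableAt ℂ f z)
    (hb : ∀ z : ℂ, a ≤ z.re → z.re ≤ b → ‖f z‖ ≤ C * (1 + z.im ^ 2)⁻¹) :
    ∫ y : ℝ, f (a + y * I) = ∫ y : ℝ, f (b + y * I) := by
  have hC : 0 ≤ C := by
    have := (norm_nonneg _).trans (hb a (by simp) (by simpa))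
    simpa using this
  have hint : ∀ c : ℝ, a ≤ c → c ≤ b → Integrable fun y : ℝ => f (c + y * I) := by
    intro c hac hcb
    refine (integrable_inv_one_add_sq.const_mul C).mono' ?_ (.of_forall fun y => ?_)
    · refine Continuous.aestronglyMeasurable (continuous_iff_continuousAt.2 fun y => ?_)
      exact ContinuousAt.comp (f := fun y : ℝ => (c : ℂ) + y * I)
        (hf _ (by simpa using hac) (by simpa using hcb)).continuousAt (by fun_prop)
    · simpa using hb (c + y * I) (by simpa using hac) (by simpa using hcb)
  have hrect : ∀ T : ℝ,
      (∫ x : ℝ in a..b, f (x + (-T : ℝ) * I)) - (∫ x : ℝ in a..b, f (x + T * I)) +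
      I • (∫ y : ℝ in (-T)..T, f (b + y * I)) - I • (∫ y : ℝ in (-T)..T, f (a + y * I)) = 0 := by
    intro T
    have := integral_boundary_rect_eq_zero_of_differentiableOn f ⟨a, -T⟩ ⟨b, T⟩ (by
      intro z hz
      have hz1 := hz.1
      simp only [mem_preimage, uIcc_of_le hab, mem_Icc] at hz1
      exact (hf z hz1.1 hz1.2).differentiableWithinAt)
    simpa using this
  have hside : ∀ s : ℝ, s = 1 ∨ s = -1 →
      Tendsto (fun T : ℝ => ∫ x : ℝ in a..b, f (x + (s * T : ℝ) * I)) atTop (𝓝 0) := by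
    intro s hs
    have hs2 : ∀ T, (s * T) ^ 2 = T ^ 2 := by intro T; rcases hs with rfl | rfl <;> ring
    refine squeeze_zero_norm (a := fun T : ℝ => C * (1 + T ^ 2)⁻¹ * |b - a|) (fun T => ?_) ?_
    · refine intervalIntegral.norm_integral_le_of_norm_le_const fun x hx => ?_
      rw [uIoc_of_le hab] at hx
      have := hb (x + (s * T : ℝ) * I) (by simpa using hx.1.le) (by simpa using hx.2)
      simpa [hs2, ← ofReal_mul] using this
    · have : Tendsto (fun T : ℝ => (1 + T ^ 2)⁻¹) atTop (𝓝 0) :=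
        tendsto_inv_atTop_zero.comp
          (tendsto_atTop_add_const_left _ _ (tendsto_pow_atTop two_ne_zero))
      simpa using (this.const_mul C).mul_const |b - a|
  have hlim : ∀ c : ℝ, a ≤ c → c ≤ b → Tendsto (fun T : ℝ => ∫ y : ℝ in (-T)..T, f (c + y * I))
      atTop (𝓝 (∫ y : ℝ, f (c + y * I))) := fun c h1 h2 =>
    intervalIntegral_tendsto_integral (hint c h1 h2) tendsto_neg_atTop_atBot tendsto_id
  have h0 := (((hside (-1) (.inr rfl)).sub (hside 1 (.inl rfl))).add
    ((hlim b hab le_rfl).const_smul I)).sub ((hlim a le_rfl hab).const_smul I)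
  have h1 := tendsto_nhds_unique h0 (tendsto_const_nhds.congr fun T => by
    simpa using (hrect T).symm)
  simp only [sub_self, zero_add, smul_eq_mul, ← mul_sub] at h1
  have h2 := (mul_eq_zero.1 h1).resolve_left I_ne_zero
  exact (sub_eq_zero.1 h2).symm

/-! ### Pulses: inverse transforms of A S^n -/

namespace Flock

/-- The factor `S` of a transform `S ^ n` whose inverse Laplace transform is a pulse travelling
with delay `τ` per step and diffusing. -/
structure IsFront (S : ℂ → ℂ) (ε₀ τ : ℝ) : Prop where
  diff : ∀ z : ℂ, -ε₀ ≤ z.re → DifferentiableAt ℂ S z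
  decay : ∀ Λ : ℝ, ∃ C, ∀ z : ℂ, -ε₀ ≤ z.re → z.re ≤ Λ → ‖S z‖ ^ 2 ≤ C * (1 + z.im ^ 2)⁻¹
  far : ∀ l > 0, ∃ ε > 0, ∃ q < 1, ∀ z : ℂ, |z.re| ≤ ε → l ≤ ‖z‖ → ‖S z‖ ≤ q
  near : ∃ l > 0, ∃ c > 0, ∃ C : ℝ, ∀ z : ℂ, ‖z‖ ≤ l →
    ‖S z‖ ≤ Real.exp (-τ * z.re - c * z.im ^ 2 + C * z.re ^ 2)
  zero : S 0 = 1

/-- An amplitude: holomorphic to the right of `-ε₀` and bounded on vertical strips. -/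
structure IsAmplitude (A : ℂ → ℂ) (ε₀ : ℝ) : Prop where
  diff : ∀ z : ℂ, -ε₀ ≤ z.re → DifferentiableAt ℂ A z
  bdd : ∀ Λ : ℝ, ∃ C, ∀ z : ℂ, -ε₀ ≤ z.re → z.re ≤ Λ → ‖A z‖ ≤ C

variable {A S : ℂ → ℂ} {ε₀ τ : ℝ}

theorem re_add_mul_I (c y : ℝ) : ((c : ℂ) + y * Complex.I).re = c := by simp

theorem im_add_mul_I (c y : ℝ) : ((c : ℂ) + y * Complex.I).im = y := by simp

open Complex MeasureTheory

theorem IsFront.pow_decay (hS : IsFront S ε₀ τ) (hA : IsAmplitude A ε₀) (Λ : ℝ) :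
    ∀ n : ℕ, 2 ≤ n → ∃ C, ∀ z : ℂ, -ε₀ ≤ z.re → z.re ≤ Λ →
      ‖A z * S z ^ n‖ ≤ C * (1 + z.im ^ 2)⁻¹ := by
  intro n hn
  obtain ⟨C, hC⟩ := hS.decay Λ
  obtain ⟨K, hK⟩ := hA.bdd Λ
  refine ⟨K * ((1 + C) ^ (n - 2) * C), fun z h1 h2 => ?_⟩
  have hy : (1 + z.im ^ 2)⁻¹ ≤ 1 := inv_le_one_of_one_le₀ (by nlinarith [sq_nonneg z.im])
  have hy0 : 0 < (1 + z.im ^ 2)⁻¹ := by positivity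
  have h3 := hC z h1 h2
  have hC0 : 0 ≤ C := by
    by_contra h
    nlinarith [sq_nonneg ‖S z‖]
  have h4 : ‖S z‖ ≤ 1 + C := by
    nlinarith [sq_nonneg (‖S z‖ - 1), mul_le_mul_of_nonneg_left hy hC0]
  have h5 : ‖S z‖ ^ n = ‖S z‖ ^ (n - 2) * ‖S z‖ ^ 2 := by rw [← pow_add]; congr 1; omega
  have hK0 : 0 ≤ K := (norm_nonneg _).trans (hK z h1 h2)
  rw [norm_mul, norm_pow, h5]
  calc ‖A z‖ * (‖S z‖ ^ (n - 2) * ‖S z‖ ^ 2)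
      ≤ K * ((1 + C) ^ (n - 2) * (C * (1 + z.im ^ 2)⁻¹)) := by
        gcongr
        exact hK z h1 h2
    _ = _ := by ring

/-- Integral of `e^{zu} f(z)` over the vertical line with real part `c`. -/
noncomputable def lineIntegral (f : ℂ → ℂ) (c u : ℝ) : ℂ :=
  ∫ y : ℝ, cexp ((c + y * I) * u) * f (c + y * I)

theorem IsFront.continuous_line (hS : IsFront S ε₀ τ) (hA : IsAmplitude A ε₀) (n : ℕ)
    {c : ℝ} (hc : -ε₀ ≤ c) : Continuous fun y : ℝ => A (c + y * I) * S (c + y * I) ^ n := by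
  refine continuous_iff_continuousAt.2 fun y => ?_
  refine ContinuousAt.comp (f := fun y : ℝ => (c : ℂ) + y * I) (g := fun z => A z * S z ^ n)
    ?_ (by fun_prop)
  have h1 := (hA.diff (c + y * I) (by simpa using hc)).continuousAt
  have h2 := (hS.diff (c + y * I) (by simpa using hc)).continuousAt
  exact h1.mul (h2.pow n)

theorem IsFront.integrable_line (hS : IsFront S ε₀ τ) (hA : IsAmplitude A ε₀) {n : ℕ} (hn : 2 ≤ n)
    {c : ℝ} (hc : -ε₀ ≤ c) : Integrable fun y : ℝ => A (c + y * I) * S (c + y * I) ^ n := by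
  obtain ⟨C, hC⟩ := hS.pow_decay hA c n hn
  refine (integrable_inv_one_add_sq.const_mul C).mono'
    (hS.continuous_line hA n hc).aestronglyMeasurable (.of_forall fun y => ?_)
  simpa using hC (c + y * I) (by simpa using hc) (by simp)

theorem IsFront.lineIntegral_eq (hS : IsFront S ε₀ τ) (hA : IsAmplitude A ε₀) {n : ℕ} (hn : 2 ≤ n)
    {c d : ℝ} (hc : -ε₀ ≤ c) (hcd : c ≤ d) (u : ℝ) :
    lineIntegral (fun z => A z * S z ^ n) c u = lineIntegral (fun z => A z * S z ^ n) d u := by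
  obtain ⟨C, hC⟩ := hS.pow_decay hA d n hn
  refine integral_vertical_eq (f := fun z => cexp (z * u) * (A z * S z ^ n))
    (C := Real.exp (max (c * u) (d * u)) * C) hcd (fun z h1 h2 => ?_) (fun z h1 h2 => ?_)
  · have := hA.diff z (hc.trans h1)
    have := hS.diff z (hc.trans h1)
    fun_prop
  · rw [norm_mul, Complex.norm_exp, mul_assoc]
    gcongr
    · have : z.re * u ≤ max (c * u) (d * u) := by
        rcases le_total 0 u with h | h
        · exact (mul_le_mul_of_nonneg_right h2 h).trans (le_max_right _ _)
        · exact (mul_le_mul_of_nonpos_right h1 h).trans (le_max_left _ _)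
      simpa using this
    · exact hC z (hc.trans h1) h2

theorem eventually_pow_le_exp_sqrt {q : ℝ} (hq : q < 1) (hq0 : 0 < q) (a : ℝ) :
    ∀ᶠ n : ℕ in atTop, q ^ (n - 2) ≤ Real.exp (-a * √n) * (√n)⁻¹ := by
  set κ := -Real.log q with hκ
  have hκ0 : 0 < κ := by rw [hκ, neg_pos]; exact Real.log_neg hq0 hq
  have hqe : q = Real.exp (-κ) := by rw [hκ, neg_neg, Real.exp_log hq0]
  have hlim : Tendsto (fun n : ℕ => √(n : ℝ)) atTop atTop :=
    Real.tendsto_sqrt_atTop.comp tendsto_natCast_atTop_atTop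
  -- For √n ≥ 1 this threshold gives κ(n - 2) ≥ |a|√n + √n; the summand √n pays for the factor 1/√n.
  filter_upwards [hlim.eventually_ge_atTop ((|a| + 1 + 2 * κ) / κ), eventually_ge_atTop 2,
    hlim.eventually_ge_atTop 1] with n h1 h2 h3
  have hn : (n : ℝ) = √n * √n := (Real.mul_self_sqrt (Nat.cast_nonneg n)).symm
  have h4 : (√n)⁻¹ ≥ Real.exp (-√n) := by
    rw [Real.exp_neg]
    gcongr
    linarith [Real.add_one_le_exp (√(n : ℝ))]
  have h5 : q ^ (n - 2) = Real.exp (-κ * (n - 2)) := by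
    rw [hqe, ← Real.exp_nat_mul, Nat.cast_sub h2]
    congr 1
    push_cast
    ring
  rw [h5]
  refine le_trans ?_ (mul_le_mul_of_nonneg_left h4 (Real.exp_nonneg _))
  rw [← Real.exp_add]
  gcongr
  rw [div_le_iff₀ hκ0] at h1
  have h6 := le_abs_self a
  nlinarith [mul_le_mul_of_nonneg_right h1 (by linarith : (0 : ℝ) ≤ √n)]

/-- On Re z = ±1/√n the quadratic term C (Re z)² of the local bound contributes only the constant
e^C to the n-th power, while the linear term gives e^{∓τ√n}. Away from 0 the power is exponentially
small in n; two of its factors are set aside to keep the decay in y. -/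
theorem IsFront.norm_pow_le (hS : IsFront S ε₀ τ) (hε₀ : 0 < ε₀) :
    ∃ C > 0, ∃ c > 0, ∀ᶠ n : ℕ in atTop, ∀ s : ℝ, |s| = 1 → ∀ y : ℝ,
      ‖S ((s * (√n)⁻¹ : ℝ) + y * I)‖ ^ n ≤
        C * Real.exp (-τ * (s * √n)) * (Real.exp (-(c * n) * y ^ 2) + (√n)⁻¹ * (1 + y ^ 2)⁻¹) := by
  obtain ⟨l, hl, c, hc, C, hnear⟩ := hS.near
  obtain ⟨ε, hε, q, hq, hfar⟩ := hS.far l hl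
  obtain ⟨D, hD⟩ := hS.decay ε₀
  set q' := max q (1 / 2) with hq'
  have hq'1 : q' < 1 := max_lt hq (by norm_num)
  have hq'0 : 0 < q' := lt_of_lt_of_le (by norm_num) (le_max_right _ _)
  have hlim : Tendsto (fun n : ℕ => √(n : ℝ)) atTop atTop :=
    Real.tendsto_sqrt_atTop.comp tendsto_natCast_atTop_atTop
  refine ⟨Real.exp C + |D|, by positivity, c, hc, ?_⟩
  filter_upwards [eventually_pow_le_exp_sqrt hq'1 hq'0 |τ|, eventually_ge_atTop 2,
    (tendsto_inv_atTop_zero.comp hlim).eventually_le_const (lt_min hε hε₀)] with n h1 h2 h3 s hs y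
  simp only [Function.comp_apply] at h3
  have hn0 : (0 : ℝ) < n := by positivity
  have hsn : 0 < √(n : ℝ) := Real.sqrt_pos.2 hn0
  have hss : s ^ 2 = 1 := by rw [← sq_abs, hs, one_pow]
  have hnn : (n : ℝ) = √n * √n := (Real.mul_self_sqrt hn0.le).symm
  set z : ℂ := ((s * (√n)⁻¹ : ℝ) : ℂ) + y * I with hz
  have hre : z.re = s * (√n)⁻¹ := re_add_mul_I _ _
  have him : z.im = y := im_add_mul_I _ _
  have hare : |z.re| = (√n)⁻¹ := by rw [hre, abs_mul, hs, one_mul, abs_of_pos (by positivity)]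
  rcases le_total ‖z‖ l with hzl | hzl
  · have h4 := pow_le_pow_left₀ (norm_nonneg _) (hnear z hzl) n
    rw [← Real.exp_nat_mul, hre, him] at h4
    have h5 : (n : ℝ) * (-τ * (s * (√n)⁻¹) - c * y ^ 2 + C * (s * (√n)⁻¹) ^ 2)
        = C + -τ * (s * √n) + -(c * n) * y ^ 2 := by
      have : (n : ℝ) * (√n)⁻¹ = √n := by rw [hnn]; field_simp; simp
      have h6 : (n : ℝ) * ((√n)⁻¹ * (√n)⁻¹) = 1 := by rw [← mul_assoc, this]; field_simp
      linear_combination (-τ * s) * this + C * s ^ 2 * h6 + C * hss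
    rw [h5, Real.exp_add, Real.exp_add] at h4
    refine h4.trans ?_
    have : 0 ≤ (√(n : ℝ))⁻¹ * (1 + y ^ 2)⁻¹ := by positivity
    have h7 := Real.exp_pos (-(c * n) * y ^ 2)
    gcongr
    · linarith [abs_nonneg D]
    · linarith
  · have h4 : ‖S z‖ ≤ q' := (hfar z (hare ▸ h3.trans (min_le_left _ _)) hzl).trans (le_max_left _ _)
    have h5 := hD z (by linarith [neg_le_of_abs_le (hare ▸ h3.trans (min_le_right _ _))])
      (le_of_abs_le (hare ▸ h3.trans (min_le_right _ _)))
    have h6 : ‖S z‖ ^ n = ‖S z‖ ^ (n - 2) * ‖S z‖ ^ 2 := by rw [← pow_add]; congr 1; omega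
    rw [him] at h5
    have h8 : Real.exp (-|τ| * √n) ≤ Real.exp (-τ * (s * √n)) := by
      have : τ * s ≤ |τ| := (le_abs_self _).trans (by rw [abs_mul, hs, mul_one])
      exact Real.exp_le_exp.2 (by nlinarith)
    calc ‖S z‖ ^ n ≤ (Real.exp (-|τ| * √n) * (√n)⁻¹) * (|D| * (1 + y ^ 2)⁻¹) := by
          rw [h6]
          gcongr
          · exact (pow_le_pow_left₀ (norm_nonneg _) h4 _).trans h1
          · exact h5.trans (by gcongr; exact le_abs_self D)
      _ ≤ (Real.exp (-τ * (s * √n)) * (√n)⁻¹) * (|D| * (1 + y ^ 2)⁻¹) := by gcongr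
      _ = |D| * Real.exp (-τ * (s * √n)) * (0 + (√n)⁻¹ * (1 + y ^ 2)⁻¹) := by ring
      _ ≤ _ := by
        gcongr
        · linarith [Real.exp_pos C]
        · positivity

/-- Without the factor 1/z the contour may cross the origin. At distance 1/√n from the imaginary
axis the exponential weight gains e^{-|u - nτ|/√n}, and the Gaussian in y integrates to order 1/√n.
-/
theorem IsFront.norm_lineIntegral_le (hS : IsFront S ε₀ τ) (hA : IsAmplitude A ε₀)
    (hε₀ : 0 < ε₀) {Λ : ℝ} (hΛ : 0 < Λ) :
    ∃ C > 0, ∀ᶠ n : ℕ in atTop, ∀ u : ℝ,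
      ‖lineIntegral (fun z => A z * S z ^ n) Λ u‖ ≤
        C * (√n)⁻¹ * Real.exp (-|u - n * τ| * (√n)⁻¹) := by
  obtain ⟨C, hC, c, hc, hpow⟩ := hS.norm_pow_le hε₀
  obtain ⟨K, hK⟩ := hA.bdd ε₀
  have hK0 : 0 ≤ K := (norm_nonneg _).trans (hK 0 (by simpa using hε₀.le) (by simpa using hε₀.le))
  have hlim : Tendsto (fun n : ℕ => √(n : ℝ)) atTop atTop :=
    Real.tendsto_sqrt_atTop.comp tendsto_natCast_atTop_atTop
  refine ⟨(K + 1) * C * (√(Real.pi / c) + Real.pi), by positivity, ?_⟩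
  filter_upwards [hpow, eventually_ge_atTop 2,
    (tendsto_inv_atTop_zero.comp hlim).eventually_le_const (lt_min hε₀ hΛ)] with n hp h2 h3 u
  simp only [Function.comp_apply] at h3
  have hn0 : (0 : ℝ) < n := by positivity
  have hsn : 0 < √(n : ℝ) := Real.sqrt_pos.2 hn0
  have hnn : (n : ℝ) = √n * √n := (Real.mul_self_sqrt hn0.le).symm
  -- The contour goes to the left for times after the pulse and to the right for times before it.
  obtain ⟨s, hs, hsu⟩ : ∃ s : ℝ, |s| = 1 ∧ s * (u - n * τ) = -|u - n * τ| := by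
    rcases le_total 0 (u - n * τ) with h | h
    · exact ⟨-1, by simp, by rw [abs_of_nonneg h]; ring⟩
    · exact ⟨1, by simp, by rw [abs_of_nonpos h]; ring⟩
  have hsc : |s * (√n)⁻¹| = (√n)⁻¹ := by rw [abs_mul, hs, one_mul, abs_of_pos (by positivity)]
  have hlo : -ε₀ ≤ s * (√n)⁻¹ := neg_le_of_abs_le (hsc.le.trans (h3.trans (min_le_left _ _)))
  have hhi : s * (√n)⁻¹ ≤ Λ := le_of_abs_le (hsc.le.trans (h3.trans (min_le_right _ _)))
  have hhi' : s * (√n)⁻¹ ≤ ε₀ := le_of_abs_le (hsc.le.trans (h3.trans (min_le_left _ _)))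
  rw [← hS.lineIntegral_eq hA h2 hlo hhi u, lineIntegral]
  set M := K * (C * Real.exp (-τ * (s * √n))) with hM
  have hg1 : Integrable fun y : ℝ => Real.exp (-(c * n) * y ^ 2) :=
    integrable_exp_neg_mul_sq (by positivity)
  have hg2 : Integrable fun y : ℝ => (√n)⁻¹ * (1 + y ^ 2)⁻¹ :=
    integrable_inv_one_add_sq.const_mul _
  have hbound : ∀ y : ℝ, ‖cexp ((((s * (√n)⁻¹ : ℝ) : ℂ) + y * I) * u) *
      (A ((s * (√n)⁻¹ : ℝ) + y * I) * S ((s * (√n)⁻¹ : ℝ) + y * I) ^ n)‖ ≤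
      Real.exp (s * (√n)⁻¹ * u) * M *
        (Real.exp (-(c * n) * y ^ 2) + (√n)⁻¹ * (1 + y ^ 2)⁻¹) := by
    intro y
    rw [norm_mul, norm_mul, norm_pow, Complex.norm_exp, hM, mul_assoc (Real.exp _), mul_assoc K]
    refine mul_le_mul ?_ (mul_le_mul ?_ (hp s hs y) (by positivity) hK0) (by positivity)
      (by positivity)
    · have : ((((s * (√n)⁻¹ : ℝ) : ℂ) + y * I) * u).re = s * (√n)⁻¹ * u := by
        rw [Complex.re_mul_ofReal, re_add_mul_I]
      rw [this]
    · exact hK _ (by rwa [re_add_mul_I]) (by rwa [re_add_mul_I])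
  have h4 := norm_integral_le_of_norm_le ((hg1.add hg2).const_mul
    (Real.exp (s * (√n)⁻¹ * u) * M)) (.of_forall hbound)
  refine h4.trans ?_
  have h5 : ∫ y : ℝ, (Real.exp (s * (√n)⁻¹ * u) * M) *
      ((fun y : ℝ => Real.exp (-(c * n) * y ^ 2)) + (fun y : ℝ => (√n)⁻¹ * (1 + y ^ 2)⁻¹)) y =
      Real.exp (s * (√n)⁻¹ * u) * M * (√(Real.pi / c) + Real.pi) * (√n)⁻¹ := by
    rw [integral_const_mul]
    simp only [Pi.add_apply]
    rw [integral_add hg1 hg2, integral_gaussian, integral_const_mul,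
      integral_univ_inv_one_add_sq, ← div_div, Real.sqrt_div (by positivity)]
    ring
  rw [h5]
  have h6 : Real.exp (s * (√n)⁻¹ * u) * Real.exp (-τ * (s * √n)) =
      Real.exp (-|u - n * τ| * (√n)⁻¹) := by
    rw [← Real.exp_add, ← hsu]
    congr 1
    have : (n : ℝ) * (√n)⁻¹ = √n := by rw [hnn]; field_simp; simp
    linear_combination (τ * s) * this
  calc Real.exp (s * (√n)⁻¹ * u) * M * (√(Real.pi / c) + Real.pi) * (√n)⁻¹
      = K * C * (√(Real.pi / c) + Real.pi) * (√n)⁻¹ *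
        (Real.exp (s * (√n)⁻¹ * u) * Real.exp (-τ * (s * √n))) := by rw [hM]; ring
    _ ≤ _ := by
      rw [h6]
      gcongr
      linarith

end Flock

/-! ### Fronts: integrated pulses -/

namespace Flock

variable {A S : ℂ → ℂ} {ε₀ τ : ℝ}

open Complex MeasureTheory

theorem norm_exp_line (c y u : ℝ) : ‖cexp ((c + y * I) * u)‖ = Real.exp (c * u) := by
  rw [Complex.norm_exp, Complex.re_mul_ofReal, re_add_mul_I]

theorem IsFront.continuous_lineIntegral (hS : IsFront S ε₀ τ) (hA : IsAmplitude A ε₀)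
    (hε₀ : 0 < ε₀) {n : ℕ} (hn : 2 ≤ n) :
    Continuous (lineIntegral (fun z => A z * S z ^ n) 0) := by
  have hc : -ε₀ ≤ (0 : ℝ) := by linarith
  refine continuous_of_dominated (bound := fun y : ℝ => ‖A ((0 : ℝ) + y * I) *
    S ((0 : ℝ) + y * I) ^ n‖) (fun u => ?_) (fun u => .of_forall fun y => ?_)
    (hS.integrable_line hA hn hc).norm (.of_forall fun y => by fun_prop)
  · have := hS.continuous_line hA n hc
    exact Continuous.aestronglyMeasurable (by fun_prop)
  · rw [norm_mul, norm_exp_line]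
    simp

/-- On the imaginary axis the line integral is, up to scaling by 2π, an inverse Fourier transform.
Its total integral is the Fourier transform at frequency 0, which recovers A(0) S(0)^n = A(0). -/
theorem IsFront.integral_lineIntegral (hS : IsFront S ε₀ τ) (hA : IsAmplitude A ε₀)
    (hε₀ : 0 < ε₀) {n : ℕ} (hn : 2 ≤ n)
    (hint : Integrable (lineIntegral (fun z => A z * S z ^ n) 0)) :
    ∫ u, lineIntegral (fun z => A z * S z ^ n) 0 u = 2 * Real.pi * A 0 := by
  have hc : -ε₀ ≤ (0 : ℝ) := by linarith
  have hpi : (2 * Real.pi) ≠ 0 := by positivity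
  set φ : ℝ → ℂ := fun y => A ((0 : ℝ) + y * I) * S ((0 : ℝ) + y * I) ^ n with hφ
  have hφc : Continuous φ := hS.continuous_line hA n hc
  have hφi : Integrable φ := hS.integrable_line hA hn hc
  set ψ : ℝ → ℂ := fun x => φ (2 * Real.pi * x) with hψ
  have hψc : Continuous ψ := by fun_prop
  have hψi : Integrable ψ := hφi.comp_mul_left' hpi
  have hinv : FourierTransformInv.fourierInv ψ =
      fun u => ((2 * Real.pi)⁻¹ : ℝ) • lineIntegral (fun z => A z * S z ^ n) 0 u := by
    ext u
    rw [Real.fourierInv_eq']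
    have := Measure.integral_comp_mul_left
      (fun y : ℝ => cexp (((0 : ℝ) + y * I) * u) * φ y) (2 * Real.pi)
    rw [abs_of_pos (by positivity)] at this
    rw [lineIntegral, ← this]
    refine integral_congr_ae (.of_forall fun x => ?_)
    simp only [hψ, smul_eq_mul]
    congr 2
    simp only [RCLike.inner_apply, conj_trivial]
    push_cast
    ring
  have hψF : Integrable (FourierTransform.fourier ψ) := by
    have h : FourierTransform.fourier ψ = fun w => FourierTransformInv.fourierInv ψ (-w) := by
      ext w
      rw [Real.fourierInv_eq_fourier_neg, neg_neg]
    rw [h, hinv]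
    exact (hint.smul ((2 * Real.pi)⁻¹ : ℝ)).comp_neg
  have h1 := hψi.fourier_fourierInv_eq hψF (v := (0 : ℝ)) hψc.continuousAt
  have h3 : ∀ f : ℝ → ℂ, FourierTransform.fourier f (0 : ℝ) = ∫ u, f u := fun f => by
    simp [Real.fourier_eq']
  rw [hinv, h3, integral_smul] at h1
  have h2 : ψ 0 = A 0 := by simp [hψ, hφ, hS.zero]
  rw [← h2, ← h1, real_smul]
  push_cast
  field_simp

/-- Fubini, with e^{zt}/z written as the integral of e^{zu} over u ≤ t, which converges because Λ >
0. The pole at 0 is thereby traded for an integration in time. -/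
theorem IsFront.lineIntegral_div (hS : IsFront S ε₀ τ) (hA : IsAmplitude A ε₀)
    (hε₀ : 0 < ε₀) {Λ : ℝ} (hΛ : 0 < Λ) {n : ℕ} (hn : 2 ≤ n) (t : ℝ) :
    lineIntegral (fun z => A z * S z ^ n / z) Λ t =
      ∫ u in Iic t, lineIntegral (fun z => A z * S z ^ n) Λ u := by
  have hc : -ε₀ ≤ Λ := by linarith
  have hφc := hS.continuous_line hA n hc
  have hφi := hS.integrable_line hA hn hc
  simp only [lineIntegral]
  rw [integral_integral_swap]
  · refine integral_congr_ae (.of_forall fun y => ?_)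
    simp only
    rw [integral_mul_const, integral_exp_mul_complex_Iic (by rw [re_add_mul_I]; exact hΛ)]
    ring
  · refine Integrable.mono' ((integrableOn_exp_mul_Iic hΛ t).mul_prod hφi.norm) ?_
      (.of_forall fun p => ?_)
    · refine Continuous.aestronglyMeasurable ?_
      simp only [Function.uncurry_def]
      exact Continuous.mul (by fun_prop) (hφc.comp continuous_snd)
    · simp only [Function.uncurry_def]
      rw [norm_mul, norm_exp_line]

/-- Before nτ only the left tail of the pulse has been integrated; after nτ only the right tail is
missing from the total mass. Both tails are integrals of the exponential pulse bound. -/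
theorem IsFront.front (hS : IsFront S ε₀ τ) (hA : IsAmplitude A ε₀)
    (hε₀ : 0 < ε₀) {Λ : ℝ} (hΛ : 0 < Λ) :
    ∃ C > 0, ∀ᶠ n : ℕ in atTop, ∀ t : ℝ,
      (t ≤ n * τ → ‖lineIntegral (fun z => A z * S z ^ n / z) Λ t‖ ≤
        C * Real.exp (-(n * τ - t) * (√n)⁻¹)) ∧
      (n * τ ≤ t → ‖lineIntegral (fun z => A z * S z ^ n / z) Λ t - 2 * Real.pi * A 0‖ ≤
        C * Real.exp (-(t - n * τ) * (√n)⁻¹)) := by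
  obtain ⟨C, hC, hev⟩ := hS.norm_lineIntegral_le hA hε₀ hΛ
  refine ⟨C, hC, ?_⟩
  filter_upwards [hev, eventually_ge_atTop 2] with n hn h2 t
  have hn0 : (0 : ℝ) < n := by positivity
  set a := (√(n : ℝ))⁻¹ with ha
  have ha0 : 0 < a := by positivity
  set G := lineIntegral (fun z => A z * S z ^ n) Λ with hG
  have hG0 : G = lineIntegral (fun z => A z * S z ^ n) 0 := by
    ext u
    exact (hS.lineIntegral_eq hA h2 (by linarith) hΛ.le u).symm
  have hGc : Continuous G := hG0 ▸ hS.continuous_lineIntegral hA hε₀ h2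
  set v := (n : ℝ) * τ with hv
  have hlow : ∀ s ≤ v, IntegrableOn G (Iic s) ∧
      ‖∫ u in Iic s, G u‖ ≤ C * Real.exp (-(v - s) * a) := by
    intro s hs
    have h1 : IntegrableOn (fun u => C * a * Real.exp (-v * a) * Real.exp (a * u)) (Iic s) :=
      (integrableOn_exp_mul_Iic ha0 s).const_mul _
    have hb : ∀ u ∈ Iic s, ‖G u‖ ≤ C * a * Real.exp (-v * a) * Real.exp (a * u) := by
      intro u hu
      refine (hn u).trans_eq ?_
      rw [mul_assoc (C * a), ← Real.exp_add, abs_of_nonpos (by linarith [mem_Iic.1 hu])]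
      congr 2
      ring
    refine ⟨Integrable.mono' h1 hGc.aestronglyMeasurable
      (ae_restrict_of_forall_mem measurableSet_Iic hb), ?_⟩
    refine (norm_integral_le_of_norm_le h1
      (ae_restrict_of_forall_mem measurableSet_Iic hb)).trans_eq ?_
    rw [integral_const_mul, integral_exp_mul_Iic ha0,
      show -(v - s) * a = -v * a + a * s by ring, Real.exp_add]
    field_simp
  have hhigh : ∀ s ≥ v, IntegrableOn G (Ioi s) ∧
      ‖∫ u in Ioi s, G u‖ ≤ C * Real.exp (-(s - v) * a) := by
    intro s hs
    have h1 : IntegrableOn (fun u => C * a * Real.exp (v * a) * Real.exp (-a * u)) (Ioi s) :=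
      (integrableOn_exp_mul_Ioi (by linarith) s).const_mul _
    have hb : ∀ u ∈ Ioi s, ‖G u‖ ≤ C * a * Real.exp (v * a) * Real.exp (-a * u) := by
      intro u hu
      refine (hn u).trans_eq ?_
      rw [mul_assoc (C * a), ← Real.exp_add, abs_of_nonneg (by linarith [mem_Ioi.1 hu])]
      congr 2
      ring
    refine ⟨Integrable.mono' h1 hGc.aestronglyMeasurable
      (ae_restrict_of_forall_mem measurableSet_Ioi hb), ?_⟩
    refine (norm_integral_le_of_norm_le h1
      (ae_restrict_of_forall_mem measurableSet_Ioi hb)).trans_eq ?_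
    rw [integral_const_mul, integral_exp_mul_Ioi (by linarith),
      show -(s - v) * a = v * a + -a * s by ring, Real.exp_add]
    field_simp
  have hint : Integrable G := by
    rw [← integrableOn_univ, ← Iic_union_Ioi (a := v)]
    exact (hlow v le_rfl).1.union (hhigh v le_rfl).1
  have htot : ∫ u, G u = 2 * Real.pi * A 0 := by
    rw [hG0]
    exact hS.integral_lineIntegral hA hε₀ h2 (hG0 ▸ hint)
  rw [hS.lineIntegral_div hA hε₀ hΛ h2 t]
  refine ⟨fun ht => (hlow t ht).2, fun ht => ?_⟩
  rw [← htot, ← intervalIntegral.integral_Iic_add_Ioi hint.integrableOn hint.integrableOn (b := t),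
    sub_add_cancel_left, norm_neg]
  exact (hhigh t ht).2

end Flock

/-! ### The wave factors: square root of the discriminant, bounds, behaviour at infinity -/

namespace Flock

open Complex

/-- Width of the strip to the left of the imaginary axis on which the transforms are holomorphic. -/
noncomputable def strip (x g b : ℝ) : ℝ := min (g / 2) (x / (2 * (g * (|b| + 1))))

/-- Discriminant of the characteristic equation of the recursion, up to the factor `z ^ 2`. -/
noncomputable def disc (x g b : ℝ) (z : ℂ) : ℂ := z ^ 2 + 2 * g * z + (2 * x + g ^ 2 * b ^ 2 : ℝ)

/-- Principal square root of the discriminant. -/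
noncomputable def rootDisc (x g b : ℝ) (z : ℂ) : ℂ := disc x g b z ^ (2⁻¹ : ℂ)

/-- The denominator of the rationalized root of the characteristic equation. The usual quadratic
formula would divide by x/2 - g(b - 1)z/2, which can vanish in the right half-plane. -/
noncomputable def waveDen (x g b : ℝ) (z : ℂ) : ℂ := z + rootDisc x g b z + (g * b : ℝ)

/-- The factor by which a right-moving wave is multiplied from one agent to the next; the factor for
left-moving waves is obtained by changing the sign of `b`. -/
noncomputable def wave (x g b : ℝ) (z : ℂ) : ℂ := 1 - 2 * z / waveDen x g b z

section
variable {x g b : ℝ}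

theorem strip_pos (hx : 0 < x) (hg : 0 < g) (b : ℝ) : 0 < strip x g b := by
  unfold strip
  positivity

theorem strip_neg (x g b : ℝ) : strip x g (-b) = strip x g b := by
  simp [strip]

theorem disc_neg (x g b : ℝ) (z : ℂ) : disc x g (-b) z = disc x g b z := by simp [disc]

theorem rootDisc_neg (x g b : ℝ) (z : ℂ) : rootDisc x g (-b) z = rootDisc x g b z := by
  simp [rootDisc, disc_neg]

theorem strip_bounds (hg : 0 < g) {s : ℝ} (hs : -strip x g b ≤ s) :
    -g ≤ 2 * s ∧ -x ≤ 2 * (g * (|b| + 1)) * s := by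
  have h1 : -s ≤ g / 2 := by
    have := min_le_left (g / 2) (x / (2 * (g * (|b| + 1))))
    rw [strip] at hs
    linarith
  have h2 : -s ≤ x / (2 * (g * (|b| + 1))) := by
    have := min_le_right (g / 2) (x / (2 * (g * (|b| + 1))))
    rw [strip] at hs
    linarith
  rw [le_div_iff₀ (by positivity)] at h2
  constructor <;> linarith

theorem strip_bound' (hx : 0 < x) (hg : 0 < g) {s : ℝ} (hs : -strip x g b ≤ s) :
    -x ≤ 2 * g * s := by
  have h := (strip_bounds hg hs).2
  rcases le_total 0 s with h0 | h0
  · have := mul_nonneg hg.le h0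
    linarith
  · nlinarith [mul_nonneg (mul_nonneg hg.le (abs_nonneg b)) (neg_nonneg.2 h0)]

theorem disc_re (x g b : ℝ) (z : ℂ) :
    (disc x g b z).re = z.re ^ 2 - z.im ^ 2 + 2 * g * z.re + (2 * x + g ^ 2 * b ^ 2) := by
  simp only [disc, pow_two, add_re, mul_re, mul_im, ofReal_re, ofReal_im, re_ofNat, im_ofNat]
  ring

theorem disc_im (x g b : ℝ) (z : ℂ) : (disc x g b z).im = 2 * (z.im * (z.re + g)) := by
  simp only [disc, pow_two, add_im, mul_re, mul_im, ofReal_re, ofReal_im, re_ofNat, im_ofNat]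
  ring

theorem disc_mem_slitPlane (hx : 0 < x) (hg : 0 < g) {z : ℂ} (hz : -strip x g b ≤ z.re) :
    disc x g b z ∈ slitPlane := by
  rw [mem_slitPlane_iff, disc_re, disc_im]
  have h1 := (strip_bounds hg hz).1
  have h2 := strip_bound' hx hg hz
  by_cases h : z.im = 0
  · left
    rw [h]
    nlinarith [sq_nonneg z.re, sq_nonneg (g * b)]
  · right
    have : z.re + g ≠ 0 := by linarith
    positivity

theorem rootDisc_sq (x g b : ℝ) (z : ℂ) : rootDisc x g b z ^ 2 = disc x g b z := by
  simp [rootDisc]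

theorem rootDisc_re_pos (hx : 0 < x) (hg : 0 < g) {z : ℂ} (hz : -strip x g b ≤ z.re) :
    0 < (rootDisc x g b z).re := by
  have h := disc_mem_slitPlane hx hg hz
  rw [rootDisc, cpow_inv_two_re]
  apply Real.sqrt_pos.2
  have := mem_slitPlane_iff_not_le_zero.1 h
  have h3 : 0 < ‖disc x g b z‖ + (disc x g b z).re := by
    rcases (neg_le_of_abs_le (abs_re_le_norm (disc x g b z))).lt_or_eq with h4 | h4
    · linarith
    · exfalso
      rw [mem_slitPlane_iff] at h
      have h5 : (disc x g b z).im = 0 := by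
        have := Complex.sq_norm (disc x g b z)
        rw [normSq_apply] at this
        have h6 : (disc x g b z).im * (disc x g b z).im = 0 := by
          rw [← h4] at this
          linarith
        exact mul_self_eq_zero.1 h6
      rcases h with h | h
      · linarith [norm_nonneg (disc x g b z)]
      · exact h h5
  linarith

theorem rootDisc_mul_im (x g b : ℝ) (z : ℂ) :
    (rootDisc x g b z).re * (rootDisc x g b z).im = z.im * (z.re + g) := by
  have h := congrArg Complex.im (rootDisc_sq x g b z)
  rw [disc_im, pow_two, mul_im] at h
  linarith

theorem rootDisc_re_sq_sub (x g b : ℝ) (z : ℂ) :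
    (rootDisc x g b z).re ^ 2 - (rootDisc x g b z).im ^ 2 =
      z.re ^ 2 - z.im ^ 2 + 2 * g * z.re + (2 * x + g ^ 2 * b ^ 2) := by
  have h := congrArg Complex.re (rootDisc_sq x g b z)
  rw [disc_re, pow_two, mul_re] at h
  linarith

theorem differentiableAt_rootDisc (hx : 0 < x) (hg : 0 < g) {z : ℂ} (hz : -strip x g b ≤ z.re) :
    DifferentiableAt ℂ (rootDisc x g b) z := by
  have h : DifferentiableAt ℂ (disc x g b) z := by unfold disc; fun_prop
  exact h.cpow_const (disc_mem_slitPlane hx hg hz)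

theorem rootDisc_zero (hx : 0 < x) (hg : 0 < g) (b : ℝ) :
    rootDisc x g b 0 = (√(2 * x + g ^ 2 * b ^ 2) : ℝ) := by
  have hV : (√(2 * x + g ^ 2 * b ^ 2)) ^ 2 = 2 * x + g ^ 2 * b ^ 2 := Real.sq_sqrt (by positivity)
  have h1 : rootDisc x g b 0 ^ 2 = ((√(2 * x + g ^ 2 * b ^ 2) : ℝ) : ℂ) ^ 2 := by
    rw [rootDisc_sq, ← ofReal_pow, hV]
    simp [disc]
  rcases sq_eq_sq_iff_eq_or_eq_neg.1 h1 with h | h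
  · exact h
  · have h2 := rootDisc_re_pos (b := b) (z := 0) hx hg (by simpa using (strip_pos hx hg b).le)
    rw [h, neg_re, ofReal_re] at h2
    linarith [Real.sqrt_nonneg (2 * x + g ^ 2 * b ^ 2)]

theorem abs_lt_sqrt (hx : 0 < x) : |g * b| < √(2 * x + g ^ 2 * b ^ 2) :=
  Real.lt_sqrt_of_sq_lt (by rw [sq_abs, mul_pow]; linarith)

/-- `rootDisc` is asymptotic to `z + g` at infinity. -/
theorem norm_rootDisc_sub_le (hx : 0 < x) (hg : 0 < g) (b : ℝ) :
    ∃ D : ℝ, 0 ≤ D ∧ ∀ z : ℂ, -strip x g b ≤ z.re → ‖rootDisc x g b z - z‖ ≤ D := by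
  set d : ℝ := 2 * x + g ^ 2 * b ^ 2 - g ^ 2 with hd
  refine ⟨g + |d| / (g / 2), by positivity, fun z hz => ?_⟩
  set Q := rootDisc x g b z with hQ
  have h1 := (strip_bounds hg hz).1
  have hq := rootDisc_re_pos hx hg hz
  have him := rootDisc_mul_im x g b z
  -- Completing the square leaves a constant, and the second factor has real part at least g/2, so Q
  -- - (z + g) is bounded.
  have hmul : (Q - (z + g)) * (Q + (z + g)) = d := by
    have := rootDisc_sq x g b z
    rw [← hQ, disc] at this
    rw [hd]
    push_cast at this ⊢
    linear_combination this
  have hlow : g / 2 ≤ ‖Q + (z + g)‖ := by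
    refine le_trans ?_ (re_le_norm _)
    simp only [add_re, ofReal_re]
    linarith
  have h2 : ‖Q - (z + g)‖ ≤ |d| / (g / 2) := by
    rw [le_div_iff₀ (by positivity)]
    calc ‖Q - (z + g)‖ * (g / 2) ≤ ‖Q - (z + g)‖ * ‖Q + (z + g)‖ := by gcongr
      _ = |d| := by rw [← norm_mul, hmul, norm_real, Real.norm_eq_abs]
  calc ‖Q - z‖ = ‖(g : ℂ) + (Q - (z + g))‖ := by congr 1; ring
    _ ≤ ‖(g : ℂ)‖ + ‖Q - (z + g)‖ := norm_add_le _ _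
    _ ≤ _ := by
      gcongr
      rw [norm_real, Real.norm_eq_abs, abs_of_pos hg]

theorem waveDen_ne_zero (hx : 0 < x) (hg : 0 < g) {z : ℂ} (hz : -strip x g b ≤ z.re) :
    waveDen x g b z ≠ 0 := by
  intro h
  have hq := rootDisc_re_pos hx hg hz
  have hQ : rootDisc x g b z = -(z + (g * b : ℝ)) := by
    rw [waveDen] at h
    linear_combination h
  -- Squaring removes z² and leaves the linear equation g(1 - b)z = -x. In the strip a solution
  -- needs b > 1 and Re z > 0, and then the root of the discriminant would have negative real part.
  have h1 := rootDisc_sq x g b z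
  rw [hQ, disc] at h1
  have h2 : ((g * (1 - b) : ℝ) : ℂ) * z = ((-x : ℝ) : ℂ) := by
    push_cast at h1 ⊢
    linear_combination -(1 / 2) * h1
  have h3 := congrArg Complex.re h2
  rw [re_ofReal_mul, ofReal_re] at h3
  rw [hQ] at hq
  simp only [neg_re, add_re, ofReal_re] at hq
  have h4 := (strip_bounds hg hz).2
  have hb := neg_abs_le b
  rcases le_total 0 z.re with h0 | h0
  · rcases le_total b 1 with hb1 | hb1
    · nlinarith [mul_nonneg (mul_nonneg hg.le (sub_nonneg.2 hb1)) h0]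
    · nlinarith
  · nlinarith [mul_nonneg hg.le (neg_nonneg.2 h0),
      mul_nonneg (mul_nonneg hg.le (neg_nonneg.2 h0)) (by linarith : 0 ≤ |b| + b)]

theorem differentiableAt_waveDen (hx : 0 < x) (hg : 0 < g) {z : ℂ} (hz : -strip x g b ≤ z.re) :
    DifferentiableAt ℂ (waveDen x g b) z := by
  have := differentiableAt_rootDisc hx hg hz
  unfold waveDen
  fun_prop

theorem differentiableAt_wave (hx : 0 < x) (hg : 0 < g) {z : ℂ} (hz : -strip x g b ≤ z.re) :
    DifferentiableAt ℂ (wave x g b) z := by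
  have h1 := differentiableAt_waveDen hx hg hz
  have h2 := waveDen_ne_zero hx hg hz
  unfold wave
  fun_prop (disch := assumption)

theorem norm_wave_lt_one (hx : 0 < x) (hg : 0 < g) (b : ℝ) {z : ℂ} (hz : 0 ≤ z.re) (hz0 : z ≠ 0) :
    ‖wave x g b z‖ < 1 := by
  have hz' : -strip x g b ≤ z.re := by linarith [strip_pos hx hg b]
  have hp := waveDen_ne_zero hx hg hz'
  have hq := rootDisc_re_pos hx hg hz'
  have h1 := rootDisc_mul_im x g b z
  have h2 := rootDisc_re_sq_sub x g b z
  have hw : wave x g b z = (waveDen x g b z - 2 * z) / waveDen x g b z := by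
    rw [wave]; field_simp
  rw [hw, norm_div, div_lt_one (norm_pos_iff.2 hp)]
  refine lt_of_pow_lt_pow_left₀ 2 (norm_nonneg _) ?_
  rw [Complex.sq_norm, Complex.sq_norm, normSq_apply, normSq_apply]
  simp only [waveDen, add_re, add_im, sub_re, sub_im, mul_re, mul_im, ofReal_re, ofReal_im,
    re_ofNat, im_ofNat]
  set s := z.re
  set y := z.im with hy
  set q := (rootDisc x g b z).re
  set k := (rootDisc x g b z).im
  -- The claim |p - 2z| < |p| amounts to positivity of the bracket. Multiplication by q > 0 allows
  -- the unknown k to be eliminated through qk = y(s + g), leaving a nonnegative combination of s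
  -- and y².
  have hK : 0 < q * (s * (q + g * b) + y * k) := by
    have e1 : q * (s * (q + g * b) + y * k) =
        s * (q ^ 2 + y ^ 2 + g * b * q) + g * y ^ 2 := by
      linear_combination y * h1
    have e2 : x ≤ q ^ 2 + y ^ 2 + g * b * q := by
      nlinarith [sq_nonneg (q + g * b), sq_nonneg k, sq_nonneg s, mul_nonneg hg.le hz,
        sq_nonneg y]
    rw [e1]
    rcases hz.lt_or_eq with h | h
    · have := mul_pos h (hx.trans_le e2)
      positivity
    · have hy0 : y ≠ 0 := fun hy0 => hz0 (Complex.ext h.symm hy0)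
      rw [← h, zero_mul, zero_add]
      positivity
  have := pos_of_mul_pos_right hK hq.le
  linarith

theorem norm_waveDen_ge (hx : 0 < x) (hg : 0 < g) (b : ℝ) :
    ∃ L : ℝ, 1 ≤ L ∧ ∀ z : ℂ, -strip x g b ≤ z.re → L ≤ ‖z‖ → ‖z‖ ≤ ‖waveDen x g b z‖ := by
  obtain ⟨D, hD0, hD⟩ := norm_rootDisc_sub_le hx hg b
  refine ⟨1 + D + |g * b|, by have := abs_nonneg (g * b); linarith, fun z hz hzL => ?_⟩
  have h1 : ‖2 * z‖ ≤ ‖waveDen x g b z‖ + (‖rootDisc x g b z - z‖ + ‖((g * b : ℝ) : ℂ)‖) := by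
    calc ‖2 * z‖ = ‖waveDen x g b z - ((rootDisc x g b z - z) + ((g * b : ℝ) : ℂ))‖ := by
          congr 1; rw [waveDen]; ring
      _ ≤ _ := (norm_sub_le _ _).trans (by gcongr; exact norm_add_le _ _)
  rw [norm_mul, norm_real, Real.norm_eq_abs, Complex.norm_ofNat] at h1
  linarith [hD z hz]

theorem norm_waveDen_sub_le (hx : 0 < x) (hg : 0 < g) (b : ℝ) :
    ∃ M : ℝ, 0 ≤ M ∧ ∀ z : ℂ, -strip x g b ≤ z.re → ‖waveDen x g b z - 2 * z‖ ≤ M := by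
  obtain ⟨D, hD0, hD⟩ := norm_rootDisc_sub_le hx hg b
  refine ⟨D + |g * b|, by positivity, fun z hz => ?_⟩
  calc ‖waveDen x g b z - 2 * z‖ = ‖(rootDisc x g b z - z) + ((g * b : ℝ) : ℂ)‖ := by
        congr 1; rw [waveDen]; ring
    _ ≤ _ := (norm_add_le _ _).trans (by
      gcongr
      · exact hD z hz
      · rw [norm_real, Real.norm_eq_abs])

theorem wave_eq_div (hx : 0 < x) (hg : 0 < g) {z : ℂ} (hz : -strip x g b ≤ z.re) :
    wave x g b z = (waveDen x g b z - 2 * z) / waveDen x g b z := by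
  have hp := waveDen_ne_zero hx hg hz
  rw [wave]; field_simp

theorem norm_wave_le (hx : 0 < x) (hg : 0 < g) (b : ℝ) :
    ∃ M : ℝ, 0 ≤ M ∧ ∃ L : ℝ, 1 ≤ L ∧ ∀ z : ℂ, -strip x g b ≤ z.re → L ≤ ‖z‖ →
      ‖wave x g b z‖ ≤ M / ‖z‖ := by
  obtain ⟨L, hL1, hL⟩ := norm_waveDen_ge hx hg b
  obtain ⟨M, hM0, hM⟩ := norm_waveDen_sub_le hx hg b
  refine ⟨M, hM0, L, hL1, fun z hz hzL => ?_⟩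
  rw [wave_eq_div hx hg hz, norm_div]
  have : 0 < ‖z‖ := by linarith
  gcongr
  · exact hM z hz
  · exact hL z hz hzL

theorem norm_wave_le_half (hx : 0 < x) (hg : 0 < g) (b : ℝ) :
    ∃ L : ℝ, 1 ≤ L ∧ ∀ z : ℂ, -strip x g b ≤ z.re → L ≤ ‖z‖ → ‖wave x g b z‖ ≤ 1 / 2 := by
  obtain ⟨M, hM0, L, hL1, h⟩ := norm_wave_le hx hg b
  refine ⟨max L (2 * M), hL1.trans (le_max_left _ _), fun z hz hzL => ?_⟩
  have h1 := (le_max_left _ _).trans hzL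
  have h2 := (le_max_right _ _).trans hzL
  refine (h z hz h1).trans ?_
  rw [div_le_iff₀ (by linarith)]
  linarith

end

end Flock

/-! ### Gaussian bound near the origin, compactness bounds, amplitudes -/

namespace Flock

open Complex

theorem norm_one_add_le_exp {w : ℂ} : ‖1 + w‖ ≤ Real.exp (w.re + ‖w‖ ^ 2 / 2) := by
  have h1 : ‖1 + w‖ ^ 2 ≤ Real.exp (w.re + ‖w‖ ^ 2 / 2) ^ 2 := by
    rw [← Real.exp_nat_mul]
    have : ‖1 + w‖ ^ 2 = 1 + (2 : ℕ) * (w.re + ‖w‖ ^ 2 / 2) := by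
      rw [Complex.sq_norm, Complex.sq_norm, normSq_apply, normSq_apply]
      simp only [add_re, one_re, add_im, one_im]
      push_cast
      ring
    rw [this]
    linarith [Real.add_one_le_exp ((2 : ℕ) * (w.re + ‖w‖ ^ 2 / 2))]
  exact le_of_sq_le_sq h1 (Real.exp_nonneg _)
where
  le_of_sq_le_sq {a b : ℝ} (h : a ^ 2 ≤ b ^ 2) (hb : 0 ≤ b) : a ≤ b :=
    (abs_le_of_sq_le_sq' h hb).2

open Asymptotics in
/-- A function whose second-order expansion at `0` is that of `exp (-τ z + κ z ^ 2)` with `κ > 0`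
is bounded by a Gaussian in the imaginary direction. -/
theorem exists_norm_le_gaussian {f ρ : ℂ → ℂ} {τ κ : ℝ} (hκ : 0 < κ)
    (hf : ∀ᶠ z in 𝓝 (0 : ℂ), f z = 1 - τ * z + z ^ 2 * ρ z) (hρ : ContinuousAt ρ 0)
    (hρ0 : ρ 0 = (τ ^ 2 / 2 + κ : ℝ)) :
    ∃ l > 0, ∃ c > 0, ∃ C : ℝ, ∀ z : ℂ, ‖z‖ ≤ l →
      ‖f z‖ ≤ Real.exp (-τ * z.re - c * z.im ^ 2 + C * z.re ^ 2) := by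
  set E : ℂ → ℂ := fun z => cexp (τ * z) - (1 + τ * z + τ ^ 2 / 2 * z ^ 2) with hE
  have hE3 : E =O[𝓝 0] fun z : ℂ => z ^ 3 := by
    have h := exp_sub_sum_range_isBigO_pow 3
    have ht : Tendsto (fun z : ℂ => (τ : ℂ) * z) (𝓝 0) (𝓝 0) := by
      have : Continuous fun z : ℂ => (τ : ℂ) * z := by fun_prop
      simpa using this.tendsto 0
    have h2 := h.comp_tendsto ht
    have h3 : (fun z : ℂ => ((τ : ℂ) * z) ^ 3) =O[𝓝 0] fun z : ℂ => z ^ 3 := by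
      simp only [mul_pow]
      exact (isBigO_refl _ _).const_mul_left _
    refine (h2.trans h3).congr_left fun z => ?_
    simp only [Function.comp_apply, hE, Finset.sum_range_succ, Finset.sum_range_zero,
      Nat.factorial]
    push_cast
    ring
  have h32 : (fun z : ℂ => z ^ 3) =o[𝓝 0] fun z : ℂ => z ^ 2 := isLittleO_pow_pow (by norm_num)
  have hE2 : E =o[𝓝 0] fun z : ℂ => z ^ 2 := hE3.trans_isLittleO h32
  have hbd : ∀ u : ℂ → ℂ, ContinuousAt u 0 → u =O[𝓝 0] fun _ => (1 : ℂ) := fun u hu =>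
    (hu.tendsto.isBigO_one ℂ)
  have hr : (fun z => ρ z - ρ 0) =o[𝓝 0] fun _ => (1 : ℂ) := by
    rw [isLittleO_one_iff]
    simpa using hρ.tendsto.sub_const (ρ 0)
  -- Removing the drift e^{-τz} leaves 1 + κz² to second order; `e4` collects the terms of order
  -- three and four from multiplying the two quadratic polynomials.
  have herr : (fun z => f z * cexp (τ * z) - 1 - κ * z ^ 2) =o[𝓝 0] fun z : ℂ => z ^ 2 := by
    have e1 : (fun z => z ^ 2 * (ρ z - ρ 0)) =o[𝓝 0] fun z : ℂ => z ^ 2 := by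
      simpa using (isBigO_refl (fun z : ℂ => z ^ 2) (𝓝 0)).mul_isLittleO hr
    have e2 : (fun z => (z ^ 2 * (ρ z - ρ 0)) * cexp (τ * z)) =o[𝓝 0] fun z : ℂ => z ^ 2 := by
      simpa using e1.mul_isBigO (hbd (fun z => cexp (τ * z)) (by fun_prop))
    have e3 : (fun z => E z * (1 - τ * z + z ^ 2 * ρ 0)) =o[𝓝 0] fun z : ℂ => z ^ 2 := by
      simpa using hE2.mul_isBigO (hbd (fun z => 1 - τ * z + z ^ 2 * ρ 0) (by fun_prop))
    have e4 : (fun z => z ^ 3 * (-τ ^ 3 / 2 + ρ 0 * τ + ρ 0 * τ ^ 2 / 2 * z)) =o[𝓝 0]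
        fun z : ℂ => z ^ 2 := by
      simpa using h32.mul_isBigO
        (hbd (fun z => -(τ : ℂ) ^ 3 / 2 + ρ 0 * τ + ρ 0 * τ ^ 2 / 2 * z) (by fun_prop))
    refine ((e2.add e3).add e4).congr' ?_ (.of_forall fun _ => rfl)
    filter_upwards [hf] with z hz
    have hexp : cexp (τ * z) = E z + (1 + τ * z + τ ^ 2 / 2 * z ^ 2) := by simp [hE]
    rw [hz, hexp, hρ0]
    push_cast
    ring
  have hsmall : ∀ᶠ z in 𝓝 (0 : ℂ), (2 * κ) ^ 2 * ‖z‖ ^ 2 ≤ κ / 4 := by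
    have : Tendsto (fun z : ℂ => (2 * κ) ^ 2 * ‖z‖ ^ 2) (𝓝 0) (𝓝 0) := by
      have : Continuous fun z : ℂ => (2 * κ) ^ 2 * ‖z‖ ^ 2 := by fun_prop
      simpa using this.tendsto 0
    exact this.eventually_le_const (by positivity)
  have hall := (herr.bound (show 0 < κ / 8 by positivity)).and hsmall
  obtain ⟨l, hl, hball⟩ := Metric.eventually_nhds_iff.1 hall
  refine ⟨l / 2, by positivity, κ / 2, by positivity, 2 * κ, fun z hz => ?_⟩
  obtain ⟨h1, h2⟩ := hball (y := z) (by rw [dist_zero_right]; linarith)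
  set w := f z * cexp (τ * z) - 1 with hw
  rw [norm_pow] at h1
  have hn : ‖z‖ ^ 2 = z.re ^ 2 + z.im ^ 2 := by rw [Complex.sq_norm, normSq_apply]; ring
  have hwre : w.re ≤ κ * (z.re ^ 2 - z.im ^ 2) + κ / 8 * ‖z‖ ^ 2 := by
    have h3 := (re_le_norm (w - κ * z ^ 2)).trans h1
    have h4 : ((κ : ℂ) * z ^ 2).re = κ * (z.re ^ 2 - z.im ^ 2) := by
      rw [re_ofReal_mul, pow_two, mul_re]; ring
    rw [sub_re, h4] at h3
    linarith
  have hwn : ‖w‖ ≤ 2 * κ * ‖z‖ ^ 2 := by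
    calc ‖w‖ = ‖(w - κ * z ^ 2) + κ * z ^ 2‖ := by congr 1; ring
      _ ≤ κ / 8 * ‖z‖ ^ 2 + κ * ‖z‖ ^ 2 := by
        refine (norm_add_le _ _).trans (add_le_add h1 ?_)
        rw [norm_mul, norm_pow, norm_real, Real.norm_eq_abs, abs_of_pos hκ]
      _ ≤ _ := by nlinarith [sq_nonneg ‖z‖]
  have hwn2 : ‖w‖ ^ 2 / 2 ≤ κ / 8 * ‖z‖ ^ 2 := by
    have h5 := pow_le_pow_left₀ (norm_nonneg _) hwn 2
    nlinarith [sq_nonneg ‖z‖]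
  have hfz : f z = (1 + w) * cexp (-(τ * z)) := by
    rw [hw, add_sub_cancel, mul_assoc, ← Complex.exp_add]
    simp
  rw [hfz, norm_mul, Complex.norm_exp, neg_re, re_ofReal_mul]
  calc ‖1 + w‖ * Real.exp (-(τ * z.re))
      ≤ Real.exp (w.re + ‖w‖ ^ 2 / 2) * Real.exp (-(τ * z.re)) := by
        gcongr
        exact norm_one_add_le_exp
    _ ≤ _ := by
      rw [← Real.exp_add]
      apply Real.exp_le_exp.2
      rw [hn] at hwre hwn2
      nlinarith [mul_nonneg hκ.le (sq_nonneg z.re), mul_nonneg hκ.le (sq_nonneg z.im)]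

/-- Compactness: counterexamples in ever thinner strips stay bounded because |f| ≤ 1/2 far out, and
a limit point on the imaginary axis away from 0 would have |f| ≥ 1. -/
theorem exists_norm_le_of_lt_one {f : ℂ → ℂ} {ε₀ L : ℝ} (hε₀ : 0 < ε₀)
    (hf : ∀ z : ℂ, -ε₀ ≤ z.re → ContinuousAt f z) (hlt : ∀ z : ℂ, z.re = 0 → z ≠ 0 → ‖f z‖ < 1)
    (hL : ∀ z : ℂ, -ε₀ ≤ z.re → L ≤ ‖z‖ → ‖f z‖ ≤ 1 / 2) {l : ℝ} (hl : 0 < l) :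
    ∃ ε > 0, ∃ q < 1, ∀ z : ℂ, |z.re| ≤ ε → l ≤ ‖z‖ → ‖f z‖ ≤ q := by
  by_contra! hcon
  have hpos : ∀ n : ℕ, 0 < min ε₀ (1 / ((n : ℝ) + 2)) := fun n => by positivity
  -- The shift by 2 makes these thresholds at least 1/2 from n = 0 on, which confines every
  -- counterexample to the ball of radius L.
  have hq : ∀ n : ℕ, 1 - 1 / ((n : ℝ) + 2) < 1 := fun n => by
    have : 0 < 1 / ((n : ℝ) + 2) := by positivity
    linarith
  choose w hw1 hw2 hw3 using fun n => hcon _ (hpos n) _ (hq n)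
  have hstrip : ∀ n, -ε₀ ≤ (w n).re := fun n =>
    neg_le_of_abs_le ((hw1 n).trans (min_le_left _ _))
  have hbd : ∀ n, w n ∈ Metric.closedBall (0 : ℂ) L := fun n => by
    rw [mem_closedBall_zero_iff]
    by_contra! h
    have h1 := hL (w n) (hstrip n) h.le
    have h2 : 1 / ((n : ℝ) + 2) ≤ 1 / 2 := by
      apply one_div_le_one_div_of_le <;> linarith [(Nat.cast_nonneg n : (0 : ℝ) ≤ n)]
    linarith [hw3 n]
  obtain ⟨z, -, φ, hφ, hlim⟩ := (isCompact_closedBall (0 : ℂ) L).tendsto_subseq hbd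
  have hinv : Tendsto (fun n : ℕ => 1 / ((n : ℝ) + 2)) atTop (𝓝 0) := by
    have : Tendsto (fun n : ℕ => (n : ℝ) + 2) atTop atTop :=
      tendsto_atTop_add_const_right _ _ tendsto_natCast_atTop_atTop
    simp only [one_div]
    exact tendsto_inv_atTop_zero.comp this
  have hinv' := hinv.comp hφ.tendsto_atTop
  have hre : z.re = 0 := by
    have h1 : Tendsto (fun n => (w (φ n)).re) atTop (𝓝 z.re) :=
      (continuous_re.tendsto z).comp hlim
    refine tendsto_nhds_unique h1 (squeeze_zero_norm (fun n => ?_) hinv')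
    exact (hw1 (φ n)).trans (min_le_right _ _)
  have hz : l ≤ ‖z‖ := ge_of_tendsto' ((continuous_norm.tendsto z).comp hlim) fun n => hw2 (φ n)
  have hfz : Tendsto (fun n => ‖f (w (φ n))‖) atTop (𝓝 ‖f z‖) :=
    ((hf z (by rw [hre]; linarith)).norm.tendsto).comp hlim
  have h1 : 1 ≤ ‖f z‖ := by
    have h2 : Tendsto (fun n => 1 - 1 / ((φ n : ℝ) + 2)) atTop (𝓝 (1 - 0)) := hinv'.const_sub 1
    rw [sub_zero] at h2
    exact le_of_tendsto_of_tendsto' h2 hfz fun n => (hw3 (φ n)).le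
  exact absurd (hlt z hre (norm_pos_iff.1 (hl.trans_le hz))) (not_lt.2 h1)

theorem isAmplitude_of_bdd {A : ℂ → ℂ} {ε₀ C L : ℝ}
    (hA : ∀ z : ℂ, -ε₀ ≤ z.re → DifferentiableAt ℂ A z)
    (hL : ∀ z : ℂ, -ε₀ ≤ z.re → L ≤ ‖z‖ → ‖A z‖ ≤ C) : IsAmplitude A ε₀ := by
  refine ⟨hA, fun Λ => ?_⟩
  have hK : IsCompact (Metric.closedBall (0 : ℂ) L ∩ {z | -ε₀ ≤ z.re}) :=
    (isCompact_closedBall _ _).inter_right (isClosed_le continuous_const continuous_re)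
  obtain ⟨B, hB⟩ := hK.exists_bound_of_continuousOn (f := A)
    (fun z hz => (hA z hz.2).continuousAt.continuousWithinAt)
  refine ⟨max B C, fun z hz _ => ?_⟩
  rcases le_total L ‖z‖ with h | h
  · exact (hL z hz h).trans (le_max_right _ _)
  · exact (hB z ⟨by simpa using h, hz⟩).trans (le_max_left _ _)

theorem IsAmplitude.mul {A B : ℂ → ℂ} {ε₀ : ℝ} (hA : IsAmplitude A ε₀) (hB : IsAmplitude B ε₀) :
    IsAmplitude (fun z => A z * B z) ε₀ := by
  refine ⟨fun z hz => (hA.diff z hz).mul (hB.diff z hz), fun Λ => ?_⟩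
  obtain ⟨a, ha⟩ := hA.bdd Λ
  obtain ⟨b, hb⟩ := hB.bdd Λ
  refine ⟨a * b, fun z h1 h2 => ?_⟩
  rw [norm_mul]
  exact mul_le_mul (ha z h1 h2) (hb z h1 h2) (norm_nonneg _)
    ((norm_nonneg _).trans (ha z h1 h2))

theorem IsAmplitude.add {A B : ℂ → ℂ} {ε₀ : ℝ} (hA : IsAmplitude A ε₀) (hB : IsAmplitude B ε₀) :
    IsAmplitude (fun z => A z + B z) ε₀ := by
  refine ⟨fun z hz => (hA.diff z hz).add (hB.diff z hz), fun Λ => ?_⟩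
  obtain ⟨a, ha⟩ := hA.bdd Λ
  obtain ⟨b, hb⟩ := hB.bdd Λ
  exact ⟨a + b, fun z h1 h2 => (norm_add_le _ _).trans (add_le_add (ha z h1 h2) (hb z h1 h2))⟩

theorem isAmplitude_const (a : ℂ) (ε₀ : ℝ) : IsAmplitude (fun _ => a) ε₀ :=
  ⟨fun _ _ => differentiableAt_const a, fun _ => ⟨‖a‖, fun _ _ _ => le_rfl⟩⟩

theorem IsAmplitude.pow {A : ℂ → ℂ} {ε₀ : ℝ} (hA : IsAmplitude A ε₀) (n : ℕ) :
    IsAmplitude (fun z => A z ^ n) ε₀ := by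
  induction n with
  | zero => simpa using isAmplitude_const 1 ε₀
  | succ n ih => simpa [pow_succ] using ih.mul hA

section
variable {x g b : ℝ}

theorem isAmplitude_wave (hx : 0 < x) (hg : 0 < g) (b : ℝ) :
    IsAmplitude (wave x g b) (strip x g b) := by
  obtain ⟨L, -, hL⟩ := norm_wave_le_half hx hg b
  exact isAmplitude_of_bdd (fun z hz => differentiableAt_wave hx hg hz) hL

/-- Since Q² - V² = z(z + 2g), the denominator is V + gb + zP with P = 1 + (z + 2g)/(Q + V). Hence
the wave factor is exactly 1 - τz + τz²P/`waveDen`. At 0 the coefficient of z² exceeds τ²/2 by κ =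
τ²g/(2V) > 0, which is the diffusion of the wave. -/
theorem wave_near (hx : 0 < x) (hg : 0 < g) (b : ℝ) :
    ∃ l > 0, ∃ c > 0, ∃ C : ℝ, ∀ z : ℂ, ‖z‖ ≤ l → ‖wave x g b z‖ ≤
      Real.exp (-(2 / (√(2 * x + g ^ 2 * b ^ 2) + g * b)) * z.re - c * z.im ^ 2 + C * z.re ^ 2) := by
  set V := √(2 * x + g ^ 2 * b ^ 2) with hV
  have hV2 : V ^ 2 = 2 * x + g ^ 2 * b ^ 2 := Real.sq_sqrt (by positivity)
  have hV0 : 0 < V := Real.sqrt_pos.2 (by positivity)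
  have hp0 : 0 < V + g * b := by
    have := abs_lt_sqrt (g := g) (b := b) hx
    linarith [neg_abs_le (g * b)]
  set τ := 2 / (V + g * b) with hτ
  have hs := strip_pos hx hg b
  have hnear : ∀ᶠ z in 𝓝 (0 : ℂ), -strip x g b ≤ z.re := by
    have : Tendsto re (𝓝 (0 : ℂ)) (𝓝 0) := by simpa using continuous_re.tendsto 0
    exact this.eventually_const_le (by linarith)
  have h0 : -strip x g b ≤ (0 : ℂ).re := by simpa using hs.le
  have hQc := (differentiableAt_rootDisc hx hg h0).continuousAt
  have hpc := (differentiableAt_waveDen hx hg h0).continuousAt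
  have hQ0 : rootDisc x g b 0 = V := rootDisc_zero hx hg b
  have hVC : (V : ℂ) ≠ 0 := ofReal_ne_zero.2 hV0.ne'
  have hpC : (V : ℂ) + (g : ℂ) * b ≠ 0 := by exact_mod_cast hp0.ne'
  refine exists_norm_le_gaussian (κ := τ ^ 2 / 2 * (g / V))
    (ρ := fun z => τ * (1 + (z + 2 * g) / (rootDisc x g b z + V)) / waveDen x g b z)
    (by positivity) ?_ ?_ ?_
  · filter_upwards [hnear] with z hz
    have hq := rootDisc_re_pos hx hg hz
    have hQV : rootDisc x g b z + V ≠ 0 := by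
      intro h
      have := congrArg Complex.re h
      simp only [add_re, ofReal_re, zero_re] at this
      linarith
    have hp := waveDen_ne_zero hx hg hz
    have hpe : waveDen x g b z = (V + g * b : ℝ) +
        z * (1 + (z + 2 * g) / (rootDisc x g b z + V)) := by
      have hsq := rootDisc_sq x g b z
      have hVc : (V : ℂ) ^ 2 = 2 * x + g ^ 2 * b ^ 2 := by exact_mod_cast hV2
      rw [disc] at hsq
      rw [waveDen]
      push_cast at hsq ⊢
      field_simp
      linear_combination hsq - hVc
    generalize 1 + (z + 2 * g) / (rootDisc x g b z + V) = P at hpe ⊢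
    have hτp : (τ : ℂ) * (V + g * b : ℝ) = 2 := by
      rw [hτ]
      push_cast
      field_simp
    have h2 : 2 * z = (τ * waveDen x g b z - τ * (z * P)) * z := by
      linear_combination (-τ * z : ℂ) * hpe - z * hτp
    rw [wave, h2]
    field_simp
    ring
  · have hne : rootDisc x g b 0 + V ≠ 0 := by
      rw [hQ0]
      exact_mod_cast (by positivity : V + V ≠ 0)
    have hpne := waveDen_ne_zero hx hg h0
    fun_prop (disch := assumption)
  · have hVV : (V : ℂ) + V ≠ 0 := by exact_mod_cast (by positivity : V + V ≠ 0)
    have hw0 : waveDen x g b 0 = V + g * b := by simp [waveDen, hQ0]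
    simp only [hw0, hQ0, hτ]
    push_cast
    rw [zero_add]
    field_simp
    ring

end

end Flock

/-! ### Pulses after j round trips; reflection amplitudes -/

namespace Flock

open Complex

/-- The time a wave needs from one agent to the next. -/
noncomputable def delay (x g b : ℝ) : ℝ := 2 / (√(2 * x + g ^ 2 * b ^ 2) + g * b)

/-- The factor for the wave that has run through the flock to the last agent, and `j` times back
and forth. -/
noncomputable def pulse (x g b : ℝ) (j : ℕ) (z : ℂ) : ℂ :=
  wave x g b z ^ (j + 1) * wave x g (-b) z ^ j

section
variable {x g : ℝ}

theorem differentiableAt_wave_neg (hx : 0 < x) (hg : 0 < g) {b : ℝ} {z : ℂ}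
    (hz : -strip x g b ≤ z.re) : DifferentiableAt ℂ (wave x g (-b)) z :=
  differentiableAt_wave hx hg (by rwa [strip_neg])

theorem isAmplitude_wave_neg (hx : 0 < x) (hg : 0 < g) (b : ℝ) :
    IsAmplitude (wave x g (-b)) (strip x g b) := by
  have := isAmplitude_wave hx hg (-b)
  rwa [strip_neg] at this

theorem isAmplitude_pulse (hx : 0 < x) (hg : 0 < g) (b : ℝ) (j : ℕ) :
    IsAmplitude (pulse x g b j) (strip x g b) :=
  ((isAmplitude_wave hx hg b).pow (j + 1)).mul ((isAmplitude_wave_neg hx hg b).pow j)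

/-- The exponents of the local bounds add up. One factor `wave x g b` supplies both the decay at
infinity and the strict inequality on the imaginary axis; the other factors need only be bounded,
which also covers j = 0. -/
theorem isFront_pulse (hx : 0 < x) (hg : 0 < g) (b : ℝ) (j : ℕ) :
    IsFront (pulse x g b j) (strip x g b) ((j + 1) * delay x g b + j * delay x g (-b)) := by
  refine ⟨(isAmplitude_pulse hx hg b j).diff, fun Λ => ?_, fun l hl => ?_, ?_, ?_⟩
  · obtain ⟨M, hM0, L, hL1, hM⟩ := norm_wave_le hx hg b
    obtain ⟨B, hB⟩ := (isAmplitude_pulse hx hg b j).bdd Λ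
    obtain ⟨K, hK⟩ := (((isAmplitude_wave hx hg b).mul
      (isAmplitude_wave_neg hx hg b)).pow j).bdd Λ
    refine ⟨B ^ 2 * (1 + L ^ 2) + K ^ 2 * M ^ 2 * 2, fun z h1 h2 => ?_⟩
    have him : z.im ^ 2 ≤ ‖z‖ ^ 2 := by
      rw [← sq_abs z.im]; exact pow_le_pow_left₀ (abs_nonneg _) (abs_im_le_norm z) 2
    rw [← div_eq_mul_inv, le_div_iff₀ (by positivity)]
    rcases le_total L ‖z‖ with h | h
    · have hz1 : 1 ≤ ‖z‖ := hL1.trans h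
      have h3 : ‖pulse x g b j z‖ ≤ K * (M / ‖z‖) := by
        have : pulse x g b j z = (wave x g b z * wave x g (-b) z) ^ j * wave x g b z := by
          rw [pulse]; ring
        rw [this, norm_mul]
        exact mul_le_mul (hK z h1 h2) (hM z h1 h) (norm_nonneg _)
          ((norm_nonneg _).trans (hK z h1 h2))
      calc ‖pulse x g b j z‖ ^ 2 * (1 + z.im ^ 2) ≤ (K * (M / ‖z‖)) ^ 2 * (2 * ‖z‖ ^ 2) := by
            gcongr
            nlinarith
        _ = K ^ 2 * M ^ 2 * 2 := by field_simp
        _ ≤ _ := by linarith [mul_nonneg (sq_nonneg B) (by positivity : 0 ≤ 1 + L ^ 2)]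
    · calc ‖pulse x g b j z‖ ^ 2 * (1 + z.im ^ 2) ≤ B ^ 2 * (1 + L ^ 2) := by
            have h3 := him.trans (pow_le_pow_left₀ (norm_nonneg z) h 2)
            have h4 := hB z h1 h2
            gcongr
        _ ≤ _ := by linarith [mul_nonneg (mul_nonneg (sq_nonneg K) (sq_nonneg M)) zero_le_two]
  · obtain ⟨L, hL1, hL⟩ := norm_wave_le_half hx hg b
    obtain ⟨L', hL1', hL'⟩ := norm_wave_le_half hx hg (-b)
    rw [strip_neg] at hL'
    refine exists_norm_le_of_lt_one (strip_pos hx hg b) (L := max L L')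
      (fun z hz => ((isAmplitude_pulse hx hg b j).diff z hz).continuousAt) (fun z hz h0 => ?_)
      (fun z hz h => ?_) hl
    · have h1 := norm_wave_lt_one hx hg b hz.ge h0
      have h2 := norm_wave_lt_one hx hg (-b) hz.ge h0
      rw [pulse, norm_mul, norm_pow, norm_pow, pow_succ]
      calc _ ≤ (1 : ℝ) * ‖wave x g b z‖ * 1 := by
            gcongr
            · exact pow_le_one₀ (norm_nonneg _) h1.le
            · exact pow_le_one₀ (norm_nonneg _) h2.le
        _ < 1 := by simpa using h1
    · have h1 := hL z hz ((le_max_left _ _).trans h)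
      have h2 := hL' z hz ((le_max_right _ _).trans h)
      rw [pulse, norm_mul, norm_pow, norm_pow, pow_succ]
      calc _ ≤ (1 : ℝ) * (1 / 2) * 1 := by
            gcongr
            · exact pow_le_one₀ (norm_nonneg _) (by linarith)
            · exact pow_le_one₀ (norm_nonneg _) (by linarith)
        _ = 1 / 2 := by norm_num
  · obtain ⟨l, hl, c, hc, C, h⟩ := wave_near hx hg b
    obtain ⟨l', hl', c', hc', C', h'⟩ := wave_near hx hg (-b)
    refine ⟨min l l', lt_min hl hl', (j + 1) * c + j * c', by positivity, (j + 1) * C + j * C',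
      fun z hz => ?_⟩
    have h1 := h z (hz.trans (min_le_left _ _))
    have h2 := h' z (hz.trans (min_le_right _ _))
    rw [pulse, norm_mul, norm_pow, norm_pow]
    refine (mul_le_mul (pow_le_pow_left₀ (norm_nonneg _) h1 (j + 1))
      (pow_le_pow_left₀ (norm_nonneg _) h2 j) (by positivity) (by positivity)).trans_eq ?_
    rw [← Real.exp_nat_mul, ← Real.exp_nat_mul, ← Real.exp_add, delay, delay]
    congr 1
    push_cast
    ring
  · simp [pulse, wave]

theorem wave_line (hx : 0 < x) (hg : 0 < g) (b : ℝ) {Λ : ℝ} (hΛ : 0 < Λ) :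
    ∃ q < 1, ∀ z : ℂ, z.re = Λ → ‖wave x g b z‖ ≤ q := by
  obtain ⟨L, hL1, hL⟩ := norm_wave_le_half hx hg b
  have hs := strip_pos hx hg b
  have hK : IsCompact (Metric.closedBall (0 : ℂ) (L + Λ) ∩ {z | z.re = Λ}) :=
    (isCompact_closedBall _ _).inter_right (isClosed_eq continuous_re continuous_const)
  obtain ⟨w, hw, hmax⟩ := hK.exists_isMaxOn (f := fun z => ‖wave x g b z‖)
    ⟨Λ, by simp [abs_of_pos hΛ]; linarith, by simp⟩
    (fun z hz => ((differentiableAt_wave hx hg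
      (by have : z.re = Λ := hz.2
          linarith)).continuousAt.norm).continuousWithinAt)
  have hw1 : ‖wave x g b w‖ < 1 := by
    have hwre : w.re = Λ := hw.2
    refine norm_wave_lt_one hx hg b (by linarith) fun h => ?_
    rw [h, zero_re] at hwre
    linarith
  refine ⟨max ‖wave x g b w‖ (1 / 2), max_lt hw1 (by norm_num), fun z hz => ?_⟩
  rcases le_total L ‖z‖ with h | h
  · exact (hL z (by linarith) h).trans (le_max_right _ _)
  · exact (hmax ⟨by simpa using by linarith, hz⟩ : _).trans (le_max_left _ _)

/-- A zero would give Q = -gb and hence z² + 2gz + 2x = 0. In the strip the imaginary part forces z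
to be real, and then the left-hand side is at least x. The regular boundary condition divides by
this factor for -b. -/
theorem one_add_wave_ne_zero (hx : 0 < x) (hg : 0 < g) {b : ℝ} {z : ℂ}
    (hz : -strip x g b ≤ z.re) : 1 + wave x g b z ≠ 0 := by
  have hp := waveDen_ne_zero hx hg hz
  intro h
  have h1 : rootDisc x g b z + (g * b : ℝ) = 0 := by
    rw [wave_eq_div hx hg hz] at h
    field_simp at h
    rw [waveDen] at h
    linear_combination h / 2
  have h2 := rootDisc_sq x g b z
  rw [eq_neg_of_add_eq_zero_left h1, disc] at h2
  have h3 : z ^ 2 + 2 * g * z + (2 * x : ℝ) = 0 := by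
    push_cast at h2 ⊢
    linear_combination -h2
  have hre := congrArg Complex.re h3
  have him := congrArg Complex.im h3
  simp only [pow_two, add_re, add_im, mul_re, mul_im, ofReal_re, ofReal_im, re_ofNat, im_ofNat,
    zero_re, zero_im] at hre him
  have e1 := (strip_bounds hg hz).1
  have e2 := strip_bound' hx hg hz
  have h4 : z.im * (z.re + g) = 0 := by linarith
  have h5 : z.im = 0 := (mul_eq_zero.1 h4).resolve_right (by linarith)
  rw [h5] at hre
  nlinarith [sq_nonneg z.re]

theorem isAmplitude_root_div (hx : 0 < x) (hg : 0 < g) (b : ℝ) :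
    IsAmplitude (fun z => 2 * rootDisc x g b z / waveDen x g b z) (strip x g b) := by
  obtain ⟨L, hL1, hL⟩ := norm_waveDen_ge hx hg b
  obtain ⟨D, hD0, hD⟩ := norm_rootDisc_sub_le hx hg b
  refine isAmplitude_of_bdd (L := L) (C := 2 * (1 + D)) (fun z hz => ?_) (fun z hz h => ?_)
  · have h1 := differentiableAt_waveDen hx hg hz
    have h2 := waveDen_ne_zero hx hg hz
    have h3 := differentiableAt_rootDisc hx hg hz
    fun_prop (disch := assumption)
  · have hz1 : 1 ≤ ‖z‖ := hL1.trans h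
    have hp := hL z hz h
    rw [norm_div, norm_mul, Complex.norm_ofNat, div_le_iff₀ (by linarith)]
    have h1 : ‖rootDisc x g b z‖ ≤ D + ‖z‖ := by
      calc ‖rootDisc x g b z‖ = ‖(rootDisc x g b z - z) + z‖ := by rw [sub_add_cancel]
        _ ≤ _ := (norm_add_le _ _).trans (by gcongr; exact hD z hz)
    nlinarith

theorem isAmplitude_reflection (hx : 0 < x) (hg : 0 < g) (b : ℝ) :
    IsAmplitude (fun z => (waveDen x g (-b) z - 2 * z) / waveDen x g b z) (strip x g b) := by
  obtain ⟨L, hL1, hL⟩ := norm_waveDen_ge hx hg b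
  obtain ⟨M, hM0, hM⟩ := norm_waveDen_sub_le hx hg (-b)
  rw [strip_neg] at hM
  refine isAmplitude_of_bdd (L := L) (C := M) (fun z hz => ?_) (fun z hz h => ?_)
  · have h1 := differentiableAt_waveDen hx hg hz
    have h2 := waveDen_ne_zero hx hg hz
    have h3 := differentiableAt_waveDen (b := -b) hx hg (by rwa [strip_neg])
    fun_prop (disch := assumption)
  · have hz1 : 1 ≤ ‖z‖ := hL1.trans h
    have hp := hL z hz h
    rw [norm_div, div_le_iff₀ (by linarith)]
    nlinarith [hM z hz]

theorem isAmplitude_inv_one_add (hx : 0 < x) (hg : 0 < g) (b : ℝ) :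
    IsAmplitude (fun z => (1 + wave x g (-b) z)⁻¹) (strip x g b) := by
  obtain ⟨L, hL1, hL⟩ := norm_wave_le_half hx hg (-b)
  rw [strip_neg] at hL
  refine isAmplitude_of_bdd (L := L) (C := 2) (fun z hz => ?_) (fun z hz h => ?_)
  · have h1 := differentiableAt_wave_neg hx hg hz
    have h2 := one_add_wave_ne_zero (b := -b) (z := z) hx hg (by rwa [strip_neg])
    fun_prop (disch := assumption)
  · have h1 := hL z hz h
    have h2 : 1 ≤ ‖1 + wave x g (-b) z‖ + ‖wave x g (-b) z‖ := by
      simpa using norm_sub_le (1 + wave x g (-b) z) (wave x g (-b) z)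
    rw [norm_inv]
    exact inv_le_of_inv_le₀ (by norm_num) (by linarith)

/-- Amplitude of the wave that reaches the last agent first. -/
noncomputable def ampE (x g b : ℝ) : Boundary → ℂ → ℂ
  | .variableMass => fun z => wave x g b z * (2 * rootDisc x g b z / waveDen x g b z)
  | .regular => fun z => (wave x g (-b) z + wave x g b z) *
      (2 * rootDisc x g b z / waveDen x g b z) * (1 + wave x g (-b) z)⁻¹

/-- Factor of the amplitude for a run back and forth through the flock. -/
noncomputable def ampF (x g b : ℝ) : Boundary → ℂ → ℂ
  | .variableMass => fun z => -1 * (wave x g b z * wave x g (-b) z) *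
      ((waveDen x g (-b) z - 2 * z) / waveDen x g b z)
  | .regular => fun z => -1 * wave x g (-b) z * ((waveDen x g (-b) z - 2 * z) / waveDen x g b z) *
      ((1 + wave x g b z) * (1 + wave x g (-b) z)⁻¹)

theorem isAmplitude_ampE (hx : 0 < x) (hg : 0 < g) (b : ℝ) (bc : Boundary) :
    IsAmplitude (ampE x g b bc) (strip x g b) := by
  have h1 := isAmplitude_wave hx hg b
  have h2 := isAmplitude_wave_neg hx hg b
  have h3 := isAmplitude_root_div hx hg b
  cases bc
  · exact h1.mul h3
  · exact ((h2.add h1).mul h3).mul (isAmplitude_inv_one_add hx hg b)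

theorem isAmplitude_ampF (hx : 0 < x) (hg : 0 < g) (b : ℝ) (bc : Boundary) :
    IsAmplitude (ampF x g b bc) (strip x g b) := by
  have h1 := isAmplitude_wave hx hg b
  have h2 := isAmplitude_wave_neg hx hg b
  have h3 := isAmplitude_reflection hx hg b
  have h4 := isAmplitude_const (-1) (strip x g b)
  have h5 := isAmplitude_const 1 (strip x g b)
  cases bc
  · exact (h4.mul (h1.mul h2)).mul h3
  · exact ((h4.mul h2).mul h3).mul ((h5.add h1).mul (isAmplitude_inv_one_add hx hg b))

/-- At 0 both wave factors are 1, so the factors in which the two boundary conditions differ are 1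
as well. -/
theorem ampF_zero (hx : 0 < x) (hg : 0 < g) (b : ℝ) (bc : Boundary) :
    ampF x g b bc 0 = ((-(√(2 * x + g ^ 2 * b ^ 2) - g * b) / (√(2 * x + g ^ 2 * b ^ 2) + g * b) :
      ℝ) : ℂ) := by
  have hQ0 : rootDisc x g b 0 = _ := rootDisc_zero hx hg b
  have hQ1 : rootDisc x g (-b) 0 = _ := (rootDisc_neg x g b 0).trans hQ0
  cases bc <;> simp [ampF, wave, waveDen, hQ0, hQ1] <;> ring

theorem ampE_zero (hx : 0 < x) (hg : 0 < g) (b : ℝ) (bc : Boundary) :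
    ampE x g b bc 0 = 1 - ampF x g b bc 0 := by
  have hV : 0 < √(2 * x + g ^ 2 * b ^ 2) + g * b := by
    have := abs_lt_sqrt (g := g) (b := b) hx
    linarith [neg_abs_le (g * b)]
  have hV' : (√(2 * x + g ^ 2 * b ^ 2) : ℂ) + g * b ≠ 0 := by exact_mod_cast hV.ne'
  have hQ0 : rootDisc x g b 0 = _ := rootDisc_zero hx hg b
  rw [ampF_zero hx hg]
  push_cast
  cases bc <;> simp [ampE, wave, waveDen, hQ0] <;> field_simp <;> ring

end

end Flock

/-! ### Solving the recursion for the last agent -/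

namespace Flock

open Complex

section
variable {R : Type*} [CommRing R] {r s : R} {X : ℕ → R} {n : ℕ}

/-- The recursion factors with roots r and 1/s. The combination X (k + 1) - r X k annihilates the
mode r^k, so s times it at step k is its value at step k - 1. In `left_going` the roles are
exchanged. -/
theorem right_going (h : ∀ k, 1 ≤ k → k ≤ n → (1 + r * s) * X k = s * X (k + 1) + r * X (k - 1)) :
    X 1 - r * X 0 = s ^ n * (X (n + 1) - r * X n) := by
  induction n with
  | zero => simp
  | succ n ih =>
    rw [ih fun k h1 h2 => h k h1 (by omega)]
    have := h (n + 1) (by omega) le_rfl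
    rw [Nat.add_sub_cancel] at this
    linear_combination s ^ n * this

theorem left_going (h : ∀ k, 1 ≤ k → k ≤ n → (1 + r * s) * X k = s * X (k + 1) + r * X (k - 1)) :
    X n - s * X (n + 1) = r ^ n * (X 0 - s * X 1) := by
  induction n with
  | zero => simp
  | succ n ih =>
    have h1 := ih fun k h1 h2 => h k h1 (by omega)
    have := h (n + 1) (by omega) le_rfl
    rw [Nat.add_sub_cancel] at this
    linear_combination this + r * h1

/-- Linear elimination of X 1 and X n. Here `hlast` is the recursion at the last agent with a
fictitious successor in the same position, while `last_of_regular` corresponds to a successor that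
copies the predecessor. -/
theorem last_of_variableMass
    (h : ∀ k, 1 ≤ k → k ≤ n → (1 + r * s) * X k = s * X (k + 1) + r * X (k - 1)) (h0 : X 0 = 1)
    (hlast : (1 + r * s) * X (n + 1) = s * X (n + 1) + r * X n) :
    X (n + 1) * ((1 - s) + r ^ (n + 1) * s ^ (n + 2) * (1 - r)) = r ^ (n + 1) * (1 - r * s) := by
  have h1 := right_going h
  have h2 := left_going h
  rw [h0] at h1 h2
  linear_combination (1 - r ^ (n + 1) * s ^ (n + 1)) * hlast + r * h2 - r ^ (n + 1) * s * h1

theorem last_of_regular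
    (h : ∀ k, 1 ≤ k → k ≤ n → (1 + r * s) * X k = s * X (k + 1) + r * X (k - 1)) (h0 : X 0 = 1)
    (hlast : (1 + r * s) * X (n + 1) = (s + r) * X n) :
    X (n + 1) * ((1 - s ^ 2) + r ^ n * s ^ (n + 2) * (1 - r ^ 2)) =
      r ^ n * ((s + r) * (1 - r * s)) := by
  have h1 := right_going h
  have h2 := left_going h
  rw [h0] at h1 h2
  linear_combination (1 - r ^ (n + 1) * s ^ (n + 1)) * hlast + (s + r) * h2 -
    r ^ n * s * (s + r) * h1

end

section
variable {x g b : ℝ} {z : ℂ}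

theorem waveDen_mul_sub (x g b : ℝ) (z : ℂ) :
    (waveDen x g (-b) z - 2 * z) * waveDen x g b z = 4 * (x / 2 - g * (b - 1) / 2 * z) := by
  have h := rootDisc_sq x g b z
  simp only [waveDen, rootDisc_neg]
  rw [disc] at h
  push_cast at h ⊢
  linear_combination h

theorem waveDen_sub_mul (x g b : ℝ) (z : ℂ) :
    (waveDen x g b z - 2 * z) * waveDen x g (-b) z = 4 * (x / 2 + g * (b + 1) / 2 * z) := by
  have h := rootDisc_sq x g b z
  simp only [waveDen, rootDisc_neg]
  rw [disc] at h
  push_cast at h ⊢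
  linear_combination h

theorem waveDen_mul (x g b : ℝ) (z : ℂ) :
    waveDen x g b z * waveDen x g (-b) z +
      (waveDen x g b z - 2 * z) * (waveDen x g (-b) z - 2 * z) = 4 * (z ^ 2 + g * z + x) := by
  have h := rootDisc_sq x g b z
  simp only [waveDen, rootDisc_neg]
  rw [disc] at h
  push_cast at h ⊢
  linear_combination 2 * h

theorem waveDen_neg_ne_zero (hx : 0 < x) (hg : 0 < g) (hz : -strip x g b ≤ z.re) :
    waveDen x g (-b) z ≠ 0 := waveDen_ne_zero hx hg (by rwa [strip_neg])

theorem wave_neg_eq_div (hx : 0 < x) (hg : 0 < g) (hz : -strip x g b ≤ z.re) :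
    wave x g (-b) z = (waveDen x g (-b) z - 2 * z) / waveDen x g (-b) z :=
  wave_eq_div hx hg (by rwa [strip_neg])

/-- The recursion of the transforms in terms of the wave factors. -/
theorem wave_recursion (hx : 0 < x) (hg : 0 < g) (hz : -strip x g b ≤ z.re) {X₀ X₁ X₂ : ℂ}
    (h : z ^ 2 * X₁ = (x / 2 - g * (b - 1) / 2 * z) * (X₂ - X₁) -
      (x / 2 + g * (b + 1) / 2 * z) * (X₁ - X₀)) :
    (1 + wave x g b z * wave x g (-b) z) * X₁ =
      wave x g (-b) z * X₂ + wave x g b z * X₀ := by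
  have hp := waveDen_ne_zero hx hg hz
  have hm := waveDen_neg_ne_zero hx hg hz
  have e1 := waveDen_mul_sub x g b z
  have e2 := waveDen_sub_mul x g b z
  have e3 := waveDen_mul x g b z
  rw [wave_eq_div hx hg hz, wave_neg_eq_div hx hg hz]
  field_simp
  linear_combination 4 * h + X₁ * e3 - X₂ * e1 - X₀ * e2

/-- Solving for the last agent requires division by 1 - s, which vanishes at z = 0. This identity
and `one_sub_wave` cancel that zero algebraically, so the amplitudes are holomorphic across the
imaginary axis. -/
theorem one_sub_wave_mul (hx : 0 < x) (hg : 0 < g) (hz : -strip x g b ≤ z.re) :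
    1 - wave x g b z * wave x g (-b) z =
      (1 - wave x g (-b) z) * (2 * rootDisc x g b z / waveDen x g b z) := by
  have hp := waveDen_ne_zero hx hg hz
  have hm := waveDen_neg_ne_zero hx hg hz
  have hsum : waveDen x g b z + waveDen x g (-b) z = 2 * z + 2 * rootDisc x g b z := by
    simp only [waveDen, rootDisc_neg]
    push_cast
    ring
  rw [wave, wave]
  field_simp
  linear_combination 2 * z * hsum

theorem one_sub_wave (hx : 0 < x) (hg : 0 < g) (hz : -strip x g b ≤ z.re) :
    wave x g (-b) z * (1 - wave x g b z) =
      (1 - wave x g (-b) z) * ((waveDen x g (-b) z - 2 * z) / waveDen x g b z) := by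
  have hp := waveDen_ne_zero hx hg hz
  have hm := waveDen_neg_ne_zero hx hg hz
  rw [wave, wave]
  field_simp
  ring

theorem last_eq (hx : 0 < x) (hg : 0 < g) (hz : -strip x g b ≤ z.re) (hz0 : z ≠ 0) {X : ℕ → ℂ}
    {n : ℕ} (bc : Boundary) (h0 : X 0 = 1)
    (h : ∀ k, 1 ≤ k → k ≤ n →
      z ^ 2 * X k = (x / 2 - g * (b - 1) / 2 * z) * (X (k + 1) - X k) -
        (x / 2 + g * (b + 1) / 2 * z) * (X k - X (k - 1)))
    (hlast : z ^ 2 * X (n + 1) = match bc with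
      | .variableMass => -(x / 2 + g * (b + 1) / 2 * z) * (X (n + 1) - X n)
      | .regular => -(x + g * z) * (X (n + 1) - X n)) :
    X (n + 1) * (1 - ampF x g b bc z * (wave x g b z ^ n * wave x g (-b) z ^ n)) =
      ampE x g b bc z * wave x g b z ^ n := by
  have hrec := fun k h1 h2 => wave_recursion hx hg hz (h k h1 h2)
  have hm := waveDen_neg_ne_zero hx hg hz
  have hs1 : 1 - wave x g (-b) z ≠ 0 := by
    rw [wave, sub_sub_cancel]
    exact div_ne_zero (mul_ne_zero two_ne_zero hz0) hm
  have e1 := one_sub_wave_mul hx hg hz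
  have e2 := one_sub_wave hx hg hz
  have hs2 := one_add_wave_ne_zero (b := -b) (z := z) hx hg (by rwa [strip_neg])
  cases bc with
  | variableMass =>
    have hl := wave_recursion hx hg hz (X₀ := X n) (X₁ := X (n + 1)) (X₂ := X (n + 1))
      (by rw [hlast]; ring)
    have := last_of_variableMass hrec h0 hl
    simp only [ampE, ampF]
    generalize (waveDen x g (-b) z - 2 * z) / waveDen x g b z = M at e2 ⊢
    generalize 2 * rootDisc x g b z / waveDen x g b z = Q at e1 ⊢
    refine mul_left_cancel₀ hs1 ?_
    generalize wave x g (-b) z = s at *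
    generalize wave x g b z = r at *
    linear_combination this + r ^ (n + 1) * e1 - X (n + 1) * r ^ (n + 1) * s ^ (n + 1) * e2
  | regular =>
    have hl := wave_recursion hx hg hz (X₀ := X n) (X₁ := X (n + 1)) (X₂ := X n)
      (by rw [hlast]; ring)
    have := last_of_regular hrec h0 (by rw [hl]; ring)
    simp only [ampE, ampF]
    generalize (waveDen x g (-b) z - 2 * z) / waveDen x g b z = M at e2 ⊢
    generalize 2 * rootDisc x g b z / waveDen x g b z = Q at e1 ⊢
    -- The regular condition brings in 1 - s² = (1 - s)(1 + s), hence the second factor to be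
    -- cancelled.
    refine mul_left_cancel₀ (mul_ne_zero hs1 hs2) ?_
    generalize wave x g (-b) z = s at *
    generalize wave x g b z = r at *
    have hi := mul_inv_cancel₀ hs2
    generalize (1 + s)⁻¹ = i at hi ⊢
    linear_combination this + r ^ n * (s + r) * e1 -
      X (n + 1) * r ^ n * s ^ (n + 1) * (1 + r) * e2 + ((1 - s) * s * M * (1 + r) * r ^ n * s ^ n *
        X (n + 1) - (1 - s) * (s + r) * Q * r ^ n) * hi

end

end Flock

/-! ### Laplace transform, its inversion, and linear chains -/

namespace Flock

open Complex MeasureTheory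

/-- Laplace transform of a real function. -/
noncomputable def lap (u : ℝ → ℝ) (z : ℂ) : ℂ := ∫ t in Ioi (0 : ℝ), cexp (-z * t) * (u t : ℂ)

/-- Continuous on the half-line with exponential growth of rate `K`. -/
structure HasGrowth (u : ℝ → ℝ) (K : ℝ) : Prop where
  cont : Continuous u
  bound : ∃ C, ∀ t ≥ 0, |u t| ≤ C * Real.exp (K * t)

theorem norm_exp_neg_mul (z : ℂ) (t : ℝ) : ‖cexp (-z * t)‖ = Real.exp (-z.re * t) := by
  rw [Complex.norm_exp, Complex.re_mul_ofReal, neg_re]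

theorem HasGrowth.integrableOn {u : ℝ → ℝ} {K : ℝ} (hu : HasGrowth u K) {z : ℂ} (hz : K < z.re) :
    IntegrableOn (fun t : ℝ => cexp (-z * t) * (u t : ℂ)) (Ioi 0) := by
  obtain ⟨C, hC⟩ := hu.bound
  have hc := hu.cont
  refine Integrable.mono' ((integrableOn_exp_mul_Ioi (a := K - z.re) (by linarith) 0).const_mul C)
    (Continuous.aestronglyMeasurable (by fun_prop)) ?_
  refine ae_restrict_of_forall_mem measurableSet_Ioi fun t ht => ?_
  rw [norm_mul, norm_exp_neg_mul, norm_real, Real.norm_eq_abs]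
  calc Real.exp (-z.re * t) * |u t| ≤ Real.exp (-z.re * t) * (C * Real.exp (K * t)) := by
        gcongr
        exact hC t (mem_Ioi.1 ht).le
    _ = C * (Real.exp (-z.re * t) * Real.exp (K * t)) := by ring
    _ = _ := by rw [← Real.exp_add]; ring_nf

theorem lap_deriv {u u' : ℝ → ℝ} {K : ℝ} (hu : HasGrowth u K) {z : ℂ} (hz : K < z.re)
    (hd : ∀ t > 0, HasDerivAt u (u' t) t)
    (hi : IntegrableOn (fun t : ℝ => cexp (-z * t) * (u' t : ℂ)) (Ioi 0)) :
    lap u' z = z * lap u z - u 0 := by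
  have hc := hu.cont
  have h1 : ∀ t ∈ Ioi (0 : ℝ), HasDerivAt (fun t : ℝ => cexp (-z * t) * (u t : ℂ))
      (cexp (-z * t) * (u' t : ℂ) - z * (cexp (-z * t) * (u t : ℂ))) t := by
    intro t ht
    have e1 : HasDerivAt (fun t : ℝ => cexp (-z * t)) (cexp (-z * t) * (-z * 1)) t :=
      (((hasDerivAt_id t).ofReal_comp).const_mul (-z)).cexp
    have e2 := (hd t ht).ofReal_comp
    refine (e1.mul e2).congr_deriv ?_
    ring
  obtain ⟨C, hC⟩ := hu.bound
  have hlim : Tendsto (fun t : ℝ => cexp (-z * t) * (u t : ℂ)) atTop (𝓝 0) := by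
    have h0 : Tendsto (fun t : ℝ => C * Real.exp ((K - z.re) * t)) atTop (𝓝 0) := by
      have : Tendsto (fun t : ℝ => (K - z.re) * t) atTop atBot :=
        tendsto_id.const_mul_atTop_of_neg (by linarith)
      simpa using (Real.tendsto_exp_atBot.comp this).const_mul C
    refine squeeze_zero_norm' ?_ h0
    filter_upwards [eventually_ge_atTop 0] with t ht
    rw [norm_mul, norm_exp_neg_mul, norm_real, Real.norm_eq_abs]
    calc Real.exp (-z.re * t) * |u t| ≤ Real.exp (-z.re * t) * (C * Real.exp (K * t)) := by
          gcongr
          exact hC t ht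
      _ = C * (Real.exp (-z.re * t) * Real.exp (K * t)) := by ring
      _ = _ := by rw [← Real.exp_add]; ring_nf
  have hiu := hu.integrableOn hz
  have := integral_Ioi_of_hasDerivAt_of_tendsto
    (Continuous.continuousWithinAt (by fun_prop)) h1 (hi.sub (hiu.const_mul z)) hlim
  rw [integral_sub hi (hiu.const_mul z), integral_const_mul] at this
  simp only [ofReal_zero, mul_zero, exp_zero, one_mul, zero_sub] at this
  rw [lap, lap]
  linear_combination this

theorem lap_const {z : ℂ} (hz : 0 < z.re) (a : ℝ) : lap (fun _ => a) z = a / z := by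
  rw [lap, integral_mul_const, integral_exp_mul_complex_Ioi (by simpa using hz)]
  simp
  ring

/-- Inversion of the Laplace transform. -/
theorem lap_inversion {u : ℝ → ℝ} {K Λ : ℝ} (hu : HasGrowth u K) (hΛ : K < Λ)
    (hneg : ∀ t ≤ 0, u t = 0) (hint : Integrable fun y : ℝ => lap u (Λ + y * I)) (t : ℝ) :
    lineIntegral (lap u) Λ t = 2 * Real.pi * u t := by
  have hpi : (2 * Real.pi) ≠ 0 := by positivity
  -- As u is continuous and vanishes for t ≤ 0, f is continuous and integrable on the whole line, so
  -- Fourier inversion holds at every point.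
  set f : ℝ → ℂ := fun t => cexp (-(Λ : ℂ) * t) * (u t : ℂ) with hf
  have hc := hu.cont
  have hfc : Continuous f := by fun_prop
  have hfi : Integrable f := by
    rw [← integrableOn_univ, ← Iic_union_Ioi (a := (0 : ℝ))]
    refine IntegrableOn.union ?_ (hu.integrableOn (by simpa using hΛ))
    refine (integrableOn_zero (ε' := ℂ)).congr_fun (fun t ht => ?_) measurableSet_Iic
    simp [hf, hneg t ht]
  have hF : FourierTransform.fourier f = fun ξ : ℝ => lap u (Λ + (2 * Real.pi * ξ : ℝ) * I) := by
    ext ξ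
    rw [Real.fourier_eq', lap, ← integral_indicator measurableSet_Ioi]
    refine integral_congr_ae (.of_forall fun s => ?_)
    rcases le_or_gt s 0 with h | h
    · simp [hf, hneg s h, h]
    · simp only [indicator_of_mem (mem_Ioi.2 h), hf, smul_eq_mul]
      rw [← mul_assoc, ← Complex.exp_add]
      congr 2
      simp only [RCLike.inner_apply, conj_trivial]
      push_cast
      ring
  have hFi : Integrable (FourierTransform.fourier f) := by
    rw [hF]
    exact hint.comp_mul_left' hpi
  have h1 := hfi.fourierInv_fourier_eq hFi (v := t) hfc.continuousAt
  rw [Real.fourierInv_eq', hF] at h1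
  have h2 := Measure.integral_comp_mul_left
      (fun y : ℝ => cexp ((Λ + y * I) * t) * lap u (Λ + y * I)) (2 * Real.pi)
  rw [abs_of_pos (by positivity)] at h2
  have h3 : ∫ ξ : ℝ, cexp ((Λ + (2 * Real.pi * ξ : ℝ) * I) * t) *
      lap u (Λ + (2 * Real.pi * ξ : ℝ) * I) = cexp (Λ * t) * f t := by
    rw [← h1, ← integral_const_mul]
    refine integral_congr_ae (.of_forall fun ξ => ?_)
    simp only [smul_eq_mul]
    rw [← mul_assoc, ← Complex.exp_add]
    congr 2
    simp only [RCLike.inner_apply, conj_trivial]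
    push_cast
    ring
  rw [h3] at h2
  have h4 : cexp (Λ * t) * f t = u t := by
    rw [hf, ← mul_assoc, ← Complex.exp_add]
    simp
  rw [h4] at h2
  rw [lineIntegral, h2, real_smul]
  generalize ∫ y : ℝ, cexp ((Λ + y * I) * t) * lap u (Λ + y * I) = J
  push_cast
  field_simp

/-- A chain of `N` agents in coordinates relative to the leader. -/
structure IsChain (a b : ℕ → Fin 3 → ℝ) (v₀ : ℝ) (N : ℕ) (h v : ℕ → ℝ → ℝ) : Prop where
  cont_h : ∀ k, Continuous (h k)
  cont_v : ∀ k, Continuous (v k)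
  zero : ∀ k, k = 0 ∨ N < k → ∀ t, h k t = 0 ∧ v k t = 0
  init : ∀ k, 1 ≤ k → k ≤ N → h k 0 = 0 ∧ v k 0 = -v₀
  deriv_h : ∀ k, ∀ t > 0, HasDerivAt (h k) (v k t) t
  deriv_v : ∀ k, 1 ≤ k → k ≤ N → ∀ t > 0, HasDerivAt (v k)
    (a k 0 * h (k - 1) t + a k 1 * h k t + a k 2 * h (k + 1) t +
      (b k 0 * v (k - 1) t + b k 1 * v k t + b k 2 * v (k + 1) t)) t

section
variable {a b : ℕ → Fin 3 → ℝ} {v₀ : ℝ} {N : ℕ} {h v : ℕ → ℝ → ℝ}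

/-- Grönwall for the vector of all positions and velocities. An acceleration has six terms with
coefficients at most M, so the rate 6M + 1 does not depend on N, and one contour serves all flocks.
-/
theorem IsChain.growth (hc : IsChain a b v₀ N h v) {M : ℝ} (hM : ∀ k i, |a k i| ≤ M ∧ |b k i| ≤ M)
    (k : ℕ) : HasGrowth (h k) (6 * M + 1) ∧ HasGrowth (v k) (6 * M + 1) := by
  have hM0 : 0 ≤ M := (abs_nonneg _).trans (hM 0 0).1
  set K := 6 * M + 1 with hK
  set Y : ℝ → Fin (N + 1) → ℝ × ℝ := fun t i => (h i t, v i t) with hY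
  have hYh : ∀ k t, |h k t| ≤ ‖Y t‖ ∧ |v k t| ≤ ‖Y t‖ := by
    intro k t
    by_cases hk : k ≤ N
    · have h1 := norm_le_pi_norm (Y t) ⟨k, by omega⟩
      exact ⟨(norm_fst_le _).trans h1, (norm_snd_le _).trans h1⟩
    · have := hc.zero k (.inr (by omega)) t
      simp [this]
  set acc : ℕ → ℝ → ℝ := fun k t => if k = 0 then 0 else
    a k 0 * h (k - 1) t + a k 1 * h k t + a k 2 * h (k + 1) t +
      (b k 0 * v (k - 1) t + b k 1 * v k t + b k 2 * v (k + 1) t) with hacc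
  have hYd : ∀ t > 0, HasDerivAt Y (fun i => (v i t, acc i t)) t := by
    intro t ht
    refine hasDerivAt_pi.2 fun i => (hc.deriv_h i t ht).prodMk ?_
    by_cases hi : (i : ℕ) = 0
    · have hv0 : v i = fun _ => 0 := funext fun s => (hc.zero i (.inl hi) s).2
      rw [hv0]
      simpa [hacc, hi] using hasDerivAt_const t (0 : ℝ)
    · have := hc.deriv_v i (by omega) (by omega) t ht
      simpa [hacc, hi] using this
  have hYb : ∀ t, ‖(fun i : Fin (N + 1) => (v i t, acc i t))‖ ≤ K * ‖Y t‖ + 0 := by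
    intro t
    have hY0 := norm_nonneg (Y t)
    rw [add_zero]
    refine (pi_norm_le_iff_of_nonneg (by positivity)).2 fun i => ?_
    refine norm_prod_le_iff.2 ⟨?_, ?_⟩
    · have := (hYh i t).2
      simp only [Real.norm_eq_abs]
      nlinarith [mul_nonneg hM0 hY0]
    · simp only [hacc, Real.norm_eq_abs]
      split_ifs
      · simpa using by positivity
      · have key : ∀ c y : ℝ, |c| ≤ M → |y| ≤ ‖Y t‖ → |c * y| ≤ M * ‖Y t‖ := fun c y h1 h2 => by
          rw [abs_mul]; exact mul_le_mul h1 h2 (abs_nonneg _) hM0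
        have q1 := key _ _ (hM i 0).1 (hYh (i - 1) t).1
        have q2 := key _ _ (hM i 1).1 (hYh i t).1
        have q3 := key _ _ (hM i 2).1 (hYh (i + 1) t).1
        have q4 := key _ _ (hM i 0).2 (hYh (i - 1) t).2
        have q5 := key _ _ (hM i 1).2 (hYh i t).2
        have q6 := key _ _ (hM i 2).2 (hYh (i + 1) t).2
        refine (abs_add_le _ _).trans ?_
        refine (add_le_add ((abs_add_le _ _).trans (add_le_add (abs_add_le _ _) le_rfl))
          ((abs_add_le _ _).trans (add_le_add (abs_add_le _ _) le_rfl))).trans ?_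
        rw [hK]
        linarith
  have hYc : Continuous Y := continuous_pi fun i => (hc.cont_h i).prodMk (hc.cont_v i)
  obtain ⟨B, hB⟩ := (isCompact_Icc (a := (0 : ℝ)) (b := 1)).exists_bound_of_continuousOn
    hYc.continuousOn
  have hB0 : 0 ≤ B := (norm_nonneg _).trans (hB 0 (by simp))
  have hgr : ∀ t ≥ 0, ‖Y t‖ ≤ B * Real.exp (K * t) := by
    intro t ht
    rcases le_total t 1 with h1 | h1
    · have : 1 ≤ Real.exp (K * t) := Real.one_le_exp (by positivity)
      nlinarith [hB t ⟨ht, h1⟩]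
    -- The equations of motion hold only for positive times, so Grönwall starts at time 1;
    -- compactness covers [0, 1].
    · have := norm_le_gronwallBound_of_norm_deriv_right_le (f := Y) (a := 1) (b := t)
        hYc.continuousOn (fun s hs => (hYd s (by linarith [hs.1])).hasDerivWithinAt)
        (hB 1 (by simp)) (fun s _ => hYb s) t ⟨h1, le_rfl⟩
      rw [gronwallBound_ε0] at this
      refine this.trans ?_
      gcongr
      linarith
  exact ⟨⟨hc.cont_h k, B, fun t ht => (hYh k t).1.trans (hgr t ht)⟩,
    ⟨hc.cont_v k, B, fun t ht => (hYh k t).2.trans (hgr t ht)⟩⟩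

theorem IsChain.lap_h (hc : IsChain a b v₀ N h v) {M : ℝ} (hM : ∀ k i, |a k i| ≤ M ∧ |b k i| ≤ M)
    {z : ℂ} (hz : 6 * M + 1 < z.re) (k : ℕ) : lap (v k) z = z * lap (h k) z := by
  have h1 := lap_deriv (hc.growth hM k).1 hz (hc.deriv_h k) ((hc.growth hM k).2.integrableOn hz)
  have h2 : h k 0 = 0 := by
    by_cases hk : k = 0 ∨ N < k
    · exact (hc.zero k hk 0).1
    · exact (hc.init k (by omega) (by omega)).1
  rw [h1, h2]
  simp

theorem IsChain.lap_v (hc : IsChain a b v₀ N h v) {M : ℝ} (hM : ∀ k i, |a k i| ≤ M ∧ |b k i| ≤ M)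
    {z : ℂ} (hz : 6 * M + 1 < z.re) {k : ℕ} (hk : 1 ≤ k) (hkN : k ≤ N) :
    a k 0 * lap (h (k - 1)) z + a k 1 * lap (h k) z + a k 2 * lap (h (k + 1)) z +
      (b k 0 * lap (v (k - 1)) z + b k 1 * lap (v k) z + b k 2 * lap (v (k + 1)) z) =
      z * lap (v k) z + v₀ := by
  have ih := fun k => (hc.growth hM k).1.integrableOn hz
  have iv := fun k => (hc.growth hM k).2.integrableOn hz
  have i1 := ((((ih (k - 1)).const_mul (a k 0 : ℂ)).add ((ih k).const_mul (a k 1 : ℂ))).add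
    ((ih (k + 1)).const_mul (a k 2 : ℂ)))
  have i2 := ((((iv (k - 1)).const_mul (b k 0 : ℂ)).add ((iv k).const_mul (b k 1 : ℂ))).add
    ((iv (k + 1)).const_mul (b k 2 : ℂ)))
  have heq : ∀ t : ℝ, cexp (-z * t) * ((a k 0 * h (k - 1) t + a k 1 * h k t + a k 2 * h (k + 1) t +
      (b k 0 * v (k - 1) t + b k 1 * v k t + b k 2 * v (k + 1) t) : ℝ) : ℂ) =
      (a k 0 * (cexp (-z * t) * h (k - 1) t) + a k 1 * (cexp (-z * t) * h k t) +
        a k 2 * (cexp (-z * t) * h (k + 1) t)) +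
      (b k 0 * (cexp (-z * t) * v (k - 1) t) + b k 1 * (cexp (-z * t) * v k t) +
        b k 2 * (cexp (-z * t) * v (k + 1) t)) := by
    intro t
    push_cast
    ring
  have h1 := lap_deriv (hc.growth hM k).2 hz (hc.deriv_v k hk hkN)
    ((i1.add i2).congr (.of_forall fun t => (heq t).symm))
  rw [(hc.init k hk hkN).2] at h1
  push_cast at h1
  rw [sub_neg_eq_add] at h1
  rw [← h1]
  refine Eq.symm ((integral_congr_ae (.of_forall heq)).trans ((integral_add i1 i2).trans ?_))
  have j1 := ((ih (k - 1)).const_mul (a k 0 : ℂ))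
  have j2 := ((ih k).const_mul (a k 1 : ℂ))
  have j3 := ((ih (k + 1)).const_mul (a k 2 : ℂ))
  have j4 := ((iv (k - 1)).const_mul (b k 0 : ℂ))
  have j5 := ((iv k).const_mul (b k 1 : ℂ))
  have j6 := ((iv (k + 1)).const_mul (b k 2 : ℂ))
  have j12 := j1.add j2
  have j45 := j4.add j5
  refine (congrArg₂ (· + ·) ((integral_add j12 j3).trans (congrArg (· + _) (integral_add j1 j2)))
    ((integral_add j45 j6).trans (congrArg (· + _) (integral_add j4 j5)))).trans ?_
  simp only [integral_const_mul, lap]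

end

end Flock

/-! ### From orbits to the transform of the last agent -/

namespace Flock

open Complex MeasureTheory

/-- Coefficients of the positions in the equation of motion of agent `k`. -/
noncomputable def coefX (P : Params) (bc : Boundary) (N k : ℕ) : Fin 3 → ℝ :=
  if k < N then ![P.gx * P.ρx (-1), P.gx * P.ρx 0, P.gx * P.ρx 1]
  else ![-(P.gx * bc.βx P), P.gx * bc.βx P, 0]

/-- Coefficients of the velocities in the equation of motion of agent `k`. -/
noncomputable def coefV (P : Params) (bc : Boundary) (N k : ℕ) : Fin 3 → ℝ :=
  if k < N then ![P.gv * P.ρv (-1), P.gv * P.ρv 0, P.gv * P.ρv 1]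
  else ![-(P.gv * bc.βv P), P.gv * bc.βv P, 0]

theorem exists_coef_le (P : Params) (bc : Boundary) :
    ∃ M : ℝ, 0 ≤ M ∧ ∀ N k i, |coefX P bc N k i| ≤ M ∧ |coefV P bc N k i| ≤ M := by
  refine ⟨|P.gx * P.ρx (-1)| + |P.gx * P.ρx 0| + |P.gx * P.ρx 1| + |P.gx * bc.βx P| +
    (|P.gv * P.ρv (-1)| + |P.gv * P.ρv 0| + |P.gv * P.ρv 1| + |P.gv * bc.βv P|), by positivity,
    fun N k i => ?_⟩
  have h1 := abs_nonneg (P.gx * P.ρx (-1))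
  have h2 := abs_nonneg (P.gx * P.ρx 0)
  have h3 := abs_nonneg (P.gx * P.ρx 1)
  have h4 := abs_nonneg (P.gx * bc.βx P)
  have h5 := abs_nonneg (P.gv * P.ρv (-1))
  have h6 := abs_nonneg (P.gv * P.ρv 0)
  have h7 := abs_nonneg (P.gv * P.ρv 1)
  have h8 := abs_nonneg (P.gv * bc.βv P)
  unfold coefX coefV
  split_ifs <;> fin_cases i <;> constructor <;>
    simp only [Matrix.cons_val, Fin.zero_eta, Fin.mk_one, Fin.reduceFinMk, abs_neg, abs_zero] <;>
    linarith

variable {P : Params} {bc : Boundary} {v₀ : ℝ} {N : ℕ} {z : ℕ → ℝ → ℝ}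

open Classical in
/-- Position of agent `k` relative to the leader, continued by `0`. -/
noncomputable def relPos (v₀ : ℝ) (N : ℕ) (z : ℕ → ℝ → ℝ) (k : ℕ) (t : ℝ) : ℝ :=
  if 1 ≤ k ∧ k ≤ N then z k t - v₀ * t else 0

open Classical in
/-- Velocity of agent `k` relative to the leader, continued by `0`. -/
noncomputable def relVel (v₀ : ℝ) (N : ℕ) (z : ℕ → ℝ → ℝ) (k : ℕ) (t : ℝ) : ℝ :=
  if 1 ≤ k ∧ k ≤ N then deriv (z k) t - v₀ else 0

theorem IsOrbit.eq_relPos (ho : IsOrbit P bc v₀ N z) {k : ℕ} (hk : k ≤ N) {t : ℝ} (ht : 0 < t) :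
    z k t = relPos v₀ N z k t + v₀ * t ∧ deriv (z k) t = relVel v₀ N z k t + v₀ := by
  rcases Nat.eq_zero_or_pos k with rfl | h
  · have h0 : z 0 =ᶠ[𝓝 t] fun t => v₀ * t := by
      filter_upwards [lt_mem_nhds ht] with s hs
      rw [ho.leader, if_neg (not_lt.2 (le_of_lt hs))]
    refine ⟨by simpa [relPos] using h0.eq_of_nhds, ?_⟩
    rw [h0.deriv_eq]
    simp [relVel]
  · have : 1 ≤ k ∧ k ≤ N := ⟨h, hk⟩
    simp [relPos, relVel, this]

theorem Params.Normalized.coefX_sum (hP : P.Normalized) (N k : ℕ) :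
    coefX P bc N k 0 + coefX P bc N k 1 + coefX P bc N k 2 = 0 := by
  unfold coefX
  split_ifs <;> (simp [hP.ρx_zero, hP.ρx_neg_one, hP.ρx_one]; try ring)

theorem Params.Normalized.coefV_sum (hP : P.Normalized) (N k : ℕ) :
    coefV P bc N k 0 + coefV P bc N k 1 + coefV P bc N k 2 = 0 := by
  unfold coefV
  split_ifs
  · simp only [Matrix.cons_val]
    linear_combination P.gv * hP.ρv_sum
  · simp

/-- At t = 0 the value follows from continuity of the velocity and the limit from the left. It gives
the initial relative velocity -v₀ and the vanishing that `lap_inversion` needs. -/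
theorem IsOrbit.deriv_zero (ho : IsOrbit P bc v₀ N z) {k : ℕ} (hk1 : 1 ≤ k) (hk : k ≤ N) {t : ℝ}
    (ht : t ≤ 0) : deriv (z k) t = 0 := by
  have hlt : ∀ s < 0, deriv (z k) s = 0 := fun s hs => by
    have : z k =ᶠ[𝓝 s] fun _ => 0 := by
      filter_upwards [gt_mem_nhds hs] with r hr using ho.rest k hk1 hk r (le_of_lt hr)
    rw [this.deriv_eq]
    simp
  have hc : Continuous (deriv (z k)) := (ho.smooth k hk1 hk).continuous_deriv le_rfl
  rcases ht.lt_or_eq with h | rfl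
  · exact hlt t h
  · have h1 : Tendsto (deriv (z k)) (𝓝[<] 0) (𝓝 (deriv (z k) 0)) :=
      hc.continuousAt.tendsto.mono_left nhdsWithin_le_nhds
    refine tendsto_nhds_unique h1 (tendsto_const_nhds.congr' ?_)
    filter_upwards [self_mem_nhdsWithin] with s hs using (hlt s hs).symm

/-- The weights in each equation sum to zero, so subtracting the uniform motion of the leader
changes nothing, and the jump of the leader's velocity disappears from the system. -/
theorem IsOrbit.isChain (hP : P.Normalized) (ho : IsOrbit P bc v₀ N z) :
    IsChain (coefX P bc N) (coefV P bc N) v₀ N (relPos v₀ N z) (relVel v₀ N z) := by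
  have hcz : ∀ k, 1 ≤ k ∧ k ≤ N → Continuous (z k) ∧ Continuous (deriv (z k)) := fun k hk =>
    ⟨(ho.smooth k hk.1 hk.2).continuous, (ho.smooth k hk.1 hk.2).continuous_deriv le_rfl⟩
  refine ⟨fun k => ?_, fun k => ?_, fun k hk t => ?_, fun k h1 h2 => ?_, fun k t ht => ?_,
    fun k h1 h2 t ht => ?_⟩
  · by_cases h : 1 ≤ k ∧ k ≤ N
    · have := (hcz k h).1
      unfold relPos
      simp only [h, and_self, if_true]
      fun_prop
    · unfold relPos
      simp only [h, if_false]
      fun_prop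
  · by_cases h : 1 ≤ k ∧ k ≤ N
    · have := (hcz k h).2
      unfold relVel
      simp only [h, and_self, if_true]
      fun_prop
    · unfold relVel
      simp only [h, if_false]
      fun_prop
  · have : ¬ (1 ≤ k ∧ k ≤ N) := by omega
    simp [relPos, relVel, this]
  · simp [relPos, relVel, h1, h2, ho.rest k h1 h2 0 le_rfl, ho.deriv_zero h1 h2 le_rfl]
  · by_cases h : 1 ≤ k ∧ k ≤ N
    · have hd : DifferentiableAt ℝ (z k) t :=
        ((ho.smooth k h.1 h.2).differentiable one_ne_zero).differentiableAt
      unfold relPos relVel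
      simp only [h, and_self, if_true]
      exact hd.hasDerivAt.sub (by simpa using (hasDerivAt_id t).const_mul v₀)
    · unfold relPos relVel
      simp only [h, if_false]
      exact hasDerivAt_const _ _
  · have hd : HasDerivAt (deriv (z k)) (coefX P bc N k 0 * z (k - 1) t + coefX P bc N k 1 * z k t +
        coefX P bc N k 2 * z (k + 1) t + (coefV P bc N k 0 * deriv (z (k - 1)) t +
        coefV P bc N k 1 * deriv (z k) t + coefV P bc N k 2 * deriv (z (k + 1)) t)) t := by
      rcases h2.lt_or_eq with h | rfl
      · refine (ho.interior k h1 h t ht).congr_deriv ?_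
        simp only [coefX, coefV, h, if_true, Matrix.cons_val]
        ring
      · refine (ho.last h1 t ht).congr_deriv ?_
        simp only [coefX, coefV, lt_irrefl, if_false, Matrix.cons_val]
        ring
    have hv : relVel v₀ N z k = fun s => deriv (z k) s - v₀ := by
      ext s
      simp [relVel, h1, h2]
    rw [hv]
    refine (hd.sub_const v₀).congr_deriv ?_
    rw [← hv]
    have hsX := hP.coefX_sum (bc := bc) N k
    have hsV := hP.coefV_sum (bc := bc) N k
    obtain ⟨p1, q1⟩ := ho.eq_relPos (show k - 1 ≤ N by omega) ht
    obtain ⟨p2, q2⟩ := ho.eq_relPos h2 ht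
    rcases h2.lt_or_eq with h | rfl
    · obtain ⟨p3, q3⟩ := ho.eq_relPos (show k + 1 ≤ N by omega) ht
      rw [p1, p2, p3, q1, q2, q3]
      linear_combination (v₀ * t) * hsX + v₀ * hsV
    · have e1 : coefX P bc k k 2 = 0 := by simp [coefX]
      have e2 : coefV P bc k k 2 = 0 := by simp [coefV]
      rw [p1, p2, q1, q2, e1, e2]
      rw [e1] at hsX
      rw [e2] at hsV
      linear_combination (v₀ * t) * hsX + v₀ * hsV

/-- The transform of the velocity of the last agent. -/
theorem IsOrbit.lap_eq {n : ℕ} (hP : P.Normalized) (hv₀ : v₀ ≠ 0)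
    (ho : IsOrbit P bc v₀ (n + 1) z) {M : ℝ} (hM0 : 0 ≤ M)
    (hM : ∀ N k i, |coefX P bc N k i| ≤ M ∧ |coefV P bc N k i| ≤ M) :
    HasGrowth (deriv (z (n + 1))) (6 * M + 1) ∧ ∀ w : ℂ, 6 * M + 1 < w.re →
      ∃ X : ℂ, lap (deriv (z (n + 1))) w = v₀ * X / w ∧
        X * (1 - ampF (-P.gx) (-P.gv) (1 + 2 * P.ρv 1) bc w *
          (wave (-P.gx) (-P.gv) (1 + 2 * P.ρv 1) w ^ n *
            wave (-P.gx) (-P.gv) (-(1 + 2 * P.ρv 1)) w ^ n)) =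
        ampE (-P.gx) (-P.gv) (1 + 2 * P.ρv 1) bc w *
          wave (-P.gx) (-P.gv) (1 + 2 * P.ρv 1) w ^ n := by
  have hc := ho.isChain hP
  have hv : deriv (z (n + 1)) = fun t => relVel v₀ (n + 1) z (n + 1) t + v₀ := by
    ext t
    simp [relVel]
  have hgv := (hc.growth (hM (n + 1)) (n + 1)).2
  have hg0 : HasGrowth (fun _ => v₀) 0 := ⟨continuous_const, |v₀|, by simp⟩
  refine ⟨?_, fun w hw => ?_⟩
  · refine ⟨(ho.smooth (n + 1) (by omega) le_rfl).continuous_deriv le_rfl, ?_⟩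
    obtain ⟨C, hC⟩ := hgv.bound
    refine ⟨C + |v₀|, fun t ht => ?_⟩
    have h1 : 1 ≤ Real.exp ((6 * M + 1) * t) := Real.one_le_exp (by positivity)
    rw [hv]
    refine (abs_add_le _ _).trans ?_
    nlinarith [hC t ht, abs_nonneg v₀]
  have hw0 : 0 < w.re := by linarith
  have hwne : w ≠ 0 := fun h => by rw [h, zero_re] at hw0; exact lt_irrefl _ hw0
  have hv₀' : (v₀ : ℂ) ≠ 0 := ofReal_ne_zero.2 hv₀
  set l : ℕ → ℂ := fun k => lap (relPos v₀ (n + 1) z k) w with hl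
  -- The transform of the absolute position divided by v₀/w², that of the leader; hence X 0 = 1.
  set X : ℕ → ℂ := fun k => w ^ 2 * l k / v₀ + 1 with hX
  have hlh : ∀ k, lap (relVel v₀ (n + 1) z k) w = w * l k :=
    fun k => hc.lap_h (hM (n + 1)) hw k
  have hlv : ∀ k, 1 ≤ k → k ≤ n + 1 → _ := fun k h1 h2 => hc.lap_v (hM (n + 1)) hw h1 h2
  have hll : ∀ k, lap (relPos v₀ (n + 1) z k) w = l k := fun k => rfl
  simp only [hlh, hll] at hlv
  have hρ : (P.ρv (-1) : ℂ) = -1 - P.ρv 1 := by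
    have := hP.ρv_sum
    rw [hP.ρv_zero] at this
    have h2 : P.ρv (-1) = -1 - P.ρv 1 := by linarith
    rw [h2]
    push_cast
    ring
  have hs : -strip (-P.gx) (-P.gv) (1 + 2 * P.ρv 1) ≤ w.re := by
    have := strip_pos (neg_pos.2 hP.gx_neg) (neg_pos.2 hP.gv_neg) (1 + 2 * P.ρv 1)
    linarith
  refine ⟨X (n + 1), ?_, last_eq (X := X) (neg_pos.2 hP.gx_neg) (neg_pos.2 hP.gv_neg) hs hwne bc
    ?_ (fun k h1 h2 => ?_) ?_⟩
  · have : lap (deriv (z (n + 1))) w = lap (relVel v₀ (n + 1) z (n + 1)) w + lap (fun _ => v₀) w := by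
      have h1 := hgv.integrableOn hw
      have h2 := hg0.integrableOn hw0
      rw [lap, lap, lap, ← integral_add h1 h2, hv]
      refine integral_congr_ae (.of_forall fun t => ?_)
      push_cast
      ring
    rw [this, hlh, lap_const hw0, hX]
    field_simp
  · have : relPos v₀ (n + 1) z 0 = fun _ => 0 := by
      ext t
      simp [relPos]
    simp [hX, hl, this, lap]
  · have h := hlv k h1 (by omega)
    simp only [coefX, coefV, show k < n + 1 by omega, if_true, Matrix.cons_val, hP.ρx_neg_one,
      hP.ρx_zero, hP.ρx_one, hP.ρv_zero] at h
    push_cast at h ⊢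
    rw [hρ] at h
    simp only [hX]
    field_simp
    linear_combination (-2 * w ^ 2) * h
  · have h := hlv (n + 1) (by omega) le_rfl
    simp only [coefX, coefV, lt_irrefl, if_false, Matrix.cons_val, Nat.add_sub_cancel] at h
    cases bc with
    | variableMass =>
      simp only [Boundary.βx, Boundary.βv, hP.ρx_neg_one] at h
      push_cast at h ⊢
      rw [hρ] at h
      simp only [hX]
      field_simp
      linear_combination (-2 * w ^ 2) * h
    | regular =>
      simp only [Boundary.βx, Boundary.βv] at h
      push_cast at h ⊢
      simp only [hX]
      field_simp
      linear_combination (-w ^ 2) * h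

end Flock

/-! ### Expansion of the velocity in round trips -/

namespace Flock

open Complex MeasureTheory

section
variable {A S : ℂ → ℂ} {ε₀ τ : ℝ}

theorem IsFront.exists_bound (hS : IsFront S ε₀ τ) (hA : IsAmplitude A ε₀)
    (hε₀ : 0 < ε₀) {Λ : ℝ} (hΛ : 0 < Λ) :
    ∃ C, ∀ᶠ n : ℕ in atTop, ∀ t : ℝ, ‖lineIntegral (fun z => A z * S z ^ n / z) Λ t‖ ≤ C := by
  obtain ⟨C, hC, hev⟩ := hS.front hA hε₀ hΛ
  refine ⟨C + ‖2 * Real.pi * A 0‖, ?_⟩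
  filter_upwards [hev] with n hn t
  have key : ∀ y : ℝ, 0 ≤ y → C * Real.exp (-y * (√n)⁻¹) ≤ C := fun y hy => by
    have : Real.exp (-y * (√n)⁻¹) ≤ 1 := by
      rw [Real.exp_le_one_iff, neg_mul, neg_nonpos]
      positivity
    nlinarith
  rcases le_total t (n * τ) with h | h
  · have := ((hn t).1 h).trans (key _ (by linarith))
    linarith [norm_nonneg (2 * Real.pi * A 0)]
  · have := ((hn t).2 h).trans (key _ (by linarith))
    have h2 := norm_add_le (lineIntegral (fun z => A z * S z ^ n / z) Λ t - 2 * Real.pi * A 0)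
      (2 * Real.pi * A 0)
    rw [sub_add_cancel] at h2
    linarith

/-- A margin δN exceeds the width √n of the front by far. The power is n whereas N = n + 1; the
discrepancy τ is absorbed by half of the margin. -/
theorem IsFront.front_limit (hS : IsFront S ε₀ τ) (hA : IsAmplitude A ε₀)
    (hε₀ : 0 < ε₀) {Λ : ℝ} (hΛ : 0 < Λ) {δ ε : ℝ} (hδ : 0 < δ) (hε : 0 < ε) :
    ∀ᶠ n : ℕ in atTop, ∀ t : ℝ,
      (t ≤ (n + 1) * τ - δ * (n + 1) →
        ‖lineIntegral (fun z => A z * S z ^ n / z) Λ t‖ ≤ ε) ∧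
      ((n + 1) * τ + δ * (n + 1) ≤ t →
        ‖lineIntegral (fun z => A z * S z ^ n / z) Λ t - 2 * Real.pi * A 0‖ ≤ ε) := by
  obtain ⟨C, hC, hev⟩ := hS.front hA hε₀ hΛ
  have hsq : Tendsto (fun n : ℕ => √(n : ℝ)) atTop atTop :=
    Real.tendsto_sqrt_atTop.comp tendsto_natCast_atTop_atTop
  have hlim : Tendsto (fun n : ℕ => C * Real.exp (-(δ / 2) * √n)) atTop (𝓝 0) := by
    have : Tendsto (fun n : ℕ => -(δ / 2) * √n) atTop atBot :=
      hsq.const_mul_atTop_of_neg (by linarith)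
    simpa using (Real.tendsto_exp_atBot.comp this).const_mul C
  filter_upwards [hev, hlim.eventually_le_const hε, eventually_ge_atTop 1,
    tendsto_natCast_atTop_atTop.eventually_ge_atTop (|τ| / (δ / 2))] with n hn h1 h2 h3 t
  have hn0 : (0 : ℝ) < n := by positivity
  have hsn : 0 < √(n : ℝ) := Real.sqrt_pos.2 hn0
  rw [div_le_iff₀ (by positivity)] at h3
  have hτ := abs_le.1 (le_refl |τ|)
  have key : ∀ y : ℝ, δ / 2 * n ≤ y → C * Real.exp (-y * (√n)⁻¹) ≤ ε := fun y hy => by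
    refine le_trans ?_ h1
    have h4 : δ / 2 * √n ≤ y * (√n)⁻¹ := by
      rwa [← div_eq_mul_inv, le_div_iff₀ hsn, mul_assoc, Real.mul_self_sqrt hn0.le]
    exact mul_le_mul_of_nonneg_left (Real.exp_le_exp.2 (by linarith)) hC.le
  refine ⟨fun h => ((hn t).1 (by nlinarith)).trans (key _ (by nlinarith)),
    fun h => ((hn t).2 (by nlinarith)).trans (key _ (by nlinarith))⟩

end

section
variable {x g : ℝ}

theorem pulse_pow (x g b : ℝ) (j n : ℕ) (w : ℂ) :
    pulse x g b j w ^ n = wave x g b w ^ n * (wave x g b w ^ n * wave x g (-b) w ^ n) ^ j := by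
  rw [pulse]
  ring

/-- Transform of the velocity of the last agent of `n + 1` agents, up to the factor `v₀ / w`. -/
noncomputable def lastTransform (x g b : ℝ) (bc : Boundary) (n : ℕ) (w : ℂ) : ℂ :=
  ampE x g b bc w * wave x g b w ^ n /
    (1 - ampF x g b bc w * (wave x g b w ^ n * wave x g (-b) w ^ n))

theorem lastTransform_expand (b : ℝ) (bc : Boundary) {n : ℕ} (J : ℕ) {w : ℂ}
    (hne : 1 - ampF x g b bc w * (wave x g b w ^ n * wave x g (-b) w ^ n) ≠ 0) :
    lastTransform x g b bc n w =
      (∑ j ∈ Finset.range J, ampE x g b bc w * ampF x g b bc w ^ j * pulse x g b j w ^ n) +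
      (ampF x g b bc w * (wave x g b w ^ n * wave x g (-b) w ^ n)) ^ J *
        lastTransform x g b bc n w := by
  set y := ampF x g b bc w * (wave x g b w ^ n * wave x g (-b) w ^ n) with hy
  have h1 : ∑ j ∈ Finset.range J, ampE x g b bc w * ampF x g b bc w ^ j * pulse x g b j w ^ n =
      ampE x g b bc w * wave x g b w ^ n * ∑ j ∈ Finset.range J, y ^ j := by
    rw [Finset.mul_sum]
    refine Finset.sum_congr rfl fun j _ => ?_
    rw [pulse_pow, hy, mul_pow]
    ring
  have h2 := geom_sum_mul_neg y J
  rw [h1, lastTransform, ← hy]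
  field_simp
  linear_combination -(ampE x g b bc w * wave x g b w ^ n) * h2

/-- Bounds on a vertical line in the right half-plane, uniform in the number of agents. -/
theorem exists_line_bounds (hx : 0 < x) (hg : 0 < g) (b : ℝ) (bc : Boundary) {Λ : ℝ} (hΛ : 0 < Λ) :
    ∃ q : ℝ, 0 < q ∧ q < 1 ∧ ∃ CF > 0, ∃ CE > 0, ∀ w : ℂ, w.re = Λ → ∀ n : ℕ, 2 ≤ n →
      ‖ampF x g b bc w * (wave x g b w ^ n * wave x g (-b) w ^ n)‖ ≤ CF * q ^ n ∧
      ‖ampE x g b bc w * wave x g b w ^ n‖ ≤ CE * (1 + w.im ^ 2)⁻¹ := by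
  obtain ⟨q, hq1, hq⟩ := wave_line hx hg b hΛ
  obtain ⟨CF, hCF⟩ := (isAmplitude_ampF hx hg b bc).bdd Λ
  -- The exponent 2 suffices for all n ≥ 2, because |r| < 1 on the line; this makes the constant
  -- independent of n.
  obtain ⟨CE, hCE⟩ := (isFront_pulse hx hg b 0).pow_decay (isAmplitude_ampE hx hg b bc) Λ 2 le_rfl
  have hs := strip_pos hx hg b
  refine ⟨max q (1 / 2), by positivity, max_lt hq1 (by norm_num), |CF| + 1, by positivity,
    |CE| + 1, by positivity, fun w hw n hn => ?_⟩
  have hw0 : w ≠ 0 := fun h => by rw [h, zero_re] at hw; linarith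
  have hr := norm_wave_lt_one hx hg b (by linarith : 0 ≤ w.re) hw0
  have hs1 := norm_wave_lt_one hx hg (-b) (by linarith : 0 ≤ w.re) hw0
  constructor
  · rw [norm_mul, norm_mul, norm_pow, norm_pow]
    have h1 : ‖ampF x g b bc w‖ ≤ |CF| + 1 :=
      (hCF w (by linarith) hw.le).trans ((le_abs_self _).trans (by linarith))
    have h2 : ‖wave x g b w‖ ^ n ≤ max q (1 / 2) ^ n :=
      pow_le_pow_left₀ (norm_nonneg _) ((hq w hw).trans (le_max_left _ _)) n
    have h3 : ‖wave x g (-b) w‖ ^ n ≤ 1 := pow_le_one₀ (norm_nonneg _) hs1.le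
    calc _ ≤ (|CF| + 1) * (max q (1 / 2) ^ n * 1) := by gcongr
      _ = _ := by ring
  · have h1 := hCE w (by linarith) hw.le
    simp only [pulse, zero_add, pow_one, pow_zero, mul_one] at h1
    rw [norm_mul, norm_pow] at h1 ⊢
    have h2 : ‖wave x g b w‖ ^ n ≤ ‖wave x g b w‖ ^ 2 :=
      pow_le_pow_of_le_one (norm_nonneg _) hr.le hn
    have h3 : (0 : ℝ) < (1 + w.im ^ 2)⁻¹ := by positivity
    calc _ ≤ ‖ampE x g b bc w‖ * ‖wave x g b w‖ ^ 2 := by gcongr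
      _ ≤ CE * (1 + w.im ^ 2)⁻¹ := h1
      _ ≤ _ := by
        gcongr
        linarith [le_abs_self CE]

theorem continuous_line {f : ℂ → ℂ} {c : ℝ} (h : ∀ w : ℂ, w.re = c → ContinuousAt f w) :
    Continuous fun y : ℝ => f (c + y * I) :=
  continuous_iff_continuousAt.2 fun y =>
    ContinuousAt.comp (f := fun y : ℝ => (c : ℂ) + y * I) (h _ (re_add_mul_I _ _)) (by fun_prop)

theorem lineIntegral_add {f₁ f₂ : ℂ → ℂ} {c : ℝ} (h₁ : Integrable fun y : ℝ => f₁ (c + y * I))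
    (h₂ : Integrable fun y : ℝ => f₂ (c + y * I)) (t : ℝ) :
    lineIntegral (fun w => f₁ w + f₂ w) c t = lineIntegral f₁ c t + lineIntegral f₂ c t := by
  have key : ∀ f : ℂ → ℂ, Integrable (fun y : ℝ => f (c + y * I)) →
      Integrable fun y : ℝ => cexp ((c + y * I) * t) * f (c + y * I) := fun f hf => by
    refine hf.bdd_mul (c := Real.exp (c * t)) (Continuous.aestronglyMeasurable (by fun_prop))
      (.of_forall fun y => ?_)
    rw [norm_exp_line]
  rw [lineIntegral, lineIntegral, lineIntegral, ← integral_add (key _ h₁) (key _ h₂)]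
  simp only [mul_add]

theorem lineIntegral_sum {f : ℕ → ℂ → ℂ} {c : ℝ}
    (h : ∀ j, Integrable fun y : ℝ => f j (c + y * I)) (J : ℕ) (t : ℝ) :
    lineIntegral (fun w => ∑ j ∈ Finset.range J, f j w) c t =
      ∑ j ∈ Finset.range J, lineIntegral (f j) c t := by
  induction J with
  | zero => simp [lineIntegral]
  | succ J ih =>
    simp only [Finset.sum_range_succ]
    rw [lineIntegral_add (integrable_finsetSum _ fun j _ => h j) (h J), ih]

theorem norm_lineIntegral_le {f : ℂ → ℂ} {c C : ℝ} (h : ∀ w : ℂ, w.re = c →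
    ‖f w‖ ≤ C * (1 + w.im ^ 2)⁻¹) (t : ℝ) :
    ‖lineIntegral f c t‖ ≤ Real.exp (c * t) * (C * Real.pi) := by
  refine (norm_integral_le_of_norm_le
    ((integrable_inv_one_add_sq.const_mul C).const_mul (Real.exp (c * t)))
    (.of_forall fun y => ?_)).trans_eq ?_
  · rw [norm_mul, norm_exp_line]
    gcongr
    simpa using h (c + y * I) (re_add_mul_I _ _)
  · rw [integral_const_mul, integral_const_mul, integral_univ_inv_one_add_sq]

end

end Flock

namespace Flock

open Complex MeasureTheory

theorem lineIntegral_congr {f₁ f₂ : ℂ → ℂ} {c : ℝ} (h : ∀ w : ℂ, w.re = c → f₁ w = f₂ w) (t : ℝ) :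
    lineIntegral f₁ c t = lineIntegral f₂ c t := by
  refine integral_congr_ae (.of_forall fun y => ?_)
  simp only [h _ (re_add_mul_I c y)]

theorem lineIntegral_const_mul (a : ℂ) (f : ℂ → ℂ) (c t : ℝ) :
    lineIntegral (fun w => a * f w) c t = a * lineIntegral f c t := by
  rw [lineIntegral, lineIntegral, ← integral_const_mul]
  congr 1
  ext y
  ring

theorem integrable_line_of_le {f : ℂ → ℂ} {c C : ℝ} (hf : ∀ w : ℂ, w.re = c → ContinuousAt f w)
    (h : ∀ w : ℂ, w.re = c → ‖f w‖ ≤ C * (1 + w.im ^ 2)⁻¹) :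
    Integrable fun y : ℝ => f (c + y * I) := by
  refine (integrable_inv_one_add_sq.const_mul C).mono'
    (continuous_line hf).aestronglyMeasurable (.of_forall fun y => ?_)
  simpa using h (c + y * I) (re_add_mul_I _ _)

section
variable {x g : ℝ}

theorem norm_div_le_div {w a : ℂ} {B Λ : ℝ} (hΛ : 0 < Λ) (hw : w.re = Λ) (ha : ‖a‖ ≤ B) :
    ‖a / w‖ ≤ B / Λ := by
  have h1 : Λ ≤ ‖w‖ := hw ▸ re_le_norm w
  have hB : 0 ≤ B := (norm_nonneg _).trans ha
  rw [norm_div]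
  gcongr

/-- Once C q^n ≤ 1/2 the denominator is at least 1/2 in modulus on the line. The remainder of the
finite geometric series is the J-th power of the round-trip factor times the transform itself. -/
theorem lineIntegral_lastTransform (hx : 0 < x) (hg : 0 < g) (b : ℝ) (bc : Boundary) {Λ : ℝ}
    (hΛ : 0 < Λ) : ∃ q : ℝ, 0 < q ∧ q < 1 ∧ ∃ C > 0, ∃ CF > 0, ∀ᶠ n : ℕ in atTop,
      (∀ w : ℂ, w.re = Λ →
        1 - ampF x g b bc w * (wave x g b w ^ n * wave x g (-b) w ^ n) ≠ 0) ∧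
      (Integrable fun y : ℝ => lastTransform x g b bc n (Λ + y * I) / (Λ + y * I)) ∧
      ∀ J : ℕ, ∀ t : ℝ, ‖lineIntegral (fun w => lastTransform x g b bc n w / w) Λ t -
        ∑ j ∈ Finset.range J, lineIntegral (fun w => ampE x g b bc w * ampF x g b bc w ^ j *
          pulse x g b j w ^ n / w) Λ t‖ ≤ Real.exp (Λ * t) * ((CF * q ^ n) ^ J * C) := by
  obtain ⟨q, hq0, hq1, CF, hCF, CE, hCE, hb⟩ := exists_line_bounds hx hg b bc hΛ
  have hs := strip_pos hx hg b
  refine ⟨q, hq0, hq1, 2 * CE / Λ * Real.pi, by positivity, CF, hCF, ?_⟩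
  have hq := ((tendsto_pow_atTop_nhds_zero_of_lt_one hq0.le hq1).const_mul CF)
  rw [mul_zero] at hq
  filter_upwards [hq.eventually_le_const (show (0 : ℝ) < 1 / 2 by norm_num),
    eventually_ge_atTop 2] with n hn h2
  have hstrip : ∀ w : ℂ, w.re = Λ → -strip x g b ≤ w.re := fun w hw => by linarith
  have hwne : ∀ w : ℂ, w.re = Λ → w ≠ 0 := fun w hw h => by rw [h, zero_re] at hw; linarith
  set y : ℂ → ℂ := fun w => ampF x g b bc w * (wave x g b w ^ n * wave x g (-b) w ^ n) with hy
  have hy1 : ∀ w : ℂ, w.re = Λ → ‖y w‖ ≤ CF * q ^ n := fun w hw => (hb w hw n h2).1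
  have hlow : ∀ w : ℂ, w.re = Λ → 1 / 2 ≤ ‖1 - y w‖ := fun w hw => by
    have := norm_sub_norm_le (1 : ℂ) (y w)
    rw [norm_one] at this
    linarith [hy1 w hw]
  have hne : ∀ w : ℂ, w.re = Λ → 1 - y w ≠ 0 := fun w hw h => by
    have := hlow w hw
    rw [h, norm_zero] at this
    norm_num at this
  have hGb : ∀ w : ℂ, w.re = Λ →
      ‖lastTransform x g b bc n w‖ ≤ 2 * CE * (1 + w.im ^ 2)⁻¹ := fun w hw => by
    rw [lastTransform, norm_div, div_le_iff₀ (by linarith [hlow w hw])]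
    have h3 := (hb w hw n h2).2
    have h4 : (0 : ℝ) < CE * (1 + w.im ^ 2)⁻¹ := by positivity
    nlinarith [hlow w hw]
  have hGw : ∀ w : ℂ, w.re = Λ →
      ‖lastTransform x g b bc n w / w‖ ≤ 2 * CE / Λ * (1 + w.im ^ 2)⁻¹ := fun w hw =>
    (norm_div_le_div hΛ hw (hGb w hw)).trans_eq (by ring)
  have hFc : ∀ w : ℂ, w.re = Λ → ContinuousAt (ampF x g b bc) w := fun w hw =>
    ((isAmplitude_ampF hx hg b bc).diff w (hstrip w hw)).continuousAt
  have hEc : ∀ w : ℂ, w.re = Λ → ContinuousAt (ampE x g b bc) w := fun w hw =>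
    ((isAmplitude_ampE hx hg b bc).diff w (hstrip w hw)).continuousAt
  have hrc : ∀ w : ℂ, w.re = Λ → ContinuousAt (wave x g b) w := fun w hw =>
    (differentiableAt_wave hx hg (hstrip w hw)).continuousAt
  have hsc : ∀ w : ℂ, w.re = Λ → ContinuousAt (wave x g (-b)) w := fun w hw =>
    (differentiableAt_wave_neg hx hg (hstrip w hw)).continuousAt
  have hyc : ∀ w : ℂ, w.re = Λ → ContinuousAt y w := fun w hw =>
    (hFc w hw).mul (((hrc w hw).pow n).mul ((hsc w hw).pow n))
  have hGc : ∀ w : ℂ, w.re = Λ → ContinuousAt (lastTransform x g b bc n) w := fun w hw =>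
    ((hEc w hw).mul ((hrc w hw).pow n)).div (continuousAt_const.sub (hyc w hw)) (hne w hw)
  refine ⟨hne, integrable_line_of_le (f := fun w => lastTransform x g b bc n w / w)
    (fun w hw => (hGc w hw).div continuousAt_id (hwne w hw)) hGw, fun J t => ?_⟩
  set f : ℕ → ℂ → ℂ := fun j w => ampE x g b bc w * ampF x g b bc w ^ j *
    pulse x g b j w ^ n / w with hf
  have hfi : ∀ j, Integrable fun y : ℝ => f j (Λ + y * I) := fun j => by
    have hA := (isAmplitude_ampE hx hg b bc).mul ((isAmplitude_ampF hx hg b bc).pow j)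
    obtain ⟨C, hC⟩ := (isFront_pulse hx hg b j).pow_decay hA Λ n h2
    refine integrable_line_of_le (C := C / Λ) (fun w hw => ?_) (fun w hw => ?_)
    · exact (((hA.diff w (hstrip w hw)).continuousAt).mul
        (((isFront_pulse hx hg b j).diff w (hstrip w hw)).continuousAt.pow n)).div
        continuousAt_id (hwne w hw)
    · exact (norm_div_le_div hΛ hw (hC w (hstrip w hw) hw.le)).trans_eq (by ring)
  have hrb : ∀ w : ℂ, w.re = Λ → ‖y w ^ J * (lastTransform x g b bc n w / w)‖ ≤
      (CF * q ^ n) ^ J * (2 * CE / Λ) * (1 + w.im ^ 2)⁻¹ := fun w hw => by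
    rw [norm_mul, norm_pow, mul_assoc]
    exact mul_le_mul (pow_le_pow_left₀ (norm_nonneg _) (hy1 w hw) J) (hGw w hw)
      (norm_nonneg _) (by positivity)
  have hri : Integrable fun u : ℝ => (fun w => y w ^ J * (lastTransform x g b bc n w / w))
      (Λ + u * I) := integrable_line_of_le
    (fun w hw => ((hyc w hw).pow J).mul ((hGc w hw).div continuousAt_id (hwne w hw))) hrb
  have hsplit : lineIntegral (fun w => lastTransform x g b bc n w / w) Λ t =
      ∑ j ∈ Finset.range J, lineIntegral (f j) Λ t +
        lineIntegral (fun w => y w ^ J * (lastTransform x g b bc n w / w)) Λ t := by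
    rw [← lineIntegral_sum hfi, ← lineIntegral_add (integrable_finsetSum _ fun j _ => hfi j) hri]
    refine lineIntegral_congr (fun w hw => ?_) t
    have := lastTransform_expand b bc J (hne w hw)
    rw [← Finset.sum_div]
    nth_rewrite 1 [this]
    ring
  rw [hsplit, add_sub_cancel_left]
  exact (norm_lineIntegral_le hrb t).trans_eq (by ring)

end

/-! ### Limit of the last agent's velocity -/

variable {P : Params} {v₀ : ℝ}

/-- The crude factor e^{Λt} ≤ e^{Λc(n+1)} is beaten by q^{nJ} once e^{Λc} q^J ≤ 1/2. Thus J depends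
on the time window only, not on ε or n. -/
theorem velocity_expansion (hP : P.Normalized) (hv₀ : v₀ ≠ 0) (bc : Boundary) :
    ∃ Λ > 0, ∀ (c : ℝ) (J₀ : ℕ), ∃ J ≥ J₀, ∀ ε > 0, ∀ᶠ n : ℕ in atTop, ∀ z : ℕ → ℝ → ℝ,
      IsOrbit P bc v₀ (n + 1) z → ∀ t ≤ c * (n + 1),
      ‖(2 * Real.pi * deriv (z (n + 1)) t : ℂ) - v₀ * ∑ j ∈ Finset.range J,
        lineIntegral (fun w => ampE (-P.gx) (-P.gv) (1 + 2 * P.ρv 1) bc w *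
          ampF (-P.gx) (-P.gv) (1 + 2 * P.ρv 1) bc w ^ j *
          pulse (-P.gx) (-P.gv) (1 + 2 * P.ρv 1) j w ^ n / w) Λ t‖ ≤ ε := by
  obtain ⟨M, hM0, hM⟩ := exists_coef_le P bc
  have hx := neg_pos.2 hP.gx_neg
  have hg := neg_pos.2 hP.gv_neg
  -- Any value above the growth rate 6M + 1 of the velocities would do.
  set Λ := 6 * M + 2 with hΛdef
  have hΛ : 0 < Λ := by positivity
  obtain ⟨q, hq0, hq1, C, hC, CF, hCF, hev⟩ :=
    lineIntegral_lastTransform hx hg (1 + 2 * P.ρv 1) bc hΛ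
  refine ⟨Λ, hΛ, fun c J₀ => ?_⟩
  have hJ := (tendsto_pow_atTop_nhds_zero_of_lt_one hq0.le hq1).const_mul (Real.exp (Λ * c))
  rw [mul_zero] at hJ
  obtain ⟨J, hJ1, hJ2⟩ := ((hJ.eventually_le_const (show (0 : ℝ) < 1 / 2 by norm_num)).and
    (eventually_ge_atTop J₀)).exists
  refine ⟨J, hJ2, fun ε hε => ?_⟩
  have hlim := (tendsto_pow_atTop_nhds_zero_of_lt_one (r := (1 / 2 : ℝ)) (by norm_num)
    (by norm_num)).const_mul (|v₀| * (Real.exp (Λ * c) * (CF ^ J * C)))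
  rw [mul_zero] at hlim
  filter_upwards [hev, hlim.eventually_le_const hε] with n hn hsmall z ho t ht
  obtain ⟨hne, hint, hexp⟩ := hn
  obtain ⟨hgrow, htr⟩ := ho.lap_eq hP hv₀ hM0 hM
  have hlap : ∀ w : ℂ, w.re = Λ → lap (deriv (z (n + 1))) w =
      v₀ * (lastTransform (-P.gx) (-P.gv) (1 + 2 * P.ρv 1) bc n w / w) := fun w hw => by
    obtain ⟨X, hX1, hX2⟩ := htr w (by rw [hw]; linarith)
    rw [hX1, lastTransform, ← hX2, mul_div_cancel_right₀ _ (hne w hw), mul_div_assoc]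
  have hinv := lap_inversion hgrow (Λ := Λ) (by linarith)
    (fun t ht => ho.deriv_zero (by omega) le_rfl ht)
    ((hint.const_mul (v₀ : ℂ)).congr (.of_forall fun y => (hlap _ (re_add_mul_I _ _)).symm)) t
  rw [lineIntegral_congr hlap, lineIntegral_const_mul] at hinv
  rw [← hinv, ← mul_sub, norm_mul, norm_real, Real.norm_eq_abs]
  have hexpt : Real.exp (Λ * t) ≤ Real.exp (Λ * c) * Real.exp (Λ * c) ^ n := by
    rw [← Real.exp_nat_mul, ← Real.exp_add]
    apply Real.exp_le_exp.2
    nlinarith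
  have hhalf : (Real.exp (Λ * c) * q ^ J) ^ n ≤ (1 / 2) ^ n :=
    pow_le_pow_left₀ (by positivity) hJ1 n
  calc |v₀| * _ ≤ |v₀| * (Real.exp (Λ * t) * ((CF * q ^ n) ^ J * C)) := by
        gcongr
        exact hexp J t
    _ ≤ |v₀| * ((Real.exp (Λ * c) * Real.exp (Λ * c) ^ n) * ((CF * q ^ n) ^ J * C)) := by gcongr
    _ = |v₀| * (Real.exp (Λ * c) * (CF ^ J * C)) * (Real.exp (Λ * c) * q ^ J) ^ n := by ring
    _ ≤ |v₀| * (Real.exp (Λ * c) * (CF ^ J * C)) * (1 / 2) ^ n := by gcongr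
    _ ≤ ε := hsmall

/-- Reflection coefficient of the end of the flock, for waves of low frequency. -/
noncomputable def reflectionCoef (x g b : ℝ) : ℝ :=
  -(√(2 * x + g ^ 2 * b ^ 2) - g * b) / (√(2 * x + g ^ 2 * b ^ 2) + g * b)

theorem delay_pos {x : ℝ} (hx : 0 < x) (g b : ℝ) : 0 < delay x g b := by
  have := abs_lt_sqrt (g := g) (b := b) hx
  have : 0 < √(2 * x + g ^ 2 * b ^ 2) + g * b := by linarith [neg_abs_le (g * b)]
  unfold delay
  positivity

/-- The velocity of the last agent is bounded, and close to a step function away from its steps. -/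
theorem velocity_limit (hP : P.Normalized) (hv₀ : v₀ ≠ 0) (bc : Boundary)
    {z : ℕ → ℕ → ℝ → ℝ} (hz : ∀ N, 1 ≤ N → IsOrbit P bc v₀ N (z N)) {τ τ' ρ : ℝ}
    (hτ : τ = delay (-P.gx) (-P.gv) (1 + 2 * P.ρv 1))
    (hτ' : τ' = delay (-P.gx) (-P.gv) (-(1 + 2 * P.ρv 1)))
    (hρ : ρ = reflectionCoef (-P.gx) (-P.gv) (1 + 2 * P.ρv 1)) (k₀ : ℕ) :
    (∃ M, ∀ᶠ N : ℕ in atTop, ∀ t ≤ ((k₀ + 1) * τ + k₀ * τ') * N, |deriv (z N N) t| ≤ M) ∧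
    ∀ δ > 0, ∀ ε > 0, ∀ᶠ N : ℕ in atTop, ∀ k ≤ k₀, ∀ t : ℝ,
      (k * τ + (k - 1) * τ') * N + δ * N ≤ t ∨ k = 0 → t ≤ ((k + 1) * τ + k * τ') * N - δ * N →
        |deriv (z N N) t - v₀ * (1 - ρ ^ k)| < ε := by
  have hx := neg_pos.2 hP.gx_neg
  have hg := neg_pos.2 hP.gv_neg
  have hτ0 : 0 < τ := hτ ▸ delay_pos hx _ _
  have hτ'0 : 0 < τ' := hτ' ▸ delay_pos hx _ _
  have hpi := Real.pi_pos
  obtain ⟨Λ, hΛ, hexp⟩ := velocity_expansion hP hv₀ bc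
  obtain ⟨J, hJ, hJe⟩ := hexp ((k₀ + 1) * τ + k₀ * τ') (k₀ + 1)
  set b := 1 + 2 * P.ρv 1 with hb
  set x := -P.gx
  set g := -P.gv
  have hs := strip_pos hx hg b
  have hS := isFront_pulse hx hg b
  have hA : ∀ j : ℕ, IsAmplitude (fun w => ampE x g b bc w * ampF x g b bc w ^ j) (strip x g b) :=
    fun j => (isAmplitude_ampE hx hg b bc).mul ((isAmplitude_ampF hx hg b bc).pow j)
  have hA0 : ∀ j : ℕ, ampE x g b bc 0 * ampF x g b bc 0 ^ j = (((1 - ρ) * ρ ^ j : ℝ) : ℂ) := by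
    intro j
    rw [ampE_zero hx hg, ampF_zero hx hg, hρ, reflectionCoef]
    push_cast
    ring
  set I : ℕ → ℕ → ℝ → ℂ := fun n j t => lineIntegral (fun w => ampE x g b bc w *
    ampF x g b bc w ^ j * pulse x g b j w ^ n / w) Λ t with hI
  have hshift : ∀ p : ℕ → Prop, (∀ᶠ n in atTop, p (n + 1)) → ∀ᶠ N in atTop, p N :=
    fun p hp => (eventually_atTop.2 (by
      obtain ⟨a, ha⟩ := eventually_atTop.1 hp
      refine ⟨a + 1, fun N hN => ?_⟩
      obtain ⟨n, rfl⟩ : ∃ n, N = n + 1 := ⟨N - 1, by omega⟩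
      exact ha n (by omega)))
  constructor
  · choose C hC using fun j => (hS j).exists_bound (hA j) hs hΛ
    refine ⟨1 + |v₀| * ∑ j ∈ Finset.range J, |C j|, hshift _ ?_⟩
    filter_upwards [hJe 1 one_pos, (Finset.eventually_all (Finset.range J)).2 fun j _ => hC j]
      with n h1 h2 t ht
    have h3 := h1 (z (n + 1)) (hz (n + 1) (by omega)) t (by exact_mod_cast ht)
    have h4 : ‖(v₀ : ℂ) * ∑ j ∈ Finset.range J, I n j t‖ ≤
        |v₀| * ∑ j ∈ Finset.range J, |C j| := by
      rw [norm_mul, norm_real, Real.norm_eq_abs]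
      gcongr
      exact (norm_sum_le _ _).trans
        (Finset.sum_le_sum fun j hj => (h2 j hj t).trans (le_abs_self _))
    have h5 := (norm_sub_norm_le _ _).trans h3
    have h6 : ‖(2 * Real.pi * deriv (z (n + 1) (n + 1)) t : ℂ)‖ =
        2 * Real.pi * |deriv (z (n + 1) (n + 1)) t| := by
      rw [norm_mul, norm_mul, norm_real, norm_real, Complex.norm_ofNat, Real.norm_eq_abs,
        Real.norm_eq_abs, abs_of_pos hpi]
    rw [h6] at h5
    have h7 := abs_nonneg (deriv (z (n + 1) (n + 1)) t)
    nlinarith [Real.pi_gt_three]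
  · intro δ hδ ε hε
    set η := ε / (1 + |v₀| * J) with hη
    have hη0 : 0 < η := by positivity
    have hev : ∀ j ∈ Finset.range J, _ := fun j _ => (hS j).front_limit (hA j) hs hΛ hδ hη0
    refine hshift _ ?_
    filter_upwards [hJe η hη0, (Finset.eventually_all (Finset.range J)).2 hev]
      with n h1 h2 k hk t hlo hhi
    push_cast at hlo hhi
    have hn : (0 : ℝ) ≤ n := Nat.cast_nonneg n
    have hkR : (k : ℝ) ≤ k₀ := by exact_mod_cast hk
    have h3 := h1 (z (n + 1)) (hz (n + 1) (by omega)) t (by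
      have : (k : ℝ) * (τ + τ') ≤ k₀ * (τ + τ') := by gcongr
      nlinarith)
    -- In the k-th interval exactly the waves with j < k have arrived; their heights telescope to 1
    -- - ρ^k.
    set a : ℕ → ℂ := fun j => if j < k then 2 * Real.pi * (((1 - ρ) * ρ ^ j : ℝ) : ℂ) else 0
      with ha
    have h4 : ∀ j ∈ Finset.range J, ‖I n j t - a j‖ ≤ η := by
      intro j hj
      by_cases hjk : j < k
      · have hjR : (j : ℝ) + 1 ≤ k := by exact_mod_cast hjk
        have hlo' := hlo.resolve_right (by omega)
        have h5 := (h2 j hj t).2 (by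
          rw [← hτ, ← hτ']
          have : ((j : ℝ) + 1) * (τ + τ') ≤ k * (τ + τ') := by gcongr
          nlinarith)
        rw [hA0] at h5
        simpa [ha, hjk] using h5
      · have hjR : (k : ℝ) ≤ j := by exact_mod_cast not_lt.1 hjk
        have h5 := (h2 j hj t).1 (by
          rw [← hτ, ← hτ']
          have : (k : ℝ) * (τ + τ') ≤ j * (τ + τ') := by gcongr
          nlinarith)
        simpa [ha, hjk] using h5
    have hsum : ∑ j ∈ Finset.range J, a j = 2 * Real.pi * ((1 - ρ ^ k : ℝ) : ℂ) := by
      have e1 : Finset.filter (fun j => j < k) (Finset.range J) = Finset.range k := by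
        ext j
        simp only [Finset.mem_filter, Finset.mem_range]
        omega
      rw [ha, ← Finset.sum_filter, e1, ← Finset.mul_sum, ← ofReal_sum, ← Finset.mul_sum, mul_comm (1 - ρ),
        geom_sum_mul_neg]
    have h6 : ‖(v₀ : ℂ) * ∑ j ∈ Finset.range J, I n j t - v₀ * ∑ j ∈ Finset.range J, a j‖ ≤
        |v₀| * (J * η) := by
      rw [← mul_sub, ← Finset.sum_sub_distrib, norm_mul, norm_real, Real.norm_eq_abs]
      gcongr
      refine (norm_sum_le_of_le _ h4).trans_eq ?_
      simp
    have h7 := (norm_sub_le_norm_sub_add_norm_sub _ _ _).trans (add_le_add h3 h6)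
    rw [hsum] at h7
    have h8 : (2 * Real.pi * deriv (z (n + 1) (n + 1)) t : ℂ) -
        v₀ * (2 * Real.pi * ((1 - ρ ^ k : ℝ) : ℂ)) =
        ((2 * Real.pi * (deriv (z (n + 1) (n + 1)) t - v₀ * (1 - ρ ^ k)) : ℝ) : ℂ) := by
      push_cast
      ring
    rw [h8, norm_real, Real.norm_eq_abs, abs_mul, abs_of_pos (by positivity)] at h7
    have h9 : η + |v₀| * (J * η) = ε := by
      rw [hη]
      field_simp
    rw [h9] at h7
    have h10 := abs_nonneg (deriv (z (n + 1) (n + 1)) t - v₀ * (1 - ρ ^ k))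
    nlinarith [Real.pi_gt_three]

end Flock

/-! ### From slopes to profile and zeros -/

namespace Flock

/-- Start of the `k`-th time interval, per agent. -/
noncomputable def lo (a a' : ℝ) (k : ℕ) : ℝ := if k = 0 then 0 else a + (k - 1) * (a + a')

/-- End of the `k`-th time interval, per agent. -/
noncomputable def hi (a a' : ℝ) (k : ℕ) : ℝ := a + k * (a + a')

/-- The slopes of the functions `w N` are close to the step function with values `u₀ ρ ^ k`. -/
structure HasSlopes (w : ℕ → ℝ → ℝ) (a a' u₀ ρ : ℝ) (k₀ : ℕ) : Prop where
  ha : 0 < a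
  ha' : 0 < a'
  hu₀ : u₀ ≠ 0
  hρ : ρ * a' = -a
  diff : ∀ N, 1 ≤ N → Differentiable ℝ (w N)
  zero : ∀ N, w N 0 = 0 ∨ N = 0
  bdd : ∃ M, ∀ᶠ N : ℕ in atTop, ∀ t, 0 ≤ t → t ≤ hi a a' k₀ * N → |deriv (w N) t| ≤ M
  vel : ∀ δ > 0, ∀ ε > 0, ∀ᶠ N : ℕ in atTop, ∀ k ≤ k₀, ∀ t : ℝ, 0 ≤ t →
    lo a a' k * N + δ * N ≤ t ∨ k = 0 → t ≤ hi a a' k * N - δ * N →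
      |deriv (w N) t - u₀ * ρ ^ k| < ε

theorem abs_sub_le_of_deriv_le {f : ℝ → ℝ} (hf : Differentiable ℝ f) {p q C : ℝ} (hpq : p ≤ q)
    (h : ∀ t ∈ Icc p q, |deriv f t| ≤ C) : |f q - f p| ≤ C * (q - p) := by
  have := (convex_Icc p q).norm_image_sub_le_of_norm_deriv_le (f := f) (C := C)
    (fun t _ => hf t) h (left_mem_Icc.2 hpq) (right_mem_Icc.2 hpq)
  rwa [Real.norm_eq_abs, Real.norm_eq_abs, abs_of_nonneg (sub_nonneg.2 hpq)] at this

/-- The crude slope bound C is used only on a total length of at most 2d at the ends, where the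
velocity is still jumping. -/
theorem abs_sub_le_of_deriv_le_middle {f : ℝ → ℝ} (hf : Differentiable ℝ f) {p q d C ε : ℝ}
    (hd : 0 ≤ d) (hC : 0 ≤ C) (hε : 0 ≤ ε) (h : ∀ t ∈ Icc p q, |deriv f t| ≤ C)
    (hm : ∀ t ∈ Icc (p + d) (q - d), |deriv f t| ≤ ε) {t : ℝ} (hp : p ≤ t) (hq : t ≤ q) :
    |f t - f p| ≤ 2 * d * C + ε * (q - p) := by
  have hqp : 0 ≤ ε * (q - p) := mul_nonneg hε (by linarith)
  rcases le_total (t - p) (2 * d) with h1 | h1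
  · have := abs_sub_le_of_deriv_le hf hp (fun s hs => h s ⟨hs.1, hs.2.trans hq⟩)
    nlinarith
  · have e1 := abs_sub_le_of_deriv_le hf (p := p) (q := p + d) (by linarith)
      (fun s hs => h s ⟨hs.1, hs.2.trans (by linarith)⟩)
    have e2 := abs_sub_le_of_deriv_le hf (p := p + d) (q := t - d) (by linarith)
      (fun s hs => hm s ⟨hs.1, hs.2.trans (by linarith)⟩)
    have e3 := abs_sub_le_of_deriv_le hf (p := t - d) (q := t) (by linarith)
      (fun s hs => h s ⟨by linarith [hs.1], by linarith [hs.2]⟩)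
    have h4 := abs_sub_le (f t) (f (t - d)) (f p)
    have h5 := abs_sub_le (f (t - d)) (f (p + d)) (f p)
    have h6 : ε * (t - d - (p + d)) ≤ ε * (q - p) := by gcongr <;> linarith
    linarith

section
variable {w : ℕ → ℝ → ℝ} {a a' u₀ ρ : ℝ} {k₀ : ℕ}

theorem lo_succ (a a' : ℝ) (k : ℕ) : lo a a' (k + 1) = hi a a' k := by simp [lo, hi]

theorem HasSlopes.lo_nonneg (hw : HasSlopes w a a' u₀ ρ k₀) (k : ℕ) : 0 ≤ lo a a' k := by
  have := hw.ha
  have := hw.ha'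
  rcases k with _ | k
  · simp [lo]
  · rw [lo_succ, hi]
    positivity

theorem HasSlopes.hi_mono (hw : HasSlopes w a a' u₀ ρ k₀) {j k : ℕ} (h : j ≤ k) :
    hi a a' j ≤ hi a a' k := by
  have := hw.ha
  have := hw.ha'
  unfold hi
  gcongr

theorem HasSlopes.hi_sub_lo (hw : HasSlopes w a a' u₀ ρ k₀) (k : ℕ) :
    hi a a' k - lo a a' k ≤ a + a' ∧ lo a a' k ≤ hi a a' k := by
  have := hw.ha
  have := hw.ha'
  rcases k with _ | k
  · simp [lo, hi]
    constructor <;> linarith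
  · rw [lo_succ, hi, hi]
    push_cast
    constructor <;> linarith

theorem HasSlopes.increment (hw : HasSlopes w a a' u₀ ρ k₀) {k : ℕ} (hk : k ≤ k₀) {ε : ℝ}
    (hε : 0 < ε) : ∀ᶠ N : ℕ in atTop, ∀ t, lo a a' k * N ≤ t → t ≤ hi a a' k * N →
      |w N t - w N (lo a a' k * N) - u₀ * ρ ^ k * (t - lo a a' k * N)| ≤ ε * N := by
  obtain ⟨M, hM⟩ := hw.bdd
  have ha := hw.ha
  have ha' := hw.ha'
  set C := |M| + |u₀ * ρ ^ k| + 1 with hC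
  have hC0 : 0 < C := by positivity
  filter_upwards [hM, eventually_ge_atTop 1,
    hw.vel (ε / (4 * C)) (by positivity) (ε / (2 * (a + a'))) (by positivity)]
    with N hMN hN hv t hlo hhi
  have hN0 : (0 : ℝ) < N := by positivity
  have hlo0 := mul_nonneg (hw.lo_nonneg k) hN0.le
  have hmono := mul_le_mul_of_nonneg_right (hw.hi_mono hk) hN0.le
  set f : ℝ → ℝ := fun s => w N s - u₀ * ρ ^ k * s with hf
  have hfd : Differentiable ℝ f := (hw.diff N hN).sub (by fun_prop)
  have hf' : ∀ s, deriv f s = deriv (w N) s - u₀ * ρ ^ k := fun s => by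
    have h1 : HasDerivAt (fun s : ℝ => u₀ * ρ ^ k * s) (u₀ * ρ ^ k) s := by
      simpa using (hasDerivAt_id s).const_mul (u₀ * ρ ^ k)
    exact ((hw.diff N hN s).hasDerivAt.sub h1).deriv
  have := abs_sub_le_of_deriv_le_middle hfd (d := ε / (4 * C) * N) (C := C)
    (ε := ε / (2 * (a + a'))) (by positivity) hC0.le (by positivity)
    (fun s hs => by
      rw [hf']
      refine (abs_sub _ _).trans ?_
      have := hMN s (hlo0.trans hs.1) (hs.2.trans hmono)
      linarith [le_abs_self M])
    (fun s hs => by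
      rw [hf']
      have hpos : 0 ≤ ε / (4 * C) * N := by positivity
      exact (hv k hk s (by linarith [hs.1]) (.inl hs.1) hs.2).le) hlo hhi
  have e1 : 2 * (ε / (4 * C) * N) * C = ε / 2 * N := by field_simp; norm_num
  have e2 : ε / (2 * (a + a')) * (hi a a' k * N - lo a a' k * N) ≤ ε / 2 * N := by
    have := (hw.hi_sub_lo k).1
    calc ε / (2 * (a + a')) * (hi a a' k * N - lo a a' k * N)
        = ε / (2 * (a + a')) * N * (hi a a' k - lo a a' k) := by ring
      _ ≤ ε / (2 * (a + a')) * N * (a + a') := by gcongr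
      _ = ε / 2 * N := by field_simp
  have e3 : f t - f (lo a a' k * N) =
      w N t - w N (lo a a' k * N) - u₀ * ρ ^ k * (t - lo a a' k * N) := by
    simp only [hf]
    ring
  rw [e3] at this
  linarith

/-- The functions `w N` are close to a piecewise linear function. -/
theorem HasSlopes.profile (hw : HasSlopes w a a' u₀ ρ k₀) {k : ℕ} (hk : k ≤ k₀) :
    ∀ ε > 0, ∀ᶠ N : ℕ in atTop, ∀ t, lo a a' k * N ≤ t → t ≤ hi a a' k * N →
      |w N t - u₀ * ρ ^ k * (t - k * (a + a') * N)| ≤ ε * N := by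
  induction k with
  | zero =>
    intro ε hε
    filter_upwards [hw.increment hk hε, eventually_ge_atTop 1] with N h hN t h1 h2
    have := h t h1 h2
    have h0 := (hw.zero N).resolve_right (by omega)
    simpa [lo, h0] using this
  | succ k ih =>
    intro ε hε
    filter_upwards [hw.increment hk (half_pos hε), ih (by omega) (ε / 2) (half_pos hε),
      eventually_ge_atTop 1] with N h hprev hN t h1 h2
    have e1 := h t h1 h2
    have e2 := hprev (hi a a' k * N)
      (mul_le_mul_of_nonneg_right (hw.hi_sub_lo k).2 (Nat.cast_nonneg N)) le_rfl
    rw [lo_succ] at e1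
    have e3 : w N t - u₀ * ρ ^ (k + 1) * (t - (k + 1 : ℕ) * (a + a') * N) =
        (w N t - w N (hi a a' k * N) - u₀ * ρ ^ (k + 1) * (t - hi a a' k * N)) +
        (w N (hi a a' k * N) - u₀ * ρ ^ k * (hi a a' k * N - k * (a + a') * N)) := by
      rw [hi]
      push_cast
      -- The relation ρa' = -a makes consecutive linear pieces agree at the corner.
      linear_combination (u₀ * ρ ^ k * N) * hw.hρ
    rw [e3]
    exact (abs_add_le _ _).trans (by linarith)

theorem HasSlopes.rho_ne_zero (hw : HasSlopes w a a' u₀ ρ k₀) : ρ ≠ 0 := by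
  intro h
  have := hw.hρ
  rw [h] at this
  linarith [hw.ha]

theorem HasSlopes.slope_ne_zero (hw : HasSlopes w a a' u₀ ρ k₀) (k : ℕ) : u₀ * ρ ^ k ≠ 0 :=
  mul_ne_zero hw.hu₀ (pow_ne_zero _ hw.rho_ne_zero)

theorem mul_pos_of_abs_sub_lt {u v : ℝ} (hu : u ≠ 0) (h : |v - u| < |u| / 2) : 0 < u * v := by
  have h1 := abs_lt.1 h
  rcases lt_or_gt_of_ne hu with h2 | h2
  · rw [abs_of_neg h2] at h1
    nlinarith
  · rw [abs_of_pos h2] at h1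
    nlinarith

theorem strictMonoOn_mul {f : ℝ → ℝ} (hf : Differentiable ℝ f) {u p q : ℝ}
    (h : ∀ t ∈ Icc p q, 0 < u * deriv f t) : StrictMonoOn (fun t => u * f t) (Icc p q) := by
  refine strictMonoOn_of_deriv_pos (convex_Icc p q)
    (hf.continuous.const_mul u).continuousOn fun t ht => ?_
  rw [interior_Icc] at ht
  rw [deriv_const_mul_field]
  exact h t (Ioo_subset_Icc_self ht)

/-- `T` is the only zero of `f` in `[p, q]`, and `f` changes its sign there. -/
structure IsOnlyCrossing (f : ℝ → ℝ) (p q T : ℝ) : Prop where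
  mem : T ∈ Ioo p q
  zero : f T = 0
  unique : ∀ t ∈ Icc p q, f t = 0 → t = T
  crossing : IsCrossing f T

/-- The profile error |u|eN/2 is half of the profile's size at distance eN from its zero. This
forces a sign change inside the window of radius eN and excludes zeros outside it. As e ≤ m/2, the
window stays away from the velocity jumps, so w is strictly monotone there. -/
theorem HasSlopes.exists_crossing (hw : HasSlopes w a a' u₀ ρ k₀) {k : ℕ} (hk1 : 1 ≤ k)
    (hk : k ≤ k₀) {η : ℝ} (hη : 0 < η) : ∀ᶠ N : ℕ in atTop, ∃ T,
      IsOnlyCrossing (w N) (lo a a' k * N) (hi a a' k * N) T ∧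
        |T - k * (a + a') * N| ≤ η * N := by
  have ha := hw.ha
  have ha' := hw.ha'
  set m := min a a' with hm
  have hm0 : 0 < m := lt_min ha ha'
  have hma : m ≤ a := min_le_left _ _
  have hma' : m ≤ a' := min_le_right _ _
  set e := min η (m / 2) with he
  have he0 : 0 < e := lt_min hη (by positivity)
  have heη : e ≤ η := min_le_left _ _
  have hem : e ≤ m / 2 := min_le_right _ _
  set u := u₀ * ρ ^ k with hu
  have hu0 : u ≠ 0 := hw.slope_ne_zero k
  have hau : 0 < |u| := abs_pos.2 hu0
  have hlo : lo a a' k = k * (a + a') - a' := by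
    obtain ⟨j, rfl⟩ : ∃ j, k = j + 1 := ⟨k - 1, by omega⟩
    rw [lo_succ, hi]
    push_cast
    ring
  have hhi : hi a a' k = k * (a + a') + a := by rw [hi]; ring
  filter_upwards [hw.vel (m / 2) (by positivity) (|u| / 2) (by positivity),
    hw.profile hk (|u| * e / 2) (by positivity), eventually_ge_atTop 1] with N hv hp hN
  have hN0 : (0 : ℝ) < N := by positivity
  have hloN := mul_nonneg (hw.lo_nonneg k) hN0.le
  set c := k * (a + a') * N with hc
  have hloc : lo a a' k * N = c - a' * N := by rw [hlo, hc]; ring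
  have hhic : hi a a' k * N = c + a * N := by rw [hhi, hc]; ring
  have heN : e * N ≤ m / 2 * N := by gcongr
  have heN0 : 0 < e * N := by positivity
  have hmN : m * N ≤ a * N := by gcongr
  have hmN' : m * N ≤ a' * N := by gcongr
  have hmono : StrictMonoOn (fun t => u * w N t) (Icc (c - e * N) (c + e * N)) := by
    refine strictMonoOn_mul (hw.diff N hN) fun t ht => mul_pos_of_abs_sub_lt hu0 ?_
    exact hv k hk t (by linarith [ht.1]) (.inl (by linarith [ht.1])) (by linarith [ht.2])
  have hu2 : 0 < u * u := mul_self_pos.2 hu0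
  have hval : ∀ t, lo a a' k * N ≤ t → t ≤ hi a a' k * N →
      |u * w N t - u * u * (t - c)| ≤ u * u * (e * N) / 2 := fun t h1 h2 => by
    have := hp t h1 h2
    calc |u * w N t - u * u * (t - c)| = |u| * |w N t - u * (t - c)| := by
          rw [← abs_mul]; ring_nf
      _ ≤ |u| * (|u| * e / 2 * N) := by gcongr
      _ = (|u| * |u|) * (e * N) / 2 := by ring
      _ = _ := by rw [abs_mul_abs_self]
  have hneg : u * w N (c - e * N) < 0 := by
    have := (abs_le.1 (hval (c - e * N) (by linarith) (by linarith))).2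
    nlinarith
  have hpos : 0 < u * w N (c + e * N) := by
    have := (abs_le.1 (hval (c + e * N) (by linarith) (by linarith))).1
    nlinarith
  obtain ⟨T, hT, hT0⟩ := intermediate_value_Ioo (by linarith : c - e * N ≤ c + e * N)
    ((hw.diff N hN).continuous.const_mul u).continuousOn ⟨hneg, hpos⟩
  have hwT : w N T = 0 := (mul_eq_zero.1 hT0).resolve_left hu0
  refine ⟨T, ⟨⟨by linarith [hT.1], by linarith [hT.2]⟩, hwT, fun t ht h0 => ?_, hwT, ?_⟩, ?_⟩
  · have h1 := hval t ht.1 ht.2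
    rw [h0, mul_zero, zero_sub, abs_neg, abs_mul, abs_of_pos hu2] at h1
    have h2 : |t - c| ≤ e * N := by nlinarith [abs_nonneg (t - c)]
    have h3 := abs_le.1 h2
    refine hmono.injOn ⟨by linarith, by linarith⟩ (Ioo_subset_Icc_self hT) ?_
    simp only [h0, hwT]
  · refine ⟨min (T - (c - e * N)) (c + e * N - T), lt_min (by linarith [hT.1])
      (by linarith [hT.2]), fun r hr s hs => ?_⟩
    have hr1 : c - e * N < r := by
      linarith [hr.1, min_le_left (T - (c - e * N)) (c + e * N - T)]
    have hs1 : s < c + e * N := by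
      linarith [hs.2, min_le_right (T - (c - e * N)) (c + e * N - T)]
    have h1 : u * w N r < u * w N T :=
      hmono ⟨hr1.le, by linarith [hr.2, hT.2]⟩ (Ioo_subset_Icc_self hT) hr.2
    have h2 : u * w N T < u * w N s :=
      hmono (Ioo_subset_Icc_self hT) ⟨by linarith [hs.1, hT.1], hs1.le⟩ hs.1
    rw [hwT, mul_zero] at h1 h2
    have h3 := mul_neg_of_neg_of_pos h1 h2
    have h4 : u * w N r * (u * w N s) = u * u * (w N r * w N s) := by ring
    rw [h4] at h3
    exact neg_of_mul_neg_right h3 hu2.le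
  · rw [abs_le]
    have : e * N ≤ η * N := by gcongr
    constructor <;> linarith [hT.1, hT.2]

/-- Near t = 0 the error of the profile is larger than the profile, so strict monotonicity from the
value 0 takes over; the profile handles t > aN/2. -/
theorem HasSlopes.no_early_zero (hw : HasSlopes w a a' u₀ ρ k₀) :
    ∀ᶠ N : ℕ in atTop, ∀ t ∈ Ioc 0 (hi a a' 0 * N), w N t ≠ 0 := by
  have ha := hw.ha
  have hau : 0 < |u₀| := abs_pos.2 hw.hu₀
  filter_upwards [hw.vel (a / 2) (by positivity) (|u₀| / 2) (by positivity),
    hw.profile (Nat.zero_le k₀) (|u₀| * (a / 2)) (by positivity), eventually_ge_atTop 1]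
    with N hv hp hN t ht h0
  have hN0 : (0 : ℝ) < N := by positivity
  have hhi : hi a a' 0 = a := by simp [hi]
  have hlo : lo a a' 0 = 0 := by simp [lo]
  have hmono : StrictMonoOn (fun t => u₀ * w N t) (Icc 0 (a / 2 * N)) := by
    refine strictMonoOn_mul (hw.diff N hN) fun t ht => mul_pos_of_abs_sub_lt hw.hu₀ ?_
    have := hv 0 (Nat.zero_le _) t ht.1 (.inr rfl) (by rw [hhi]; linarith [ht.2])
    simpa using this
  have h1 := hp t (by rw [hlo, zero_mul]; exact ht.1.le) ht.2
  simp only [h0, pow_zero, mul_one, Nat.cast_zero, zero_mul, sub_zero, zero_sub, abs_neg,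
    abs_mul, abs_of_pos ht.1] at h1
  rw [mul_assoc] at h1
  have h2 : t ≤ a / 2 * N := le_of_mul_le_mul_left h1 hau
  have h3 := hmono (left_mem_Icc.2 (by positivity)) ⟨ht.1.le, h2⟩ ht.1
  simp only [h0, (hw.zero N).resolve_right (by omega), mul_zero, lt_irrefl] at h3

end

end Flock

/-! ### Counting zeros and locating extrema -/

namespace Flock

/-- If `f` has no zero in `(0, q 0]` and a single one in each `[q j, q (j + 1)]`, the latter are all
its positive zeros up to `q k₀`. -/
theorem isKthCrossing_of_isOnlyCrossing {f : ℝ → ℝ} {q T : ℕ → ℝ} {k₀ : ℕ} (hq : 0 < q 0)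
    (h0 : ∀ t ∈ Ioc 0 (q 0), f t ≠ 0)
    (h : ∀ j < k₀, IsOnlyCrossing f (q j) (q (j + 1)) (T (j + 1))) {k : ℕ} (hk : k < k₀) :
    IsKthCrossing f (k + 1) (T (k + 1)) := by
  have key : ∀ k ≤ k₀, 0 < q k ∧ {t | t ∈ Ioc 0 (q k) ∧ f t = 0}.encard = k := by
    intro k
    induction k with
    | zero =>
      refine fun _ => ⟨hq, ?_⟩
      rw [Nat.cast_zero, encard_eq_zero, eq_empty_iff_forall_notMem]
      exact fun t ht => h0 t ht.1 ht.2
    | succ k ih =>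
      intro hk
      obtain ⟨hqk, hcard⟩ := ih (by omega)
      have hT := h k (by omega)
      have heq : {t | t ∈ Ioc 0 (q (k + 1)) ∧ f t = 0} =
          insert (T (k + 1)) {t | t ∈ Ioc 0 (q k) ∧ f t = 0} := by
        ext t
        simp only [mem_ofPred_eq, mem_insert_iff]
        constructor
        · rintro ⟨ht, hft⟩
          rcases le_or_gt t (q k) with h1 | h1
          · exact .inr ⟨⟨ht.1, h1⟩, hft⟩
          · exact .inl (hT.unique t ⟨h1.le, ht.2⟩ hft)
        · rintro (rfl | ⟨ht, hft⟩)
          · exact ⟨⟨hqk.trans hT.mem.1, hT.mem.2.le⟩, hT.zero⟩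
          · exact ⟨⟨ht.1, ht.2.trans (hT.mem.1.trans hT.mem.2).le⟩, hft⟩
      refine ⟨hqk.trans (hT.mem.1.trans hT.mem.2), ?_⟩
      rw [heq, encard_insert_of_notMem fun hmem => hT.mem.1.not_ge hmem.1.2, hcard]
      norm_cast
  obtain ⟨hqk, hcard⟩ := key k hk.le
  have hT := h k hk
  refine ⟨hqk.trans hT.mem.1, hT.crossing, ?_⟩
  have heq : {t | t ∈ Ioo 0 (T (k + 1)) ∧ f t = 0} = {t | t ∈ Ioc 0 (q k) ∧ f t = 0} := by
    ext t
    simp only [mem_ofPred_eq]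
    constructor
    · rintro ⟨ht, hft⟩
      refine ⟨⟨ht.1, le_of_not_gt fun h1 => ?_⟩, hft⟩
      exact ht.2.ne (hT.unique t ⟨h1.le, (ht.2.trans hT.mem.2).le⟩ hft)
    · rintro ⟨ht, hft⟩
      exact ⟨⟨ht.1, ht.2.trans_lt hT.mem.1⟩, hft⟩
  rw [heq, hcard]
  norm_cast

open Classical in
/-- The only zero of `w N` in the `k`-th time interval, and `0` for `k = 0`. -/
noncomputable def crossingTime (w : ℕ → ℝ → ℝ) (a a' : ℝ) (N k : ℕ) : ℝ :=
  if h : k ≠ 0 ∧ ∃ T, IsOnlyCrossing (w N) (lo a a' k * N) (hi a a' k * N) T then h.2.choose else 0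

section
variable {w : ℕ → ℝ → ℝ} {a a' u₀ ρ : ℝ} {k₀ : ℕ}

theorem crossingTime_zero (w : ℕ → ℝ → ℝ) (a a' : ℝ) (N : ℕ) : crossingTime w a a' N 0 = 0 := by
  simp [crossingTime]

/-- `crossingTime` is chosen without reference to η; uniqueness of the zero identifies it with the
one within ηN of the predicted time. -/
theorem HasSlopes.crossingTime_spec (hw : HasSlopes w a a' u₀ ρ k₀) {η : ℝ} (hη : 0 < η) :
    ∀ᶠ N : ℕ in atTop, ∀ k, 1 ≤ k → k ≤ k₀ →
      IsOnlyCrossing (w N) (lo a a' k * N) (hi a a' k * N) (crossingTime w a a' N k) ∧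
        |crossingTime w a a' N k - k * (a + a') * N| ≤ η * N := by
  have : ∀ᶠ N : ℕ in atTop, ∀ k ∈ Finset.Icc 1 k₀, ∃ T,
      IsOnlyCrossing (w N) (lo a a' k * N) (hi a a' k * N) T ∧
        |T - k * (a + a') * N| ≤ η * N :=
    (Finset.eventually_all _).2 fun k hk =>
      hw.exists_crossing (Finset.mem_Icc.1 hk).1 (Finset.mem_Icc.1 hk).2 hη
  filter_upwards [this] with N h k hk1 hk
  obtain ⟨T, hT, hTη⟩ := h k (Finset.mem_Icc.2 ⟨hk1, hk⟩)
  have h1 : k ≠ 0 ∧ ∃ T, IsOnlyCrossing (w N) (lo a a' k * N) (hi a a' k * N) T :=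
    ⟨by omega, T, hT⟩
  have h2 : IsOnlyCrossing (w N) (lo a a' k * N) (hi a a' k * N) (crossingTime w a a' N k) := by
    rw [crossingTime, dif_pos h1]
    exact h1.2.choose_spec
  refine ⟨h2, ?_⟩
  rwa [hT.unique _ (Ioo_subset_Icc_self h2.mem) h2.zero]

theorem HasSlopes.eventually_isKthCrossing (hw : HasSlopes w a a' u₀ ρ k₀) :
    ∀ᶠ N : ℕ in atTop, ∀ k, 1 ≤ k → k ≤ k₀ →
      IsKthCrossing (w N) k (crossingTime w a a' N k) := by
  filter_upwards [hw.crossingTime_spec one_pos, hw.no_early_zero, eventually_ge_atTop 1]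
    with N h h0 hN k hk1 hk
  have hN0 : (0 : ℝ) < N := by positivity
  obtain ⟨k, rfl⟩ : ∃ j, k = j + 1 := ⟨k - 1, by omega⟩
  have hpos : 0 < hi a a' 0 * N := by
    have := hw.ha
    simp only [hi, Nat.cast_zero, zero_mul, add_zero]
    positivity
  refine isKthCrossing_of_isOnlyCrossing (q := fun j => hi a a' j * N) hpos h0
    (fun j hj => ?_) hk
  have := (h (j + 1) (by omega) (by omega)).1
  rwa [lo_succ] at this

theorem HasSlopes.tendsto_crossingTime (hw : HasSlopes w a a' u₀ ρ k₀) {k : ℕ} (hk1 : 1 ≤ k)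
    (hk : k ≤ k₀) :
    Tendsto (fun N : ℕ => crossingTime w a a' N k / N) atTop (𝓝 ((a + a') * k)) := by
  rw [Metric.tendsto_nhds]
  intro ε hε
  filter_upwards [hw.crossingTime_spec (half_pos hε), eventually_ge_atTop 1] with N h hN
  have hN0 : (0 : ℝ) < N := by positivity
  have h1 := (h k hk1 hk).2
  have h2 : crossingTime w a a' N k / N - (a + a') * k =
      (crossingTime w a a' N k - k * (a + a') * N) / N := by field_simp
  rw [Real.dist_eq, h2, abs_div, abs_of_pos hN0, div_lt_iff₀ hN0]
  nlinarith

/-- Local extrema after the `k`-th and before the `k + 1`-st zero are close to `hi a a' k * N`. -/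
theorem HasSlopes.abs_extr_sub_le (hw : HasSlopes w a a' u₀ ρ k₀) {δ : ℝ} (hδ : 0 < δ) :
    ∀ᶠ N : ℕ in atTop, ∀ k < k₀, ∀ s ∈ Icc (lo a a' k * N) (hi a a' (k + 1) * N),
      (k ≠ 0 → lo a a' k * N + δ * N ≤ s) → s ≤ hi a a' (k + 1) * N - δ * N →
        IsLocalExtr (w N) s → |s - hi a a' k * N| ≤ δ * N := by
  have hv : ∀ᶠ N : ℕ in atTop, ∀ k ∈ Finset.range (k₀ + 1), ∀ t : ℝ, 0 ≤ t →
      lo a a' k * N + δ * N ≤ t ∨ k = 0 → t ≤ hi a a' k * N - δ * N → deriv (w N) t ≠ 0 := by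
    refine (Finset.eventually_all _).2 fun k hk => ?_
    have hu := abs_pos.2 (hw.slope_ne_zero k)
    filter_upwards [hw.vel δ hδ _ hu] with N h t h0 h1 h2 h3
    have := h k (by simpa [Nat.lt_succ_iff] using hk) t h0 h1 h2
    rw [h3, zero_sub, abs_neg] at this
    exact lt_irrefl _ this
  filter_upwards [hv] with N h k hk s hs h1 h2 hext
  have hs0 : 0 ≤ s := (mul_nonneg (hw.lo_nonneg k) (Nat.cast_nonneg N)).trans hs.1
  have hd := hext.deriv_eq_zero
  rw [abs_le]
  constructor
  · by_contra! h3
    refine h k (by simp; omega) s hs0 ?_ (by linarith) hd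
    by_cases hk0 : k = 0
    · exact .inr hk0
    · exact .inl (h1 hk0)
  · by_contra! h3
    exact h (k + 1) (by simp; omega) s hs0 (.inl (by rw [lo_succ]; linarith)) h2 hd

/-- Existence is Rolle's theorem between consecutive zeros. An extremum lies within δN of the
corner, where the profile differs from its corner value by at most UδN, with U bounding all slopes.
-/
theorem HasSlopes.eventually_extr (hw : HasSlopes w a a' u₀ ρ k₀) {ε : ℝ} (hε : 0 < ε) :
    ∀ᶠ N : ℕ in atTop, ∀ k < k₀,
      (∃ s ∈ Ioo (crossingTime w a a' N k) (crossingTime w a a' N (k + 1)),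
        IsLocalExtr (w N) s) ∧
      ∀ s ∈ Ioo (crossingTime w a a' N k) (crossingTime w a a' N (k + 1)),
        IsLocalExtr (w N) s → |w N s / N - u₀ * ρ ^ k * a| < ε := by
  have ha := hw.ha
  have ha' := hw.ha'
  obtain ⟨U, hU⟩ : ∃ U, ∀ k ∈ Finset.range (k₀ + 1), |u₀ * ρ ^ k| ≤ U :=
    ⟨∑ k ∈ Finset.range (k₀ + 1), |u₀ * ρ ^ k|, fun k hk =>
      Finset.single_le_sum (f := fun k => |u₀ * ρ ^ k|) (fun _ _ => abs_nonneg _) hk⟩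
  have hU0 : 0 ≤ U := (abs_nonneg _).trans (hU 0 (by simp))
  obtain ⟨δ, hδ, hδa, hδa', hδU⟩ : ∃ δ > 0, δ ≤ a / 2 ∧ δ ≤ a' / 2 ∧ U * δ ≤ ε / 2 := by
    refine ⟨min (min (a / 2) (a' / 2)) (ε / (2 * (U + 1))), by positivity,
      (min_le_left _ _).trans (min_le_left _ _), (min_le_left _ _).trans (min_le_right _ _), ?_⟩
    calc U * min (min (a / 2) (a' / 2)) (ε / (2 * (U + 1)))
        ≤ (U + 1) * (ε / (2 * (U + 1))) := by
          gcongr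
          · linarith
          · exact min_le_right _ _
      _ = ε / 2 := by field_simp
  have hp : ∀ᶠ N : ℕ in atTop, ∀ k ∈ Finset.range (k₀ + 1),
      ∀ t, lo a a' k * N ≤ t → t ≤ hi a a' k * N →
        |w N t - u₀ * ρ ^ k * (t - k * (a + a') * N)| ≤ ε / 4 * N :=
    (Finset.eventually_all _).2 fun k hk =>
      hw.profile (by simpa [Nat.lt_succ_iff] using hk) _ (by positivity)
  filter_upwards [hw.crossingTime_spec hδ, hw.abs_extr_sub_le hδ, hp, eventually_ge_atTop 1]
    with N hT hext hpN hN k hk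
  have hN0 : (0 : ℝ) < N := by positivity
  obtain ⟨hT1, hT1'⟩ := hT (k + 1) (by omega) hk
  set S := crossingTime w a a' N k with hS
  set T := crossingTime w a a' N (k + 1) with hTdef
  have hδN : δ * N ≤ a / 2 * N := by gcongr
  have hδN' : δ * N ≤ a' / 2 * N := by gcongr
  have haN : 0 < a * N := by positivity
  have haN' : 0 < a' * N := by positivity
  have hSlo : lo a a' k * N ≤ S ∧ (k ≠ 0 → lo a a' k * N + δ * N ≤ S) ∧ w N S = 0 ∧
      S ≤ hi a a' k * N := by
    rcases Nat.eq_zero_or_pos k with rfl | hk1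
    · rw [crossingTime_zero] at hS
      rw [hS]
      have := (hw.zero N).resolve_right (by omega)
      simp [lo, hi, this]
      positivity
    · obtain ⟨h1, h2⟩ := hT k hk1 hk.le
      refine ⟨h1.mem.1.le, fun _ => ?_, h1.zero, h1.mem.2.le⟩
      have h3 := (abs_le.1 h2).1
      obtain ⟨j, rfl⟩ : ∃ j, k = j + 1 := ⟨k - 1, by omega⟩
      rw [lo_succ, hi]
      push_cast at h3
      linarith
  obtain ⟨hS1, hS2, hS3, hS4⟩ := hSlo
  have hlt : hi a a' k * N < T := by
    have := hT1.mem.1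
    rwa [lo_succ] at this
  have hThi : T ≤ hi a a' (k + 1) * N - δ * N := by
    have := (abs_le.1 hT1').2
    rw [hi]
    push_cast at this ⊢
    linarith
  refine ⟨exists_isLocalExtr_Ioo (hS4.trans_lt hlt) (hw.diff N hN).continuous.continuousOn
    (by rw [hS3, hT1.zero]), fun s hs hse => ?_⟩
  have hclose := hext k hk s ⟨hS1.trans hs.1.le, hs.2.le.trans hT1.mem.2.le⟩
    (fun h0 => (hS2 h0).trans hs.1.le) (hs.2.le.trans hThi) hse
  -- Both pieces pass through the corner, so one estimate serves both; u is the slope of the piece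
  -- containing s.
  have main : ∀ u, |u| ≤ U → |w N s - (u * (s - hi a a' k * N) + u₀ * ρ ^ k * a * N)| ≤ ε / 4 * N →
      |w N s / N - u₀ * ρ ^ k * a| < ε := by
    intro u hu h
    have h1 : |u * (s - hi a a' k * N)| ≤ ε / 2 * N := by
      rw [abs_mul]
      calc |u| * |s - hi a a' k * N| ≤ U * (δ * N) := by gcongr
        _ = U * δ * N := by ring
        _ ≤ ε / 2 * N := by gcongr
    have h2 : w N s / N - u₀ * ρ ^ k * a = (w N s - u₀ * ρ ^ k * a * N) / N := by field_simp
    rw [h2, abs_div, abs_of_pos hN0, div_lt_iff₀ hN0]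
    have h3 : w N s - u₀ * ρ ^ k * a * N =
        (w N s - (u * (s - hi a a' k * N) + u₀ * ρ ^ k * a * N)) + u * (s - hi a a' k * N) := by
      ring
    rw [h3]
    refine (abs_add_le _ _).trans_lt ?_
    have : 0 < ε * N := by positivity
    linarith
  rcases le_total s (hi a a' k * N) with h | h
  · refine main (u₀ * ρ ^ k) (hU k (by simp; omega)) ?_
    have := hpN k (by simp; omega) s (hS1.trans hs.1.le) h
    convert this using 3
    rw [hi]
    ring
  · refine main (u₀ * ρ ^ (k + 1)) (hU (k + 1) (by simp; omega)) ?_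
    have := hpN (k + 1) (by simp; omega) s (by rwa [lo_succ])
      (hs.2.le.trans hT1.mem.2.le)
    convert this using 3
    rw [hi]
    push_cast
    linear_combination (u₀ * ρ ^ k * N) * hw.hρ

end

/-! ### Identification of delays and reflection coefficient with the signal velocities -/

section
variable {P : Params}

theorem Params.sqrt_eq (P : Params) :
    √(2 * -P.gx + (-P.gv) ^ 2 * (1 + 2 * P.ρv 1) ^ 2) =
      2 * √(P.gv ^ 2 * (1 + 2 * P.ρv 1) ^ 2 / 4 - P.gx / 2) := by
  have h4 : (2 : ℝ) = √4 := by rw [show (4 : ℝ) = 2 ^ 2 by norm_num, Real.sqrt_sq (by norm_num)]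
  rw [show 2 * √(P.gv ^ 2 * (1 + 2 * P.ρv 1) ^ 2 / 4 - P.gx / 2) =
    √4 * √(P.gv ^ 2 * (1 + 2 * P.ρv 1) ^ 2 / 4 - P.gx / 2) by rw [← h4],
    ← Real.sqrt_mul (by norm_num)]
  congr 1
  ring

theorem Params.delay_eq (P : Params) :
    delay (-P.gx) (-P.gv) (1 + 2 * P.ρv 1) = 1 / P.cPlus := by
  rw [delay, P.sqrt_eq, Params.cPlus, ← mul_div_mul_left 1 _ (two_ne_zero' ℝ)]
  congr 1 <;> ring

theorem Params.delay_neg_eq (P : Params) :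
    delay (-P.gx) (-P.gv) (-(1 + 2 * P.ρv 1)) = -(1 / P.cMinus) := by
  rw [delay, neg_sq (1 + 2 * P.ρv 1), P.sqrt_eq, Params.cMinus, ← mul_div_mul_left 1 _ (two_ne_zero' ℝ), ← div_neg]
  congr 1 <;> ring

theorem Params.reflectionCoef_eq (P : Params) :
    reflectionCoef (-P.gx) (-P.gv) (1 + 2 * P.ρv 1) = P.cMinus / P.cPlus := by
  rw [reflectionCoef, P.sqrt_eq, Params.cPlus, Params.cMinus,
    ← mul_div_mul_left (-(P.gv * (1 + 2 * P.ρv 1)) / 2 - _) _ (two_ne_zero' ℝ)]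
  congr 1 <;> ring

theorem Params.Normalized.inv_cPlus_pos (hP : P.Normalized) : 0 < 1 / P.cPlus :=
  P.delay_eq ▸ delay_pos (neg_pos.2 hP.gx_neg) _ _

theorem Params.Normalized.neg_inv_cMinus_pos (hP : P.Normalized) : 0 < -(1 / P.cMinus) :=
  P.delay_neg_eq ▸ delay_pos (neg_pos.2 hP.gx_neg) _ _

theorem responseTime_eq (P : Params) (N k : ℕ) :
    P.responseTime N k = hi (1 / P.cPlus) (-(1 / P.cMinus)) k * N := by
  rw [Params.responseTime, hi]
  push_cast
  ring

theorem IsOrbit.deriv_relOrbit {bc : Boundary} {v₀ : ℝ} {N : ℕ} {z : ℕ → ℝ → ℝ}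
    (hz : IsOrbit P bc v₀ N z) (hN : 1 ≤ N) (t : ℝ) :
    HasDerivAt (relOrbit v₀ N z) (deriv (z N) t - v₀) t := by
  have h1 : HasDerivAt (fun s : ℝ => v₀ * s) v₀ t := by
    simpa using (hasDerivAt_id t).const_mul v₀
  exact (((hz.smooth N hN le_rfl).differentiable one_ne_zero) t).hasDerivAt.sub h1

theorem hasSlopes_relOrbit (hP : P.Normalized) {v₀ : ℝ} (hv₀ : v₀ ≠ 0) (bc : Boundary)
    {z : ℕ → ℕ → ℝ → ℝ} (hz : ∀ N, 1 ≤ N → IsOrbit P bc v₀ N (z N)) (k₀ : ℕ) :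
    HasSlopes (fun N => relOrbit v₀ N (z N)) (1 / P.cPlus) (-(1 / P.cMinus)) (-v₀)
      (P.cMinus / P.cPlus) k₀ := by
  have ha := hP.inv_cPlus_pos
  have ha' := hP.neg_inv_cMinus_pos
  obtain ⟨⟨M, hM⟩, hvel⟩ := velocity_limit hP hv₀ bc hz P.delay_eq.symm P.delay_neg_eq.symm
    P.reflectionCoef_eq.symm k₀
  have hend : ∀ k : ℕ, hi (1 / P.cPlus) (-(1 / P.cMinus)) k =
      (k + 1) * (1 / P.cPlus) + k * -(1 / P.cMinus) := fun k => by
    rw [hi]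
    ring
  refine ⟨ha, ha', neg_ne_zero.2 hv₀, ?_, fun N hN t => ((hz N hN).deriv_relOrbit hN t).differentiableAt,
    fun N => ?_, ⟨M + |v₀|, ?_⟩, fun δ hδ ε hε => ?_⟩
  · have h1 : P.cPlus ≠ 0 := fun h => by simp [h] at ha
    have h2 : P.cMinus ≠ 0 := fun h => by simp [h] at ha'
    field_simp
  · rcases Nat.eq_zero_or_pos N with hN | hN
    · exact .inr hN
    · exact .inl (by simp [relOrbit, (hz N hN).rest N hN le_rfl 0 le_rfl])
  · filter_upwards [hM, eventually_ge_atTop 1] with N h hN t _ ht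
    rw [((hz N hN).deriv_relOrbit hN t).deriv]
    refine (abs_sub _ _).trans (by gcongr; exact h t (by rwa [← hend]))
  · filter_upwards [hvel δ hδ ε hε, eventually_ge_atTop 1] with N h hN k hk t _ h1 h2
    rw [((hz N hN).deriv_relOrbit hN t).deriv]
    have hlo : (k * (1 / P.cPlus) + (k - 1) * -(1 / P.cMinus)) * N + δ * N ≤ t ∨ k = 0 := by
      rcases k with _ | k
      · exact .inr rfl
      · rw [lo_succ, hend] at h1
        rwa [Nat.cast_succ, add_sub_cancel_right]
    have h3 := h k hk t hlo (by rwa [← hend])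
    convert h3 using 2
    ring

end

end Flock

theorem mainTheorem1 (P : Flock.Params) (hP : P.Normalized) (bc : Flock.Boundary)
    (v₀ : ℝ) (hv₀ : v₀ ≠ 0) (k₀ : ℕ) (hk₀ : 1 ≤ k₀)
    (z : ℕ → ℕ → ℝ → ℝ) (hz : ∀ N, 1 ≤ N → Flock.IsOrbit P bc v₀ N (z N)) :
    -- relative velocity `u_k` between the response times `t_{k-1}` and `t_k`, for `0 ≤ k ≤ k₀`
    (∀ δ > 0, ∀ ε > 0, ∀ᶠ N : ℕ in atTop, ∀ k ≤ k₀, ∀ t : ℝ, 0 ≤ t →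
      P.responseTime N ((k : ℤ) - 1) + δ * N ≤ t → t ≤ P.responseTime N k - δ * N →
        |deriv (Flock.relOrbit v₀ N (z N)) t - -(P.cMinus / P.cPlus) ^ k * v₀| < ε) ∧
    ∃ T : ℕ → ℕ → ℝ,
      (∀ N, T N 0 = 0) ∧
      -- crossing times `T_k`, for `1 ≤ k ≤ k₀`
      (∀ᶠ N : ℕ in atTop, ∀ k, 1 ≤ k → k ≤ k₀ →
        Flock.IsKthCrossing (Flock.relOrbit v₀ N (z N)) k (T N k)) ∧
      (∀ k, 1 ≤ k → k ≤ k₀ →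
        Tendsto (fun N : ℕ => T N k / N) atTop (𝓝 ((1 / P.cPlus - 1 / P.cMinus) * k))) ∧
      -- local extrema `A_k` between `T_{k-1}` and `T_k`, for `1 ≤ k ≤ k₀`
      (∀ ε > 0, ∀ᶠ N : ℕ in atTop, ∀ k, 1 ≤ k → k ≤ k₀ →
        (∃ s ∈ Ioo (T N (k - 1)) (T N k), IsLocalExtr (Flock.relOrbit v₀ N (z N)) s) ∧
        ∀ s ∈ Ioo (T N (k - 1)) (T N k), IsLocalExtr (Flock.relOrbit v₀ N (z N)) s →
          |Flock.relOrbit v₀ N (z N) s / N - -(P.cMinus / P.cPlus) ^ (k - 1) * (v₀ / P.cPlus)|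
            < ε) := by
  have hw := Flock.hasSlopes_relOrbit hP hv₀ bc hz k₀
  have hρ : ∀ k : ℕ, -v₀ * (P.cMinus / P.cPlus) ^ k = -(P.cMinus / P.cPlus) ^ k * v₀ := fun k => by
    ring
  refine ⟨fun δ hδ ε hε => ?_, Flock.crossingTime (fun N => Flock.relOrbit v₀ N (z N))
    (1 / P.cPlus) (-(1 / P.cMinus)), Flock.crossingTime_zero _ _ _,
    hw.eventually_isKthCrossing, fun k hk1 hk => ?_, fun ε hε => ?_⟩
  · filter_upwards [hw.vel δ hδ ε hε] with N h k hk t ht h1 h2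
    rw [← hρ]
    rw [Flock.responseTime_eq] at h2
    refine h k hk t ht ?_ h2
    -- For k = 0 the lower limit t_{-1} is not needed: the estimate holds from t = 0 on.
    rcases k with _ | k
    · exact .inr rfl
    · rw [Nat.cast_succ, add_sub_cancel_right, Flock.responseTime_eq, ← Flock.lo_succ] at h1
      exact .inl h1
  · rw [sub_eq_add_neg]
    exact hw.tendsto_crossingTime hk1 hk
  · filter_upwards [hw.eventually_extr hε] with N h k hk1 hk
    obtain ⟨j, rfl⟩ : ∃ j, k = j + 1 := ⟨k - 1, by omega⟩
    rw [add_tsub_cancel_right]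
    refine ⟨(h j hk).1, fun s hs hse => ?_⟩
    convert (h j hk).2 s hs hse using 3
    ring
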